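/- Let $F:\mathbb R\to[0,1]$ be a smooth function supported in $[1/2,2]$ with $\sum_{j\in\mathbb Z}F(x/2^j)=\mathbf 1_{(0,\infty)}(x)$ for all $x$, and put $F_{\le C}(x)=\sum_{j\le 0}F(x/(2^{j}C))$ and $F_{\ge C}(x)=\sum_{j\ge 0}F(x/(2^{j}C))$ for $C>0$. Write $\langle x\rangle=(1+x^2)^{1/2}$, let $e^{it\Delta}$ be the Fourier multiplier on $L^2(\mathbb R)$ with symbol $e^{-it\xi^2}$, and let $D=-i\partial_x$. Let $\sigma>2$ and let $V=V(x,t)$ be a (possibly complex-valued) measurable potential with $\langle x\rangle^{\sigma}V\in L^\infty_{t,x}$ and $\langle x\rangle^{\sigma+1}\partial_xV\in L^\infty_{t,x}$ on $(0,\infty)\times\mathbb R$ ($\partial_x V$ being the weak derivative). Let $u\in C([0,\infty);L^2(\mathbb R))$ be a weak solution of $$i\partial_tu-\Delta u+V(x,t)u=0,\qquad t\ge0,\ x\in\mathbb R,$$ with $\sup_{t\ge0}\|u(t)\|_{H^1(\mathbb R)}<\infty$. Let $0<\alpha<1$ and $0<\delta<\min(1/2,\,1-\alpha)$, and for $t>0$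 set $$J_{\mathrm{free}}(t)=e^{-it\Delta}F_{\le t^\alpha}(|x|)\,e^{it\Delta}F_{\ge t^{-\delta}}(|D|),\qquad u_{\mathrm{wb}}(t)=(I-J_{\mathrm{free}}(t))u(t).$$ Then $e^{it\Delta}J_{\mathrm{free}}(t)u(t)\in H^1$ for every $t>0$, and the strong limit $$u_+=\Omega_{\mathrm{free}}u_0:=\lim_{t\to\infty}e^{it\Delta}J_{\mathrm{free}}(t)u(t)$$ exists in $H^1(\mathbb R)$. Consequently $$u(t)=u_{\mathrm{wb}}(t)+e^{-it\Delta}u_++o_{H^1}(1)\qquad(t\to\infty),$$ where $u_{\mathrm{wb}}$ is asymptotically orthogonal to free waves: $\lim_{t\to\infty}\langle e^{-it\Delta}\phi,u_{\mathrm{wb}}(t)\rangle_{L^2}=0$ for every $\phi\in H^1(\mathbb R)$. -/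

import Mathlib

open MeasureTheory Filter Topology Set
open scoped ENNReal NNReal FourierTransform SchwartzMap ContDiff

noncomputable section

namespace FreeChannel

/-- The Hilbert space `L²(ℝ; ℂ)`. -/
abbrev L2 : Type := Lp ℂ 2 (volume : Measure ℝ)

/-- The Japanese bracket `⟨x⟩ = (1 + x²)^{1/2}`. -/
def jBra (x : ℝ) : ℝ := Real.sqrt (1 + x ^ 2)

/-- Multiplication of an `L²` function by the function `m` (the value `0` is used if the product is
not in `L²`, which does not happen for bounded measurable `m`, see `mulL2_coeFn`). -/
def mulL2 (m : ℝ → ℂ) (f : L2) : L2 :=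
  open Classical in
  if h : MemLp (fun x => m x * f x) 2 (volume : Measure ℝ) then h.toLp else 0

theorem mulL2_coeFn {m : ℝ → ℂ} (hm : Measurable m) {C : ℝ} (hC : ∀ x, ‖m x‖ ≤ C) (f : L2) :
    mulL2 m f =ᵐ[volume] fun x => m x * f x := by
  have h : MemLp (fun x => m x * f x) 2 (volume : Measure ℝ) := by
    refine MemLp.of_le_mul (Lp.memLp f) (hm.aestronglyMeasurable.mul (Lp.aestronglyMeasurable f))
      (c := C) (ae_of_all _ fun x => ?_)
    rw [norm_mul]
    exact mul_le_mul_of_nonneg_right (hC x) (norm_nonneg _)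
  rw [mulL2, dif_pos h]
  exact h.coeFn_toLp

/-- The Fourier multiplier `m(D)`, `D = -i ∂ₓ`. Mathlib's Fourier transform has the kernel
`e^{-2πixξ}`, so that `D` corresponds to multiplication by `2πξ`. -/
def fourierMult (m : ℝ → ℂ) (f : L2) : L2 :=
  𝓕⁻ (mulL2 (fun ξ => m (2 * Real.pi * ξ)) (𝓕 f : L2))

/-- The free Schrödinger propagator `e^{itΔ}`, with symbol `e^{-itξ²}`. -/
def freeProp (t : ℝ) (f : L2) : L2 :=
  fourierMult (fun ξ => Complex.exp (-Complex.I * t * (ξ : ℂ) ^ 2)) f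

/-- The norm of the Sobolev space `H¹(ℝ)`,
`‖f‖_{H¹}² = ∫ (1 + ξ²) |f̂(ξ)|² dξ = ‖f‖²_{L²} + ‖∂ₓf‖²_{L²}`,
as an extended number: `f ∈ H¹` means that it is finite. -/
def h1Norm (f : L2) : ℝ≥0∞ :=
  (∫⁻ ξ : ℝ, ENNReal.ofReal (1 + (2 * Real.pi * ξ) ^ 2) * ‖(𝓕 f : L2) ξ‖ₑ ^ 2) ^ (1 / 2 : ℝ)

/-- A smooth dyadic cutoff: `F : ℝ → [0,1]` is smooth and supported in `[1/2, 2]`, with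
`∑_{j ∈ ℤ} F(x / 2^j) = 1_{(0,∞)}(x)`. -/
structure IsDyadicCutoff (F : ℝ → ℝ) : Prop where
  smooth : ContDiff ℝ ∞ F
  nonneg : ∀ x, 0 ≤ F x
  le_one : ∀ x, F x ≤ 1
  supp : Function.support F ⊆ Icc (1 / 2) 2
  hasSum : ∀ x, HasSum (fun j : ℤ => F (x / 2 ^ j)) (indicator (Ioi 0) (fun _ => (1 : ℝ)) x)

/-- `F_≤(x) = ∑_{j ≤ 0} F(x / 2^j)`. -/
def cutLE (F : ℝ → ℝ) (x : ℝ) : ℝ := ∑' j : ℕ, F (x / 2 ^ (-(j : ℤ)))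

/-- `F_≥(x) = ∑_{j ≥ 0} F(x / 2^j)`. -/
def cutGE (F : ℝ → ℝ) (x : ℝ) : ℝ := ∑' j : ℕ, F (x / 2 ^ (j : ℤ))

/-- The free channel projection
`J_free(t) = e^{-itΔ} F_{≤ t^α}(|x|) e^{itΔ} F_{≥ t^{-δ}}(|D|)`,
where `F_{≤ C}(x) = F_≤(x / C)` and `F_{≥ C}(x) = F_≥(x / C)`. -/
def Jfree (F : ℝ → ℝ) (α δ t : ℝ) (f : L2) : L2 :=
  freeProp (-t)
    (mulL2 (fun x => (cutLE F (|x| / t ^ α) : ℂ))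
      (freeProp t
        (fourierMult (fun ξ => (cutGE F (|ξ| / t ^ (-δ)) : ℂ)) f)))

/-- The measure `dt dx` on `(0, ∞) × ℝ`. -/
def spaceTime : Measure (ℝ × ℝ) := ((volume : Measure ℝ).restrict (Ioi 0)).prod volume

/-- `V = V(t, x)` satisfies `⟨x⟩^σ V ∈ L^∞_{t,x}` and `⟨x⟩^{σ+1} ∂ₓV ∈ L^∞_{t,x}` on
`(0, ∞) × ℝ`, where `∂ₓV` is the weak derivative. -/
def IsDecayingPotential (σ : ℝ) (V : ℝ → ℝ → ℂ) : Prop :=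
  MemLp (fun p : ℝ × ℝ => ((jBra p.2 ^ σ : ℝ) : ℂ) * V p.1 p.2) ∞ spaceTime ∧
  ∃ W : ℝ → ℝ → ℂ,
    MemLp (fun p : ℝ × ℝ => ((jBra p.2 ^ (σ + 1) : ℝ) : ℂ) * W p.1 p.2) ∞ spaceTime ∧
    ∀ᵐ t ∂(volume.restrict (Ioi (0 : ℝ))), ∀ φ : 𝓢(ℝ, ℂ),
      ∫ x, V t x * deriv φ x = -∫ x, W t x * φ x

/-- `u ∈ C([0,∞); L²)` is a weak solution of `i ∂ₜu - Δu + V u = 0`, that is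
`∂ₜu = -iΔu + iVu`, on `[0, ∞) × ℝ`: the equation is tested against Schwartz functions of `x` and
integrated in time. -/
def IsSolution (V : ℝ → ℝ → ℂ) (u : ℝ → L2) : Prop :=
  ContinuousOn u (Ici 0) ∧
  ∀ φ : 𝓢(ℝ, ℂ), ∀ t : ℝ, 0 ≤ t →
    ∫ x, u t x * φ x = (∫ x, u 0 x * φ x) +
      ∫ s in (0 : ℝ)..t,
        (-Complex.I * (∫ x, u s x * deriv (deriv φ) x) +
          Complex.I * ∫ x, V s x * u s x * φ x)

/-- The weakly bound component `u_wb(t) = (I - J_free(t)) u(t)`. -/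
def uWb (F : ℝ → ℝ) (α δ : ℝ) (u : ℝ → L2) (t : ℝ) : L2 := u t - Jfree F α δ t (u t)

end FreeChannel

end

noncomputable section

namespace FreeChannel

/-! Pass to the interaction picture w(t) = e^{itΔ}u(t), which is bounded in H¹ and formally
satisfies ∂ₜw = i e^{itΔ}Vu. Conjugation by the free flow turns J_free(t) into F_{≤t^α}(|x|)
F_{≥t^{-δ}}(|D|) acting on w(t) (`freeProp_Jfree`), so the point is that w(t), localized to |x| ≲
t^α and |D| ≳ t^{-δ}, converges strongly.

The candidate limit u₊ is a weak limit of w along an ultrafilter at infinity. Cook's method is run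
against test functions: the derivative of ∫ w φ at time τ is i∫ V u e^{iτΔ}φ. If |e^{iτΔ}φ(y)| ≤ A
τ^{-2} ⟨y⟩^{3/2} for all τ ≥ t, integration gives |∫ (w(t) - u₊) φ| ≤ K A / t, because ⟨x⟩^{3/2-σ}
is in L² for σ > 2 (`exists_cook_bound`).

The test functions are φ = n(D)(e^{-x²/b²}ψ) with n(ξ) = (e^{-aξ²} - 1)^k, a = t^{2δ}, b = t^β. The
factor n suppresses the frequencies below t^{-δ}, and it makes the kernel of e^{iτΔ}n(D) a k-th
difference, with step a, of the heat kernel in complex time. Cauchy's estimates bound this kernel by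
a multiple of τ^{-1/2} min(X^k, X^{3/4}), where X = a/τ + aY²/τ² and Y is the distance between
source and observer. For sources |x| ≲ b the part of X due to the source is a negative power of t,
so a large k makes X^k negligible; the part due to the observer y contributes τ^{-1/2}(ay²/τ²)^{3/4}
= a^{3/4} τ^{-2} |y|^{3/2}. With √b from the Gaussian this gives A ≲ t^{1-γ}‖ψ‖, where γ = 1 - β/2 -
3δ/2 > 0 (`exists_decay_bound`). By duality in ψ, e^{-x²/b²} n(D)(w(t) - u₊) is O(t^{-γ}) in L².
Testing with φ' in place of φ gives the same for the x-derivative (`exists_scattering_state`).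

It remains to replace the Gaussian cutoffs by the dyadic ones. The frequency cutoff is q(t^δ D) n(D)
with q bounded and Lipschitz, the spatial cutoff is at most e⁴ e^{-x²/b²} once α ≤ β, and exchanging
q(t^δ D) with the Gaussian costs t^{δ-β} (`exists_norm_localize_le`); β = max(α, 1/2) meets all the
constraints. Since the localizations tend strongly to the identity, the localized w(t) tends to u₊,
and the product rule upgrades this to H¹ at the cost of t^{-α}. The same vanishing shows that w(t) -
u₊ tends weakly to 0 (`tendsto_inner_of_localize`), which is the orthogonality to free waves. -/

/-- Bounded measurable symbols. -/
structure IsSymbol (m : ℝ → ℂ) : Prop where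
  meas : Measurable m
  bdd : ∃ C : ℝ, ∀ x, ‖m x‖ ≤ C

/-! ### Bounded symbols and multiplication operators on L². -/

namespace IsSymbol

variable {m m' : ℝ → ℂ}

theorem of_bound (hm : Measurable m) {C : ℝ} (hC : ∀ x, ‖m x‖ ≤ C) : IsSymbol m := ⟨hm, C, hC⟩

theorem mul (h : IsSymbol m) (h' : IsSymbol m') : IsSymbol (fun x => m x * m' x) := by
  obtain ⟨C, hC⟩ := h.bdd
  obtain ⟨C', hC'⟩ := h'.bdd
  refine ⟨h.meas.mul h'.meas, C * C', fun x => ?_⟩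
  rw [norm_mul]
  exact mul_le_mul (hC x) (hC' x) (norm_nonneg _) ((norm_nonneg _).trans (hC x))

theorem sub (h : IsSymbol m) (h' : IsSymbol m') : IsSymbol (fun x => m x - m' x) := by
  obtain ⟨C, hC⟩ := h.bdd
  obtain ⟨C', hC'⟩ := h'.bdd
  exact ⟨h.meas.sub h'.meas, C + C', fun x => (norm_sub_le _ _).trans (add_le_add (hC x) (hC' x))⟩

theorem comp (h : IsSymbol m) {g : ℝ → ℝ} (hg : Measurable g) : IsSymbol (fun x => m (g x)) := by
  obtain ⟨C, hC⟩ := h.bdd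
  exact ⟨h.meas.comp hg, C, fun x => hC _⟩

theorem star (h : IsSymbol m) : IsSymbol (fun x => starRingEnd ℂ (m x)) := by
  obtain ⟨C, hC⟩ := h.bdd
  refine ⟨Complex.continuous_conj.measurable.comp h.meas, C, fun x => ?_⟩
  rw [RCLike.norm_conj]
  exact hC x

theorem scale (h : IsSymbol m) : IsSymbol (fun x => m (2 * Real.pi * x)) :=
  h.comp (measurable_const.mul measurable_id)

end IsSymbol

theorem IsSymbol.one : IsSymbol (fun _ => 1) := ⟨measurable_const, 1, fun _ => by simp⟩

theorem norm_sq_eq_integral (f : L2) : ‖f‖ ^ 2 = ∫ x, ‖f x‖ ^ 2 := by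
  rw [← @inner_self_eq_norm_sq ℂ, L2.inner_def, ← integral_re (L2.integrable_inner f f)]
  simp_rw [inner_self_eq_norm_sq]

section MulL2

variable {m m' : ℝ → ℂ}

theorem mulL2_coe (h : IsSymbol m) (f : L2) : mulL2 m f =ᵐ[volume] fun x => m x * f x :=
  h.bdd.elim fun _ hC => mulL2_coeFn h.meas hC f

theorem norm_mulL2_le (h : IsSymbol m) {C : ℝ} (hC : ∀ x, ‖m x‖ ≤ C) (f : L2) :
    ‖mulL2 m f‖ ≤ C * ‖f‖ := by
  apply Lp.norm_le_mul_norm_of_ae_le_mul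
  filter_upwards [mulL2_coe h f] with x hx
  rw [hx, norm_mul]
  exact mul_le_mul_of_nonneg_right (hC x) (norm_nonneg _)

theorem norm_mulL2_le_norm_mulL2 (h : IsSymbol m) (h' : IsSymbol m') {C : ℝ}
    (hC : ∀ᵐ x, ‖m x‖ ≤ C * ‖m' x‖) (f : L2) : ‖mulL2 m f‖ ≤ C * ‖mulL2 m' f‖ := by
  apply Lp.norm_le_mul_norm_of_ae_le_mul
  filter_upwards [mulL2_coe h f, mulL2_coe h' f, hC] with x hx hx' hc
  rw [hx, hx', norm_mul, norm_mul, ← mul_assoc]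
  exact mul_le_mul_of_nonneg_right hc (norm_nonneg _)

theorem mulL2_add (h : IsSymbol m) (f g : L2) : mulL2 m (f + g) = mulL2 m f + mulL2 m g := by
  apply Lp.ext
  filter_upwards [mulL2_coe h f, mulL2_coe h g, mulL2_coe h (f + g), Lp.coeFn_add f g,
    Lp.coeFn_add (mulL2 m f) (mulL2 m g)] with x h1 h2 h3 h4 h5
  rw [h3, h5, Pi.add_apply, h1, h2, h4, Pi.add_apply, mul_add]

theorem mulL2_sub (h : IsSymbol m) (f g : L2) : mulL2 m (f - g) = mulL2 m f - mulL2 m g := by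
  apply Lp.ext
  filter_upwards [mulL2_coe h f, mulL2_coe h g, mulL2_coe h (f - g), Lp.coeFn_sub f g,
    Lp.coeFn_sub (mulL2 m f) (mulL2 m g)] with x h1 h2 h3 h4 h5
  rw [h3, h5, Pi.sub_apply, h1, h2, h4, Pi.sub_apply, mul_sub]

theorem mulL2_mulL2 (h : IsSymbol m) (h' : IsSymbol m') (f : L2) :
    mulL2 m (mulL2 m' f) = mulL2 (fun x => m x * m' x) f := by
  apply Lp.ext
  filter_upwards [mulL2_coe h (mulL2 m' f), mulL2_coe h' f, mulL2_coe (h.mul h') f]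
    with x h1 h2 h3
  rw [h1, h2, h3, mul_assoc]

theorem mulL2_one (f : L2) : mulL2 (fun _ => 1) f = f := by
  apply Lp.ext
  filter_upwards [mulL2_coe IsSymbol.one f] with x h1
  rw [h1, one_mul]

theorem mulL2_symbol_sub (h : IsSymbol m) (h' : IsSymbol m') (f : L2) :
    mulL2 (fun x => m x - m' x) f = mulL2 m f - mulL2 m' f := by
  apply Lp.ext
  filter_upwards [mulL2_coe (h.sub h') f, mulL2_coe h f, mulL2_coe h' f,
    Lp.coeFn_sub (mulL2 m f) (mulL2 m' f)] with x h1 h2 h3 h4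
  rw [h1, h4, Pi.sub_apply, h2, h3, sub_mul]

theorem inner_mulL2 (h : IsSymbol m) (f g : L2) :
    inner ℂ f (mulL2 m g) = inner ℂ (mulL2 (fun x => starRingEnd ℂ (m x)) f) g := by
  rw [L2.inner_def, L2.inner_def]
  apply integral_congr_ae
  filter_upwards [mulL2_coe h g, mulL2_coe h.star f] with x h1 h2
  rw [h1, h2]
  simp only [RCLike.inner_apply, map_mul, Complex.conj_conj]
  ring

theorem mulL2_congr (h : IsSymbol m) (h' : IsSymbol m') (hmm : ∀ᵐ x, m x = m' x) (f : L2) :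
    mulL2 m f = mulL2 m' f := by
  apply Lp.ext
  filter_upwards [mulL2_coe h f, mulL2_coe h' f, hmm] with x h1 h2 h3
  rw [h1, h2, h3]

/-- Dominated convergence for the squared norm: the integrand is dominated by ((C + C')|f|)². -/
theorem tendsto_mulL2 {ι : Type*} {l : Filter ι} [l.IsCountablyGenerated] {M : ι → ℝ → ℂ}
    (hM : ∀ i, IsSymbol (M i)) {C : ℝ} (hC : ∀ i x, ‖M i x‖ ≤ C)
    (hlim : ∀ᵐ x, Tendsto (fun i => M i x) l (𝓝 (m x))) (h : IsSymbol m) (f : L2) :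
    Tendsto (fun i => mulL2 (M i) f) l (𝓝 (mulL2 m f)) := by
  obtain ⟨C', hC'⟩ := h.bdd
  rw [tendsto_iff_norm_sub_tendsto_zero]
  have hsq : Tendsto (fun i => ‖mulL2 (M i) f - mulL2 m f‖ ^ 2) l (𝓝 0) := by
    have hint : Integrable (fun x => ((C + C') * ‖f x‖) ^ 2) := by
      simp_rw [mul_pow]
      exact ((memLp_two_iff_integrable_sq_norm (Lp.aestronglyMeasurable f)).1
        (Lp.memLp f)).const_mul _
    have key : ∀ i, ‖mulL2 (M i) f - mulL2 m f‖ ^ 2 = ∫ x, ‖(M i x - m x) * f x‖ ^ 2 := by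
      intro i
      rw [← mulL2_symbol_sub (hM i) h, norm_sq_eq_integral]
      apply integral_congr_ae
      filter_upwards [mulL2_coe ((hM i).sub h) f] with x hx
      rw [hx]
    simp_rw [key]
    have : (0 : ℝ) = ∫ _ : ℝ, (0 : ℝ) := by simp
    rw [this]
    refine tendsto_integral_filter_of_dominated_convergence _ (Eventually.of_forall fun i => ?_)
      (Eventually.of_forall fun i => ae_of_all _ fun x => ?_) hint ?_
    · exact (((hM i).sub h).meas.aestronglyMeasurable.mul
        (Lp.aestronglyMeasurable f)).norm.pow 2
    · rw [norm_pow, norm_norm, norm_mul]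
      gcongr
      exact (norm_sub_le _ _).trans (add_le_add (hC i x) (hC' x))
    · filter_upwards [hlim] with x hx
      have := (((hx.sub_const (m x)).mul_const (f x)).norm).pow 2
      simpa using this
  have := hsq.sqrt
  simpa [Real.sqrt_sq (norm_nonneg _)] using this

end MulL2

/-! ### Fourier multipliers on L². -/

section FourierMult

variable {m m' : ℝ → ℂ}

theorem fourier_fourierMult (m : ℝ → ℂ) (f : L2) :
    (𝓕 (fourierMult m f) : L2) = mulL2 (fun ξ => m (2 * Real.pi * ξ)) (𝓕 f : L2) := by
  rw [fourierMult, FourierTransform.fourier_fourierInv_eq]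

theorem norm_fourierMult (m : ℝ → ℂ) (f : L2) :
    ‖fourierMult m f‖ = ‖mulL2 (fun ξ => m (2 * Real.pi * ξ)) (𝓕 f : L2)‖ := by
  rw [← Lp.norm_fourier_eq, fourier_fourierMult]

theorem norm_fourierMult_le (h : IsSymbol m) {C : ℝ} (hC : ∀ x, ‖m x‖ ≤ C) (f : L2) :
    ‖fourierMult m f‖ ≤ C * ‖f‖ := by
  rw [norm_fourierMult, ← Lp.norm_fourier_eq f]
  exact norm_mulL2_le h.scale (fun x => hC _) _

theorem fourierMult_add (h : IsSymbol m) (f g : L2) :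
    fourierMult m (f + g) = fourierMult m f + fourierMult m g := by
  simp only [fourierMult, FourierTransform.fourier_add, mulL2_add h.scale,
    FourierTransform.fourierInv_add]

theorem fourierMult_sub (h : IsSymbol m) (f g : L2) :
    fourierMult m (f - g) = fourierMult m f - fourierMult m g := by
  have := fourierMult_add h (f - g) g
  rw [sub_add_cancel] at this
  rw [this, add_sub_cancel_right]

theorem fourierMult_fourierMult (h : IsSymbol m) (h' : IsSymbol m') (f : L2) :
    fourierMult m (fourierMult m' f) = fourierMult (fun x => m x * m' x) f := by
  rw [fourierMult, fourier_fourierMult, mulL2_mulL2 h.scale h'.scale, fourierMult]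

theorem fourierMult_one (f : L2) : fourierMult (fun _ => 1) f = f := by
  rw [fourierMult, mulL2_one, FourierTransform.fourierInv_fourier_eq]

theorem inner_fourierMult (h : IsSymbol m) (f g : L2) :
    inner ℂ f (fourierMult m g) = inner ℂ (fourierMult (fun x => starRingEnd ℂ (m x)) f) g := by
  rw [← Lp.inner_fourier_eq, ← Lp.inner_fourier_eq (fourierMult _ f), fourier_fourierMult,
    fourier_fourierMult, inner_mulL2 h.scale]

theorem tendsto_fourierMult {ι : Type*} {l : Filter ι} [l.IsCountablyGenerated] {M : ι → ℝ → ℂ}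
    (hM : ∀ i, IsSymbol (M i)) {C : ℝ} (hC : ∀ i x, ‖M i x‖ ≤ C)
    (hlim : ∀ᵐ x, Tendsto (fun i => M i (2 * Real.pi * x)) l (𝓝 (m (2 * Real.pi * x))))
    (h : IsSymbol m) (f : L2) :
    Tendsto (fun i => fourierMult (M i) f) l (𝓝 (fourierMult m f)) := by
  have := tendsto_mulL2 (fun i => (hM i).scale) (fun i x => hC i _) hlim h.scale (𝓕 f : L2)
  exact (Lp.fourierTransformₗᵢ ℝ ℂ).symm.continuous.continuousAt.tendsto.comp this

end FourierMult

/-! ### Duality between L² and Schwartz functions. -/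

section Pairing

/-- The bilinear pairing `∫ f φ` of an `L²` function with a Schwartz function. -/
def pair (f : L2) (φ : 𝓢(ℝ, ℂ)) : ℂ := ∫ x, f x * φ x

theorem norm_star_sub_star (f g : L2) : ‖star f - star g‖ = ‖f - g‖ := by
  rw [Lp.norm_def, Lp.norm_def]
  congr 1
  apply eLpNorm_congr_norm_ae
  filter_upwards [Lp.coeFn_sub (star f) (star g), Lp.coeFn_sub f g, Lp.coeFn_star f,
    Lp.coeFn_star g] with x h1 h2 h3 h4
  rw [h1, h2, Pi.sub_apply, Pi.sub_apply, h3, h4, Pi.star_apply, Pi.star_apply, ← star_sub,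
    norm_star]

theorem norm_star_L2 (f : L2) : ‖star f‖ = ‖f‖ := by
  rw [Lp.norm_def, Lp.norm_def]
  congr 1
  apply eLpNorm_congr_norm_ae
  filter_upwards [Lp.coeFn_star f] with x h3
  rw [h3, Pi.star_apply, norm_star]

theorem continuous_star_L2 : Continuous (star : L2 → L2) :=
  (Isometry.of_dist_eq fun f g => by
    rw [dist_eq_norm, dist_eq_norm, norm_star_sub_star]).continuous

theorem pair_eq_inner (f : L2) (φ : 𝓢(ℝ, ℂ)) :
    pair f φ = inner ℂ (star (φ.toLp 2 : L2)) f := by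
  rw [pair, L2.inner_def]
  apply integral_congr_ae
  filter_upwards [Lp.coeFn_star (φ.toLp 2 volume : L2), φ.coeFn_toLp 2 volume] with x h1 h2
  rw [h1, Pi.star_apply, h2]
  simp

theorem integrable_pair (f : L2) (φ : 𝓢(ℝ, ℂ)) : Integrable fun x => f x * φ x :=
  MemLp.integrable_mul (Lp.memLp f) (φ.memLp 2)

theorem norm_pair_le (f : L2) (φ : 𝓢(ℝ, ℂ)) : ‖pair f φ‖ ≤ ‖f‖ * ‖(φ.toLp 2 : L2)‖ := by
  rw [pair_eq_inner, mul_comm]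
  exact (norm_inner_le_norm _ _).trans (by rw [norm_star_L2])

theorem pair_add_left (f g : L2) (φ : 𝓢(ℝ, ℂ)) : pair (f + g) φ = pair f φ + pair g φ := by
  simp only [pair_eq_inner, inner_add_right]

theorem pair_sub_left (f g : L2) (φ : 𝓢(ℝ, ℂ)) : pair (f - g) φ = pair f φ - pair g φ := by
  simp only [pair_eq_inner, inner_sub_right]

theorem pair_add_right (f : L2) (φ ψ : 𝓢(ℝ, ℂ)) : pair f (φ + ψ) = pair f φ + pair f ψ := by
  simp only [pair, add_apply, mul_add]
  exact integral_add (integrable_pair f φ) (integrable_pair f ψ)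

theorem pair_sub_right (f : L2) (φ ψ : 𝓢(ℝ, ℂ)) : pair f (φ - ψ) = pair f φ - pair f ψ := by
  simp only [pair, sub_apply, mul_sub]
  exact integral_sub (integrable_pair f φ) (integrable_pair f ψ)

theorem pair_smul_right (f : L2) (c : ℂ) (φ : 𝓢(ℝ, ℂ)) : pair f (c • φ) = c * pair f φ := by
  simp only [pair, smul_apply, smul_eq_mul, mul_left_comm _ c]
  exact integral_const_mul c _

/-- By density of the Schwartz functions the bound extends to all of L². The pairing is bilinear, so
the extremal test function is the conjugate of `f`. -/
theorem norm_le_of_pair {f : L2} {c : ℝ} (hc : 0 ≤ c)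
    (h : ∀ φ : 𝓢(ℝ, ℂ), ‖pair f φ‖ ≤ c * ‖(φ.toLp 2 : L2)‖) : ‖f‖ ≤ c := by
  have key : ∀ g : L2, ‖inner ℂ (star g) f‖ ≤ c * ‖g‖ := by
    intro g
    refine (SchwartzMap.denseRange_toLpCLM (E := ℝ) (F := ℂ) (p := 2) (μ := volume)
      ENNReal.ofNat_ne_top).induction_on g ?_ ?_
    · exact isClosed_le ((continuous_star_L2.inner continuous_const).norm)
        (continuous_const.mul continuous_norm)
    · intro φ
      have := h φ
      rwa [pair_eq_inner] at this
  have h1 := key (star f)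
  rw [star_star, norm_star_L2, inner_self_eq_norm_sq_to_K, norm_pow] at h1
  simp only [Complex.coe_algebraMap, Complex.norm_real, norm_norm] at h1
  rcases (norm_nonneg f).eq_or_lt with h0 | h0
  · rwa [← h0]
  · nlinarith

theorem eq_of_pair {f g : L2} (h : ∀ φ : 𝓢(ℝ, ℂ), pair f φ = pair g φ) : f = g := by
  have : ‖f - g‖ ≤ 0 := norm_le_of_pair le_rfl fun φ => by simp [pair_sub_left, h φ]
  exact sub_eq_zero.1 (norm_le_zero_iff.1 this)

theorem pair_fourier (f : L2) (φ : 𝓢(ℝ, ℂ)) : pair (𝓕 f : L2) φ = pair f (𝓕 φ) := by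
  have := congrArg (fun T => T φ) (Lp.fourier_toTemperedDistribution_eq f)
  simp only [TemperedDistribution.fourier_apply, Lp.toTemperedDistribution_apply,
    smul_eq_mul] at this
  simp only [pair, mul_comm _ (φ _), mul_comm _ ((𝓕 φ) _), this]

theorem pair_fourierInv (f : L2) (φ : 𝓢(ℝ, ℂ)) : pair (𝓕⁻ f : L2) φ = pair f (𝓕⁻ φ) := by
  have h1 : 𝓕 (𝓕⁻ φ) = φ := FourierTransform.fourier_fourierInv_eq φ
  have h2 : (𝓕 (𝓕⁻ f : L2) : L2) = f := FourierTransform.fourier_fourierInv_eq f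
  rw [← h1, ← pair_fourier, h1, h2]

theorem pair_mulL2 {m : ℝ → ℂ} (h : IsSymbol m) (hm : m.HasTemperateGrowth) (f : L2)
    (φ : 𝓢(ℝ, ℂ)) : pair (mulL2 m f) φ = pair f (SchwartzMap.smulLeftCLM ℂ m φ) := by
  apply integral_congr_ae
  filter_upwards [mulL2_coe h f] with x hx
  rw [hx, SchwartzMap.smulLeftCLM_apply_apply hm, smul_eq_mul]
  ring

/-- The transpose of the Fourier multiplier `m(D)` on Schwartz functions. -/
def schwartzMult (m : ℝ → ℂ) : 𝓢(ℝ, ℂ) →L[ℂ] 𝓢(ℝ, ℂ) :=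
  (FourierTransform.fourierCLM ℂ 𝓢(ℝ, ℂ)) ∘L
    (SchwartzMap.smulLeftCLM ℂ fun ξ => m (2 * Real.pi * ξ)) ∘L
      (FourierTransform.fourierInvCLM ℂ 𝓢(ℝ, ℂ))

theorem schwartzMult_apply (m : ℝ → ℂ) (φ : 𝓢(ℝ, ℂ)) : schwartzMult m φ =
    𝓕 (SchwartzMap.smulLeftCLM ℂ (fun ξ => m (2 * Real.pi * ξ)) (𝓕⁻ φ)) := rfl

theorem temperate_scale {m : ℝ → ℂ} (hm : m.HasTemperateGrowth) :
    (fun ξ : ℝ => m (2 * Real.pi * ξ)).HasTemperateGrowth := by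
  have : (fun ξ : ℝ => 2 * Real.pi * ξ).HasTemperateGrowth := by fun_prop
  exact hm.comp this

theorem pair_fourierMult {m : ℝ → ℂ} (h : IsSymbol m) (hm : m.HasTemperateGrowth) (f : L2)
    (φ : 𝓢(ℝ, ℂ)) : pair (fourierMult m f) φ = pair f (schwartzMult m φ) := by
  rw [fourierMult, pair_fourierInv, pair_mulL2 h.scale (temperate_scale hm), pair_fourier,
    schwartzMult_apply]

theorem schwartzMult_schwartzMult {m m' : ℝ → ℂ} (hm : m.HasTemperateGrowth)
    (hm' : m'.HasTemperateGrowth) (φ : 𝓢(ℝ, ℂ)) :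
    schwartzMult m (schwartzMult m' φ) = schwartzMult (fun x => m x * m' x) φ := by
  rw [schwartzMult_apply, schwartzMult_apply, FourierTransform.fourierInv_fourier_eq,
    SchwartzMap.smulLeftCLM_smulLeftCLM_apply (temperate_scale hm) (temperate_scale hm'),
    schwartzMult_apply]
  rfl

theorem norm_schwartzMult_le {m m' : ℝ → ℂ} (hm : m.HasTemperateGrowth)
    (hm' : m'.HasTemperateGrowth) {C : ℝ} (hC : ∀ x, ‖m x‖ ≤ C * ‖m' x‖) (φ : 𝓢(ℝ, ℂ)) :
    ‖((schwartzMult m φ).toLp 2 : L2)‖ ≤ C * ‖((schwartzMult m' φ).toLp 2 : L2)‖ := by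
  rw [schwartzMult_apply, schwartzMult_apply, SchwartzMap.norm_fourier_toL2_eq,
    SchwartzMap.norm_fourier_toL2_eq]
  apply Lp.norm_le_mul_norm_of_ae_le_mul
  filter_upwards [SchwartzMap.coeFn_toLp (SchwartzMap.smulLeftCLM ℂ
    (fun ξ => m (2 * Real.pi * ξ)) (𝓕⁻ φ)) 2 volume, SchwartzMap.coeFn_toLp
    (SchwartzMap.smulLeftCLM ℂ (fun ξ => m' (2 * Real.pi * ξ)) (𝓕⁻ φ)) 2 volume] with x h1 h2
  rw [h1, h2, SchwartzMap.smulLeftCLM_apply_apply (temperate_scale hm),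
    SchwartzMap.smulLeftCLM_apply_apply (temperate_scale hm'), norm_smul, norm_smul, ← mul_assoc]
  exact mul_le_mul_of_nonneg_right (hC _) (norm_nonneg _)

end Pairing

/-! ### Weak derivatives and the H¹ norm. -/

/-- Weak derivatives in `L²`, tested against Schwartz functions. -/
def IsWeakDeriv (f g : L2) : Prop :=
  ∀ φ : 𝓢(ℝ, ℂ), pair f (SchwartzMap.derivCLM ℂ ℂ φ) = -pair g φ

theorem temperate_neg_I_mul : (fun ξ : ℝ => -Complex.I * (ξ : ℂ)).HasTemperateGrowth := by
  have : (fun ξ : ℝ => (ξ : ℂ)).HasTemperateGrowth := Function.Complex.hasTemperateGrowth_ofReal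
  fun_prop

theorem integrable_id_smul_schwartz (φ : 𝓢(ℝ, ℂ)) : Integrable fun x : ℝ => x • φ x := by
  have := φ.integrable_pow_mul volume 1
  refine this.mono (by fun_prop) (ae_of_all _ fun x => ?_)
  simp

/-- The transform and its inverse stand in the opposite order to that in `fourierMult`, so ∂ₓ has
the symbol -iξ here instead of iξ. -/
theorem derivCLM_eq_schwartzMult (φ : 𝓢(ℝ, ℂ)) :
    SchwartzMap.derivCLM ℂ ℂ φ = schwartzMult (fun ξ => -Complex.I * ξ) φ := by
  ext x
  have h1 : 𝓕 (𝓕⁻ φ) = φ := FourierTransform.fourier_fourierInv_eq φ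
  rw [SchwartzMap.derivCLM_apply, schwartzMult_apply]
  conv_lhs => rw [← h1]
  rw [SchwartzMap.fourier_coe, SchwartzMap.fourier_coe,
    Real.deriv_fourier (𝓕⁻ φ).integrable (integrable_id_smul_schwartz _)]
  refine congrFun (congrArg _ (funext fun ξ => ?_)) x
  rw [SchwartzMap.smulLeftCLM_apply_apply (temperate_scale temperate_neg_I_mul)]
  push_cast
  congr 1
  ring

theorem derivCLM_schwartzMult {m : ℝ → ℂ} (hm : m.HasTemperateGrowth) (φ : 𝓢(ℝ, ℂ)) :
    SchwartzMap.derivCLM ℂ ℂ (schwartzMult m φ) = schwartzMult m (SchwartzMap.derivCLM ℂ ℂ φ) := by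
  rw [derivCLM_eq_schwartzMult, derivCLM_eq_schwartzMult,
    schwartzMult_schwartzMult temperate_neg_I_mul hm,
    schwartzMult_schwartzMult hm temperate_neg_I_mul]
  simp_rw [mul_comm]

theorem pair_derivCLM (f : L2) (φ : 𝓢(ℝ, ℂ)) : pair f (SchwartzMap.derivCLM ℂ ℂ φ) =
    ∫ ξ, -((2 * Real.pi * Complex.I * ξ) * (𝓕 f : L2) ξ) * (𝓕⁻ φ) ξ := by
  have h2 : (𝓕⁻ (𝓕 f : L2) : L2) = f := FourierTransform.fourierInv_fourier_eq f
  have h3 : ∀ ψ : 𝓢(ℝ, ℂ), 𝓕⁻ (𝓕 ψ) = ψ := fun ψ => FourierTransform.fourierInv_fourier_eq ψ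
  conv_lhs => rw [← h2, pair_fourierInv, derivCLM_eq_schwartzMult, schwartzMult_apply, h3]
  apply integral_congr_ae
  refine ae_of_all _ fun ξ => ?_
  simp only
  rw [SchwartzMap.smulLeftCLM_apply_apply (temperate_scale temperate_neg_I_mul), smul_eq_mul]
  push_cast
  ring

theorem pair_eq_fourier (g : L2) (φ : 𝓢(ℝ, ℂ)) :
    pair g φ = ∫ ξ, (𝓕 g : L2) ξ * (𝓕⁻ φ) ξ := by
  have h2 : (𝓕⁻ (𝓕 g : L2) : L2) = g := FourierTransform.fourierInv_fourier_eq g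
  conv_lhs => rw [← h2, pair_fourierInv]
  rfl

/-- The function ξ f̂(ξ) is a priori only locally integrable. Testing on Fourier transforms of
smooth compactly supported functions therefore suffices, by the fundamental lemma of the calculus of
variations. This allows the H¹ norm to be handled through pairs (f, ∂ₓf) in L². -/
theorem isWeakDeriv_iff {f g : L2} : IsWeakDeriv f g ↔
    (𝓕 g : L2) =ᵐ[volume] fun ξ => (2 * Real.pi * Complex.I * ξ) * (𝓕 f : L2) ξ := by
  constructor
  · intro h
    have hloc : LocallyIntegrable
        (fun ξ : ℝ => (2 * Real.pi * Complex.I * ξ) * (𝓕 f : L2) ξ - (𝓕 g : L2) ξ) := by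
      have h1 : LocallyIntegrable (𝓕 f : L2) volume :=
        (Lp.memLp (𝓕 f : L2)).locallyIntegrable (by norm_num)
      have h2 : LocallyIntegrable (𝓕 g : L2) volume :=
        (Lp.memLp (𝓕 g : L2)).locallyIntegrable (by norm_num)
      refine LocallyIntegrable.sub ?_ h2
      rw [locallyIntegrable_iff] at h1 ⊢
      intro K hK
      exact (h1 K hK).continuousOn_mul (by fun_prop) hK
    have := ae_eq_zero_of_integral_contDiff_smul_eq_zero hloc ?_
    · filter_upwards [this] with ξ hξ
      exact (sub_eq_zero.1 hξ).symm
    · intro θ hθ hc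
      have hc' : HasCompactSupport (fun x => (θ x : ℂ)) :=
        hc.comp_left (g := fun r : ℝ => (r : ℂ)) (by simp)
      have hθ' : ContDiff ℝ ∞ (fun x => (θ x : ℂ)) := Complex.ofRealCLM.contDiff.comp hθ
      set ψ : 𝓢(ℝ, ℂ) := hc'.toSchwartzMap hθ'
      have h4 := h (𝓕 ψ)
      have h3 : 𝓕⁻ (𝓕 ψ) = ψ := FourierTransform.fourierInv_fourier_eq ψ
      rw [pair_derivCLM, pair_eq_fourier, h3] at h4
      have h5 : ∀ x, ψ x = (θ x : ℂ) := fun x => rfl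
      have i1 : Integrable fun ξ : ℝ => (2 * Real.pi * Complex.I * ξ) * (𝓕 f : L2) ξ * ψ ξ := by
        have := integrable_pair (𝓕 f : L2)
          (SchwartzMap.smulLeftCLM ℂ (fun ξ => -Complex.I * ((2 * Real.pi * ξ : ℝ) : ℂ)) ψ)
        refine (this.neg).congr (ae_of_all _ fun ξ => ?_)
        simp only [Pi.neg_apply]
        rw [SchwartzMap.smulLeftCLM_apply_apply (temperate_scale temperate_neg_I_mul),
          smul_eq_mul]
        push_cast
        ring
      have i2 := integrable_pair (𝓕 g : L2) ψ
      have h6 : ∀ ξ : ℝ, θ ξ • ((2 * Real.pi * Complex.I * ξ) * (𝓕 f : L2) ξ - (𝓕 g : L2) ξ)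
          = (2 * Real.pi * Complex.I * ξ) * (𝓕 f : L2) ξ * ψ ξ - (𝓕 g : L2) ξ * ψ ξ := by
        intro ξ
        rw [h5, Complex.real_smul]
        ring
      simp_rw [h6]
      rw [integral_sub i1 i2]
      simp_rw [neg_mul] at h4
      rw [integral_neg, neg_inj] at h4
      rw [h4, sub_self]
  · intro h φ
    rw [pair_derivCLM, pair_eq_fourier, ← integral_neg]
    apply integral_congr_ae
    filter_upwards [h] with ξ hξ
    rw [hξ]
    ring

theorem IsWeakDeriv.sub {f g f' g' : L2} (h : IsWeakDeriv f g) (h' : IsWeakDeriv f' g') :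
    IsWeakDeriv (f - f') (g - g') := fun φ => by
  rw [pair_sub_left, pair_sub_left, h, h']
  ring

theorem IsWeakDeriv.fourierMult {f g : L2} (h : IsWeakDeriv f g) {m : ℝ → ℂ} (hm : IsSymbol m) :
    IsWeakDeriv (fourierMult m f) (fourierMult m g) := by
  rw [isWeakDeriv_iff] at h ⊢
  rw [fourier_fourierMult, fourier_fourierMult]
  filter_upwards [h, mulL2_coe hm.scale (𝓕 f : L2), mulL2_coe hm.scale (𝓕 g : L2)] with x h1 h2 h3
  rw [h2, h3, h1]
  ring

theorem lintegral_enorm_sq (f : L2) : ∫⁻ x, ‖f x‖ₑ ^ 2 = ENNReal.ofReal (‖f‖ ^ 2) := by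
  rw [norm_sq_eq_integral, ofReal_integral_eq_lintegral_ofReal]
  · congr 1
    ext x
    rw [ENNReal.ofReal_pow (norm_nonneg _), ofReal_norm]
  · exact (memLp_two_iff_integrable_sq_norm (Lp.aestronglyMeasurable f)).1 (Lp.memLp f)
  · exact ae_of_all _ fun x => by positivity

theorem h1Norm_eq {f g : L2} (h : IsWeakDeriv f g) :
    h1Norm f = ENNReal.ofReal (Real.sqrt (‖f‖ ^ 2 + ‖g‖ ^ 2)) := by
  have key : ∫⁻ ξ : ℝ, ENNReal.ofReal (1 + (2 * Real.pi * ξ) ^ 2) * ‖(𝓕 f : L2) ξ‖ₑ ^ 2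
      = ENNReal.ofReal (‖f‖ ^ 2 + ‖g‖ ^ 2) := by
    rw [ENNReal.ofReal_add (by positivity) (by positivity), ← Lp.norm_fourier_eq f,
      ← Lp.norm_fourier_eq g, ← lintegral_enorm_sq, ← lintegral_enorm_sq,
      ← lintegral_add_left' ((Lp.aestronglyMeasurable (𝓕 f : L2)).enorm.pow_const 2)]
    apply lintegral_congr_ae
    filter_upwards [isWeakDeriv_iff.1 h] with ξ hξ
    have hn : ‖2 * (Real.pi : ℂ) * Complex.I * ξ‖ₑ ^ 2 =
        ENNReal.ofReal ((2 * Real.pi * ξ) ^ 2) := by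
      rw [← ofReal_norm, ← ENNReal.ofReal_pow (norm_nonneg _)]
      congr 1
      simp only [norm_mul, Complex.norm_I, Complex.norm_real, Complex.norm_ofNat, mul_pow,
        Real.norm_eq_abs, sq_abs]
      ring
    rw [ENNReal.ofReal_add zero_le_one (by positivity), add_mul, ENNReal.ofReal_one, one_mul, hξ,
      enorm_mul, mul_pow ‖_‖ₑ, hn]
  rw [h1Norm, key, Real.sqrt_eq_rpow, ENNReal.ofReal_rpow_of_nonneg (by positivity) (by norm_num)]

theorem h1Norm_le {f g : L2} (h : IsWeakDeriv f g) : h1Norm f ≤ ENNReal.ofReal (‖f‖ + ‖g‖) := by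
  rw [h1Norm_eq h]
  apply ENNReal.ofReal_le_ofReal
  rw [Real.sqrt_le_left (by positivity)]
  nlinarith [norm_nonneg f, norm_nonneg g]

theorem norm_le_of_h1Norm_le {f g : L2} (h : IsWeakDeriv f g) {M : ℝ≥0} (hM : h1Norm f ≤ M) :
    ‖f‖ ≤ M ∧ ‖g‖ ≤ M := by
  rw [h1Norm_eq h, ENNReal.ofReal_le_iff_le_toReal ENNReal.coe_ne_top,
    ENNReal.coe_toReal] at hM
  constructor
  · exact (Real.le_sqrt_of_sq_le (by nlinarith [sq_nonneg ‖g‖])).trans hM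
  · exact (Real.le_sqrt_of_sq_le (by nlinarith [sq_nonneg ‖f‖])).trans hM

theorem exists_isWeakDeriv {f : L2} (h : h1Norm f < ⊤) : ∃ g, IsWeakDeriv f g := by
  have hfin : ∫⁻ ξ : ℝ, ENNReal.ofReal (1 + (2 * Real.pi * ξ) ^ 2) * ‖(𝓕 f : L2) ξ‖ₑ ^ 2 < ⊤ := by
    by_contra hc
    rw [not_lt, top_le_iff] at hc
    rw [h1Norm, hc, ENNReal.top_rpow_of_pos (by norm_num)] at h
    exact lt_irrefl _ h
  have hmeas : AEStronglyMeasurable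
      (fun ξ : ℝ => (2 * Real.pi * Complex.I * ξ) * (𝓕 f : L2) ξ) volume :=
    (Continuous.aestronglyMeasurable (by fun_prop)).mul (Lp.aestronglyMeasurable _)
  have hmem : MemLp (fun ξ : ℝ => (2 * Real.pi * Complex.I * ξ) * (𝓕 f : L2) ξ) 2 volume := by
    rw [memLp_two_iff_integrable_sq_norm hmeas]
    refine ⟨hmeas.norm.pow 2, lt_of_le_of_lt (lintegral_mono fun ξ => ?_) hfin⟩
    rw [← ofReal_norm, ← ofReal_norm, ← ENNReal.ofReal_pow (norm_nonneg _),
      ← ENNReal.ofReal_mul (by positivity)]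
    apply ENNReal.ofReal_le_ofReal
    simp only [norm_pow, norm_mul, Complex.norm_I, Complex.norm_real, Complex.norm_ofNat, mul_pow,
      Real.norm_eq_abs, sq_abs]
    nlinarith [sq_nonneg ‖(𝓕 f : L2) ξ‖]
  refine ⟨𝓕⁻ (hmem.toLp _ : L2), isWeakDeriv_iff.2 ?_⟩
  have h2 : (𝓕 (𝓕⁻ (hmem.toLp _ : L2) : L2) : L2) = hmem.toLp _ :=
    FourierTransform.fourier_fourierInv_eq _
  rw [h2]
  exact hmem.coeFn_toLp

/-! ### Finite differences of the heat kernel in complex time. -/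

/-- Each difference is traded for a derivative by the mean value inequality. The whole tower of
derivatives is carried along because the induction replaces it by the tower of its first
differences, whose k-th member is at most M h. -/
theorem norm_fwdDiff_iter_le {h M : ℝ} (hh : 0 ≤ h) (k : ℕ) : ∀ f : ℕ → ℝ → ℂ,
    (∀ i s, HasDerivAt (f i) (f (i + 1) s) s) → (∀ s, 0 ≤ s → ‖f k s‖ ≤ M) →
    ∀ s, 0 ≤ s → ‖(fwdDiff h)^[k] (f 0) s‖ ≤ M * h ^ k := by
  induction k generalizing M with
  | zero => intro f _ hM s hs; simpa using hM s hs
  | succ k ih =>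
    intro f hf hM s hs
    rw [Function.iterate_succ_apply, pow_succ', ← mul_assoc]
    refine ih (fun i => fwdDiff h (f i)) (fun i s => ?_) (fun s hs => ?_) s hs
    · have h1 : HasDerivAt (fun r => f i (r + h)) (f (i + 1) (s + h)) s :=
        (hf i (s + h)).comp_add_const s h
      exact h1.sub (hf i s)
    · have := (convex_Ici (0 : ℝ)).norm_image_sub_le_of_norm_hasDerivWithin_le
        (f := f k) (f' := f (k + 1)) (C := M) (fun x _ => (hf k x).hasDerivWithinAt)
        (fun x hx => hM x hx) (x := s) (y := s + h) hs (mem_Ici.2 (add_nonneg hs hh))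
      simpa [fwdDiff, abs_of_nonneg hh] using this

/-- The function `z ↦ z^{-j} (4πz)^{-1/2} e^{-q/z}`. -/
def heatFun (j : ℕ) (q : ℝ) (z : ℂ) : ℂ :=
  (z ^ j)⁻¹ * ((4 * Real.pi * z) ^ (1 / 2 : ℂ))⁻¹ * Complex.exp (-q / z)

theorem four_pi_mul_mem_slitPlane {z : ℂ} (hz : 0 < z.im) :
    4 * (Real.pi : ℂ) * z ∈ Complex.slitPlane := by
  right
  have : (4 * (Real.pi : ℂ) * z).im = 4 * Real.pi * z.im := by
    have : (4 * (Real.pi : ℂ)) = ((4 * Real.pi : ℝ) : ℂ) := by push_cast; rfl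
    rw [this, Complex.im_ofReal_mul]
  rw [this]
  positivity

theorem ne_zero_of_im_pos {z : ℂ} (hz : 0 < z.im) : z ≠ 0 := fun h => by simp [h] at hz

theorem differentiableAt_heatFun (j : ℕ) (q : ℝ) {z : ℂ} (hz : 0 < z.im) :
    DifferentiableAt ℂ (heatFun j q) z := by
  have h0 := ne_zero_of_im_pos hz
  have hs := four_pi_mul_mem_slitPlane hz
  have h1 : DifferentiableAt ℂ (fun z : ℂ => (4 * (Real.pi : ℂ) * z) ^ (1 / 2 : ℂ)) z :=
    (differentiableAt_id.const_mul _).cpow_const hs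
  have h2 : (4 * (Real.pi : ℂ) * z) ^ (1 / 2 : ℂ) ≠ 0 := by
    rw [Ne, Complex.cpow_eq_zero_iff]
    exact fun h => Complex.slitPlane_ne_zero hs h.1
  have h3 : DifferentiableAt ℂ (fun z : ℂ => Complex.exp (-q / z)) z :=
    ((differentiableAt_const _).div differentiableAt_id h0).cexp
  exact (((differentiableAt_id.pow j).inv (pow_ne_zero j h0)).mul (h1.inv h2)).mul h3

theorem norm_heatFun_le (j : ℕ) {q τ A : ℝ} (hτ : 0 < τ) {z : ℂ} (hz : τ / 2 ≤ ‖z‖)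
    (hA : (-q / z).re ≤ A) :
    ‖heatFun j q z‖ ≤ Real.exp A * 2 ^ j * ((τ ^ j)⁻¹ * (Real.sqrt τ)⁻¹) := by
  have e1 : ‖(4 * (Real.pi : ℂ) * z) ^ (1 / 2 : ℂ)‖ = Real.sqrt (4 * Real.pi * ‖z‖) := by
    have : (1 / 2 : ℂ) = ((1 / 2 : ℝ) : ℂ) := by push_cast; rfl
    rw [this, Complex.norm_cpow_real, Real.sqrt_eq_rpow]
    congr 1
    simp [abs_of_pos Real.pi_pos]
  have h1 : Real.sqrt τ ≤ Real.sqrt (4 * Real.pi * ‖z‖) := by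
    apply Real.sqrt_le_sqrt
    nlinarith [Real.pi_gt_three]
  have h2 : (τ / 2) ^ j ≤ ‖z‖ ^ j := pow_le_pow_left₀ (by positivity) hz j
  rw [heatFun, norm_mul, norm_mul, norm_inv, norm_inv, norm_pow, e1, Complex.norm_exp]
  have h3 : (‖z‖ ^ j)⁻¹ ≤ 2 ^ j * (τ ^ j)⁻¹ := by
    refine (inv_anti₀ (by positivity) h2).trans (le_of_eq ?_)
    rw [div_pow, inv_div]
    rfl
  have h4 : (Real.sqrt (4 * Real.pi * ‖z‖))⁻¹ ≤ (Real.sqrt τ)⁻¹ :=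
    inv_anti₀ (Real.sqrt_pos.2 hτ) h1
  calc _ ≤ (2 ^ j * (τ ^ j)⁻¹) * (Real.sqrt τ)⁻¹ * Real.exp A := by gcongr
    _ = _ := by ring

theorem re_neg_div_le {q ρ : ℝ} (hq : 0 ≤ q) {z : ℂ} (hz : z ≠ 0) (hρ : -ρ ≤ z.re) :
    (-(q : ℂ) / z).re ≤ q * ρ / ‖z‖ ^ 2 := by
  rw [← Complex.ofReal_neg, Complex.div_re, ← Complex.normSq_eq_norm_sq]
  have := Complex.normSq_pos.2 hz
  simp only [Complex.ofReal_re, Complex.ofReal_im, zero_mul, zero_div, add_zero]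
  rw [div_le_div_iff_of_pos_right this]
  nlinarith

/-- Cauchy's estimate on the disc of radius ρ = (2/τ + q/τ²)⁻¹ about `c`. This radius satisfies ρ ≤
τ/2, which keeps the disc in Im z ≥ τ/2, and qρ ≤ τ², which keeps Re(-q/z) ≤ qρ/|z|² ≤ 4 even where
the disc leaves the right half plane. -/
theorem norm_iteratedDeriv_heatFun_le (k j : ℕ) {q τ : ℝ} (hq : 0 ≤ q) (hτ : 0 < τ) {c : ℂ}
    (hre : 0 ≤ c.re) (him : c.im = τ) : ‖iteratedDeriv k (heatFun j q) c‖ ≤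
      k.factorial * (Real.exp 4 * 2 ^ j * ((τ ^ j)⁻¹ * (Real.sqrt τ)⁻¹)) *
        (2 / τ + q / τ ^ 2) ^ k := by
  set ρ : ℝ := (2 / τ + q / τ ^ 2)⁻¹ with hρdef
  have hpos : 0 < 2 / τ + q / τ ^ 2 := by positivity
  have hρ : 0 < ρ := inv_pos.2 hpos
  have hρ1 : ρ ≤ τ / 2 := by
    rw [hρdef, inv_le_comm₀ hpos (by positivity), inv_div]
    have : 0 ≤ q / τ ^ 2 := by positivity
    linarith
  have hρ2 : q * ρ ≤ τ ^ 2 := by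
    have h1 : (2 / τ + q / τ ^ 2) * ρ = 1 := mul_inv_cancel₀ hpos.ne'
    have h2 : 0 ≤ 2 / τ * ρ := by positivity
    have h3 : q / τ ^ 2 * ρ ≤ 1 := by nlinarith
    have h4 : q / τ ^ 2 * ρ = q * ρ / τ ^ 2 := by ring
    rw [h4, div_le_one (by positivity)] at h3
    exact h3
  have him' : ∀ z ∈ Metric.closedBall c ρ, τ / 2 ≤ z.im := by
    intro z hz
    rw [Metric.mem_closedBall, dist_eq_norm] at hz
    have := (Complex.abs_im_le_norm (z - c)).trans hz
    rw [Complex.sub_im, him, abs_le] at this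
    linarith [this.1]
  have hd : DiffContOnCl ℂ (heatFun j q) (Metric.ball c ρ) := by
    apply DifferentiableOn.diffContOnCl
    intro z hz
    exact (differentiableAt_heatFun j q (lt_of_lt_of_le (by positivity)
      (him' z (Metric.closure_ball_subset_closedBall hz)))).differentiableWithinAt
  have := Complex.norm_iteratedDeriv_le_of_forall_mem_sphere_norm_le k hρ hd
    (C := Real.exp 4 * 2 ^ j * ((τ ^ j)⁻¹ * (Real.sqrt τ)⁻¹)) ?_
  · rwa [div_eq_mul_inv, hρdef, inv_pow (2 / τ + q / τ ^ 2) k, inv_inv] at this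
  · intro z hz
    have hz' : z ∈ Metric.closedBall c ρ := Metric.sphere_subset_closedBall hz
    have hi := him' z hz'
    have hn : τ / 2 ≤ ‖z‖ := hi.trans ((le_abs_self _).trans (Complex.abs_im_le_norm z))
    have h0 : z ≠ 0 := ne_zero_of_im_pos (lt_of_lt_of_le (by positivity) hi)
    refine norm_heatFun_le j hτ hn ((re_neg_div_le (ρ := ρ) hq h0 ?_).trans ?_)
    · rw [Metric.mem_closedBall, dist_eq_norm] at hz'
      have := (Complex.abs_re_le_norm (z - c)).trans hz'
      rw [Complex.sub_re, abs_le] at this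
      linarith [this.1]
    · have hz0 : 0 < ‖z‖ := norm_pos_iff.2 h0
      rw [div_le_iff₀ (by positivity)]
      nlinarith

theorem hasDerivAt_iteratedDeriv_heatFun (i j : ℕ) (q : ℝ) {z : ℂ} (hz : 0 < z.im) :
    HasDerivAt (iteratedDeriv i (heatFun j q)) (iteratedDeriv (i + 1) (heatFun j q) z) z := by
  have hopen : IsOpen {z : ℂ | 0 < z.im} := isOpen_lt continuous_const Complex.continuous_im
  have hd : DifferentiableOn ℂ (heatFun j q) {z : ℂ | 0 < z.im} := fun w hw =>
    (differentiableAt_heatFun j q hw).differentiableWithinAt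
  have ha : AnalyticAt ℂ (heatFun j q) z := hd.analyticAt (hopen.mem_nhds hz)
  rw [iteratedDeriv_succ]
  have := ha.iterated_deriv i
  rw [← iteratedDeriv_eq_iterate] at this
  exact this.differentiableAt.hasDerivAt

/-- The `k`-th difference of `heatFun` with step `a`, starting at `z`. -/
def heatDiff (k j : ℕ) (q a : ℝ) (z : ℂ) : ℂ :=
  ∑ i ∈ Finset.range (k + 1), ((-1 : ℂ) ^ (k - i) * (k.choose i : ℂ)) *
    heatFun j q (z + ((i * a : ℝ) : ℂ))

theorem norm_heatDiff_le_pow (k j : ℕ) {q a τ : ℝ} (hq : 0 ≤ q) (ha : 0 ≤ a) (hτ : 0 < τ) {z : ℂ}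
    (hre : 0 ≤ z.re) (him : z.im = τ) : ‖heatDiff k j q a z‖ ≤
      k.factorial * (Real.exp 4 * 2 ^ j * ((τ ^ j)⁻¹ * (Real.sqrt τ)⁻¹)) *
        (a * (2 / τ + q / τ ^ 2)) ^ k := by
  have h1 : ∀ i (s : ℝ), HasDerivAt (fun s : ℝ => iteratedDeriv i (heatFun j q) (z + (s : ℂ)))
      (iteratedDeriv (i + 1) (heatFun j q) (z + (s : ℂ))) s := by
    intro i s
    have hz : 0 < (z + (s : ℂ)).im := by simp [him, hτ]
    have h2 := hasDerivAt_iteratedDeriv_heatFun i j q hz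
    have h3 : HasDerivAt (fun s : ℂ => z + s) 1 (s : ℂ) := (hasDerivAt_id _).const_add z
    have := (HasDerivAt.comp (s : ℂ) h2 h3).comp_ofReal
    simpa using this
  have := norm_fwdDiff_iter_le ha k
    (fun i s => iteratedDeriv i (heatFun j q) (z + (s : ℂ))) h1 (fun s hs =>
      norm_iteratedDeriv_heatFun_le k j hq hτ (c := z + (s : ℂ)) (by simp; linarith)
        (by simp [him])) 0 le_rfl
  rw [fwdDiff_iter_eq_sum_shift] at this
  rw [mul_pow, mul_comm (a ^ k), ← mul_assoc]
  convert this using 2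
  rw [heatDiff]
  refine Finset.sum_congr rfl fun i _ => ?_
  simp

/-- The triangle inequality alone: in the closed right half plane the exponential is at most 1 and
the binomial coefficients add up to 2^k. It serves where the step is too long for the difference to
exhibit cancellation. -/
theorem norm_heatDiff_le (k j : ℕ) {q a τ : ℝ} (hq : 0 ≤ q) (ha : 0 ≤ a) (hτ : 0 < τ) {z : ℂ}
    (hre : 0 ≤ z.re) (him : z.im = τ) : ‖heatDiff k j q a z‖ ≤
      2 ^ k * (2 ^ j * ((τ ^ j)⁻¹ * (Real.sqrt τ)⁻¹)) := by
  have hb : ∀ i ∈ Finset.range (k + 1), ‖((-1 : ℂ) ^ (k - i) * (k.choose i : ℂ)) *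
      heatFun j q (z + ((i * a : ℝ) : ℂ))‖ ≤
        (k.choose i : ℝ) * (2 ^ j * ((τ ^ j)⁻¹ * (Real.sqrt τ)⁻¹)) := by
    intro i _
    rw [norm_mul, norm_mul, norm_pow, norm_neg, norm_one, one_pow, one_mul, Complex.norm_natCast]
    have him' : (z + ((i * a : ℝ) : ℂ)).im = τ := by
      rw [Complex.add_im, Complex.ofReal_im, him, add_zero]
    have hre' : 0 ≤ (z + ((i * a : ℝ) : ℂ)).re := by
      rw [Complex.add_re, Complex.ofReal_re]
      positivity
    have hi : 0 < (z + ((i * a : ℝ) : ℂ)).im := by rw [him']; exact hτ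
    have hn : τ / 2 ≤ ‖z + ((i * a : ℝ) : ℂ)‖ := by
      have := (le_abs_self _).trans (Complex.abs_im_le_norm (z + ((i * a : ℝ) : ℂ)))
      rw [him'] at this
      linarith
    have := norm_heatFun_le j hτ hn (A := 0)
      ((re_neg_div_le (ρ := 0) hq (ne_zero_of_im_pos hi) (by simpa using hre')).trans (by simp))
    rw [Real.exp_zero, one_mul] at this
    gcongr
  refine (norm_sum_le_of_le _ hb).trans (le_of_eq ?_)
  rw [← Finset.sum_mul]
  congr 1
  exact_mod_cast Nat.sum_range_choose k

/-! ### Gaussian symbols and their convolution kernels. -/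

theorem integral_fourier_mul {f g : ℝ → ℂ} (hf : Integrable f) (hg : Integrable g) :
    ∫ ξ, 𝓕 f ξ * g ξ = ∫ x, f x * 𝓕 g x := by
  have := VectorFourier.integral_bilin_fourierIntegral_eq_flip (ContinuousLinearMap.mul ℂ ℂ)
    (L := innerₗ ℝ) Real.continuous_fourierChar continuous_inner hf hg
  simpa using! this

/-- A Fourier multiplier with integrable symbol is a convolution. -/
theorem schwartzMult_kernel {m : ℝ → ℂ} (hm : m.HasTemperateGrowth)
    (hint : Integrable fun ξ => m (2 * Real.pi * ξ)) (φ : 𝓢(ℝ, ℂ)) (y : ℝ) :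
    schwartzMult m φ y = ∫ x, 𝓕 (fun ξ => m (2 * Real.pi * ξ)) (y - x) * φ x := by
  set p : ℝ → ℂ := fun ξ => m (2 * Real.pi * ξ) with hp
  -- The Fourier transform is moved from `φ` to the reflected symbol times a character; the
  -- reflection accounts for 𝓕⁻φ(-ξ) = 𝓕φ(ξ).
  have hh : Integrable fun ξ : ℝ => (Real.fourierChar (-(-ξ * y)) : ℂ) * p (-ξ) := by
    refine (hint.comp_neg).bdd_mul (c := 1) (by fun_prop) (ae_of_all _ fun ξ => ?_)
    exact (Circle.norm_coe _).le
  have h1 := integral_fourier_mul φ.integrable hh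
  rw [schwartzMult_apply, SchwartzMap.fourier_coe, Real.fourier_real_eq]
  have h2 : ∫ ξ, 𝓕 (φ : ℝ → ℂ) ξ * ((Real.fourierChar (-(-ξ * y)) : ℂ) * p (-ξ)) =
      ∫ v : ℝ, Real.fourierChar (-(v * y)) •
        (SchwartzMap.smulLeftCLM ℂ (fun ξ => m (2 * Real.pi * ξ)) (𝓕⁻ φ)) v := by
    rw [← integral_neg_eq_self]
    refine integral_congr_ae (ae_of_all _ fun ξ => ?_)
    simp only [neg_neg]
    rw [SchwartzMap.smulLeftCLM_apply_apply (temperate_scale hm), SchwartzMap.fourierInv_coe,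
      Real.fourierInv_eq_fourier_neg, Circle.smul_def, smul_eq_mul, smul_eq_mul]
    ring
  rw [← h2, h1]
  refine integral_congr_ae (ae_of_all _ fun x => ?_)
  simp only
  rw [mul_comm]
  congr 1
  rw [Real.fourier_real_eq, Real.fourier_real_eq, ← integral_neg_eq_self]
  refine integral_congr_ae (ae_of_all _ fun ξ => ?_)
  simp only [neg_neg]
  rw [Circle.smul_def, Circle.smul_def, smul_eq_mul, smul_eq_mul, ← mul_assoc]
  congr 1
  rw [← Circle.coe_mul, ← AddChar.map_add_eq_mul]
  congr 2
  ring

/-- Gaussian symbols. -/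
def gaussSymbol (z : ℂ) (ξ : ℝ) : ℂ := Complex.exp (-z * (ξ : ℂ) ^ 2)

theorem norm_gaussSymbol (z : ℂ) (ξ : ℝ) : ‖gaussSymbol z ξ‖ = Real.exp (-z.re * ξ ^ 2) := by
  rw [gaussSymbol, Complex.norm_exp]
  congr 1
  rw [← Complex.ofReal_pow, Complex.re_mul_ofReal]
  simp

theorem norm_gaussSymbol_le {z : ℂ} (hz : 0 ≤ z.re) (ξ : ℝ) : ‖gaussSymbol z ξ‖ ≤ 1 := by
  rw [norm_gaussSymbol, Real.exp_le_one_iff]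
  nlinarith [sq_nonneg ξ]

theorem continuous_gaussSymbol (z : ℂ) : Continuous (gaussSymbol z) := by
  unfold gaussSymbol
  fun_prop

theorem gaussSymbol_add (z w : ℂ) (ξ : ℝ) :
    gaussSymbol (z + w) ξ = gaussSymbol z ξ * gaussSymbol w ξ := by
  rw [gaussSymbol, gaussSymbol, gaussSymbol, ← Complex.exp_add]
  congr 1
  ring

theorem isSymbol_gaussSymbol {z : ℂ} (hz : 0 ≤ z.re) : IsSymbol (gaussSymbol z) :=
  ⟨(continuous_gaussSymbol z).measurable, 1, norm_gaussSymbol_le hz⟩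

theorem hasDerivAt_polynomial_mul_gaussSymbol (z : ℂ) (P : Polynomial ℂ) (ξ : ℝ) :
    HasDerivAt (fun ξ : ℝ => P.eval (ξ : ℂ) * gaussSymbol z ξ)
      ((P.derivative - Polynomial.C (2 * z) * Polynomial.X * P).eval (ξ : ℂ) * gaussSymbol z ξ)
      ξ := by
  have h1 : HasDerivAt (fun w : ℂ => P.eval w * Complex.exp (-z * w ^ 2))
      (P.derivative.eval (ξ : ℂ) * Complex.exp (-z * (ξ : ℂ) ^ 2) +
        P.eval (ξ : ℂ) * (Complex.exp (-z * (ξ : ℂ) ^ 2) * (-z * (2 * (ξ : ℂ))))) (ξ : ℂ) := by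
    refine (P.hasDerivAt _).mul (HasDerivAt.cexp ?_)
    simpa using ((hasDerivAt_pow 2 (ξ : ℂ)).const_mul (-z))
  refine h1.comp_ofReal.congr_deriv ?_
  simp only [gaussSymbol, Polynomial.eval_sub, Polynomial.eval_mul, Polynomial.eval_C,
    Polynomial.eval_X]
  ring

theorem exists_norm_polynomial_le (P : Polynomial ℂ) :
    ∃ (k : ℕ) (C : ℝ), ∀ ξ : ℝ, ‖P.eval (ξ : ℂ)‖ ≤ C * (1 + ‖ξ‖) ^ k := by
  have h : (fun ξ : ℝ => P.eval (ξ : ℂ)).HasTemperateGrowth := by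
    have h0 : (fun ξ : ℝ => (ξ : ℂ)).HasTemperateGrowth :=
      Function.Complex.hasTemperateGrowth_ofReal
    simp_rw [Polynomial.eval_eq_sum, Polynomial.sum_def]
    refine Function.HasTemperateGrowth.sum fun i _ => ?_
    fun_prop
  obtain ⟨k, C, hC⟩ := h.2 0
  exact ⟨k, C, fun ξ => by simpa using hC ξ⟩

/-- All derivatives are polynomials times the symbol itself, which has modulus at most 1. The case
Re z = 0, the Schrödinger propagator, is included. -/
theorem temperate_gaussSymbol {z : ℂ} (hz : 0 ≤ z.re) : (gaussSymbol z).HasTemperateGrowth := by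
  have key : ∀ (n : ℕ) (P : Polynomial ℂ), ∃ Q : Polynomial ℂ,
      iteratedDeriv n (fun ξ : ℝ => P.eval (ξ : ℂ) * gaussSymbol z ξ) =
        fun ξ : ℝ => Q.eval (ξ : ℂ) * gaussSymbol z ξ := by
    intro n
    induction n with
    | zero => exact fun P => ⟨P, by simp⟩
    | succ n ih =>
      intro P
      obtain ⟨Q, hQ⟩ := ih (P.derivative - Polynomial.C (2 * z) * Polynomial.X * P)
      refine ⟨Q, ?_⟩
      rw [iteratedDeriv_succ', ← hQ]
      congr 1
      funext ξ
      exact (hasDerivAt_polynomial_mul_gaussSymbol z P ξ).deriv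
  refine ⟨?_, fun n => ?_⟩
  · have : ContDiff ℝ ∞ fun ξ : ℝ => (ξ : ℂ) := Complex.ofRealCLM.contDiff
    unfold gaussSymbol
    fun_prop
  · obtain ⟨Q, hQ⟩ := key n 1
    obtain ⟨k, C, hC⟩ := exists_norm_polynomial_le Q
    refine ⟨k, C, fun ξ => ?_⟩
    simp only [Polynomial.eval_one, one_mul] at hQ
    rw [norm_iteratedFDeriv_eq_norm_iteratedDeriv]
    have : iteratedDeriv n (gaussSymbol z) ξ = Q.eval (ξ : ℂ) * gaussSymbol z ξ := congrFun hQ ξ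
    rw [this, norm_mul]
    exact (mul_le_of_le_one_right (norm_nonneg _) (norm_gaussSymbol_le hz ξ)).trans (hC ξ)

theorem integrable_gaussSymbol {z : ℂ} (hz : 0 < z.re) :
    Integrable fun ξ : ℝ => gaussSymbol z (2 * Real.pi * ξ) := by
  have := integrable_cexp_neg_mul_sq (b := z) hz
  exact this.comp_mul_left' (by positivity)

theorem integrable_id_smul_gaussSymbol {z : ℂ} (hz : 0 < z.re) :
    Integrable fun ξ : ℝ => ξ • gaussSymbol z (2 * Real.pi * ξ) := by
  have := integrable_mul_cexp_neg_mul_sq (b := z * (2 * Real.pi) ^ 2) (by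
    have : (z * (2 * Real.pi) ^ 2 : ℂ) = z * (((2 * Real.pi) ^ 2 : ℝ) : ℂ) := by push_cast; rfl
    rw [this, Complex.re_mul_ofReal]
    positivity)
  refine this.congr (ae_of_all _ fun ξ => ?_)
  simp only [gaussSymbol, Complex.real_smul]
  congr 2
  push_cast
  ring

theorem fourier_gaussSymbol {z : ℂ} (hz : 0 < z.re) :
    𝓕 (fun ξ : ℝ => gaussSymbol z (2 * Real.pi * ξ)) =
      fun Y : ℝ => heatFun 0 (Y ^ 2 / 4) z := by
  have h0 : z ≠ 0 := fun h => by simp [h] at hz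
  have hb : 0 < (4 * (Real.pi : ℂ) * z).re := by
    have : (4 * (Real.pi : ℂ)) = ((4 * Real.pi : ℝ) : ℂ) := by push_cast; rfl
    rw [this, Complex.re_ofReal_mul]
    positivity
  have := fourier_gaussian_pi hb
  have e : (fun ξ : ℝ => gaussSymbol z (2 * Real.pi * ξ)) =
      fun x : ℝ => Complex.exp (-Real.pi * (4 * (Real.pi : ℂ) * z) * x ^ 2) := by
    funext ξ
    rw [gaussSymbol]
    congr 1
    push_cast
    ring
  rw [e, this]
  funext Y
  have hpi : (Real.pi : ℂ) ≠ 0 := by exact_mod_cast Real.pi_ne_zero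
  rw [heatFun, pow_zero, inv_one, one_mul, one_div]
  congr 2
  push_cast
  field_simp

/-- Differentiating the heat kernel in Y produces the factor -Y/(2z), which explains the index `j =
1` of `heatFun`. -/
theorem fourier_neg_I_mul_gaussSymbol {z : ℂ} (hz : 0 < z.re) :
    𝓕 (fun ξ : ℝ => -Complex.I * ((2 * Real.pi * ξ : ℝ) : ℂ) * gaussSymbol z (2 * Real.pi * ξ)) =
      fun Y : ℝ => -(Y / 2) * heatFun 1 (Y ^ 2 / 4) z := by
  have h0 : z ≠ 0 := fun h => by simp [h] at hz
  have h1 := Real.deriv_fourier (integrable_gaussSymbol hz) (integrable_id_smul_gaussSymbol hz)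
  have e : (fun ξ : ℝ => -Complex.I * ((2 * Real.pi * ξ : ℝ) : ℂ) * gaussSymbol z (2 * Real.pi * ξ))
      = fun x : ℝ => (-2 * Real.pi * Complex.I * x) • gaussSymbol z (2 * Real.pi * x) := by
    funext ξ
    rw [smul_eq_mul]
    push_cast
    ring
  rw [e, ← h1, fourier_gaussSymbol hz]
  funext Y
  apply HasDerivAt.deriv
  have h2 : HasDerivAt (fun w : ℂ => ((4 * Real.pi * z) ^ (1 / 2 : ℂ))⁻¹ *
      Complex.exp (-(w ^ 2 / 4) / z)) (((4 * Real.pi * z) ^ (1 / 2 : ℂ))⁻¹ *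
        (Complex.exp (-((Y : ℂ) ^ 2 / 4) / z) * (-((2 * (Y : ℂ)) / 4) / z))) (Y : ℂ) := by
    refine HasDerivAt.const_mul _ (HasDerivAt.cexp ?_)
    simpa using (((hasDerivAt_pow 2 (Y : ℂ)).div_const 4).neg).div_const z
  have h3 := h2.comp_ofReal
  simp only [heatFun, pow_zero, inv_one, one_mul, pow_one]
  push_cast
  refine h3.congr_deriv ?_
  field_simp
  ring

/-- The low frequency cutoff symbol `(e^{-aξ²} - 1)^k`. -/
def diffSymbol (a : ℝ) (k : ℕ) (ξ : ℝ) : ℂ := (gaussSymbol a ξ - 1) ^ k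

theorem temperate_diffSymbol {a : ℝ} (ha : 0 ≤ a) (k : ℕ) :
    (diffSymbol a k).HasTemperateGrowth := by
  have := temperate_gaussSymbol (z := a) (by simpa using ha)
  unfold diffSymbol
  fun_prop

theorem norm_diffSymbol_le {a : ℝ} (ha : 0 ≤ a) (k : ℕ) (ξ : ℝ) : ‖diffSymbol a k ξ‖ ≤ 2 ^ k := by
  rw [diffSymbol, norm_pow]
  refine pow_le_pow_left₀ (norm_nonneg _) ((norm_sub_le _ _).trans ?_) k
  have := norm_gaussSymbol_le (z := a) (by simpa using ha) ξ
  rw [norm_one]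
  linarith

theorem isSymbol_diffSymbol {a : ℝ} (ha : 0 ≤ a) (k : ℕ) : IsSymbol (diffSymbol a k) :=
  ⟨(temperate_diffSymbol ha k).1.continuous.measurable, 2 ^ k, norm_diffSymbol_le ha k⟩

/-- The binomial theorem: multiplying e^{-zξ²} by (e^{-aξ²} - 1)^k is taking the k-th difference in
z with step `a`. Frequency localization thereby becomes smoothness in complex time. -/
theorem gaussSymbol_mul_diffSymbol (z : ℂ) (a : ℝ) (k : ℕ) (ξ : ℝ) :
    gaussSymbol z ξ * diffSymbol a k ξ = ∑ i ∈ Finset.range (k + 1),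
      ((-1 : ℂ) ^ (k - i) * (k.choose i : ℂ)) * gaussSymbol (z + ((i * a : ℝ) : ℂ)) ξ := by
  rw [diffSymbol, sub_eq_add_neg, add_pow, Finset.mul_sum]
  refine Finset.sum_congr rfl fun i _ => ?_
  have : gaussSymbol a ξ ^ i = gaussSymbol ((i * a : ℝ) : ℂ) ξ := by
    rw [gaussSymbol, gaussSymbol, ← Complex.exp_nat_mul]
    congr 1
    push_cast
    ring
  rw [this, gaussSymbol_add]
  ring

theorem fourier_finset_sum {s : Finset ℕ} {c : ℕ → ℂ} {g : ℕ → ℝ → ℂ}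
    (hg : ∀ i ∈ s, Integrable (g i)) (Y : ℝ) :
    𝓕 (fun ξ => ∑ i ∈ s, c i * g i ξ) Y = ∑ i ∈ s, c i * 𝓕 (g i) Y := by
  simp_rw [Real.fourier_real_eq, Finset.smul_sum]
  rw [integral_finsetSum]
  · refine Finset.sum_congr rfl fun i _ => ?_
    rw [← integral_const_mul]
    refine integral_congr_ae (ae_of_all _ fun ξ => ?_)
    simp only [Circle.smul_def, smul_eq_mul]
    ring
  · intro i hi
    have : Integrable fun v : ℝ => (Real.fourierChar (-(v * Y)) : ℂ) * (c i * g i v) :=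
      ((hg i hi).const_mul (c i)).bdd_mul (c := 1) (by fun_prop)
        (ae_of_all _ fun ξ => (Circle.norm_coe _).le)
    exact this

theorem schwartzMult_gauss_diff {z : ℂ} (hz : 0 < z.re) {a : ℝ} (ha : 0 ≤ a) (k : ℕ)
    (φ : 𝓢(ℝ, ℂ)) (y : ℝ) :
    schwartzMult (fun ξ => gaussSymbol z ξ * diffSymbol a k ξ) φ y =
      ∫ x, heatDiff k 0 ((y - x) ^ 2 / 4) a z * φ x := by
  have hre : ∀ i : ℕ, 0 < (z + ((i * a : ℝ) : ℂ)).re := fun i => by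
    rw [Complex.add_re, Complex.ofReal_re]
    positivity
  have hs : (fun ξ : ℝ => gaussSymbol z (2 * Real.pi * ξ) * diffSymbol a k (2 * Real.pi * ξ)) =
      fun ξ => ∑ i ∈ Finset.range (k + 1), ((-1 : ℂ) ^ (k - i) * (k.choose i : ℂ)) *
        gaussSymbol (z + ((i * a : ℝ) : ℂ)) (2 * Real.pi * ξ) :=
    funext fun ξ => gaussSymbol_mul_diffSymbol z a k _
  have ht : (fun ξ => gaussSymbol z ξ * diffSymbol a k ξ).HasTemperateGrowth :=
    (temperate_gaussSymbol hz.le).mul (temperate_diffSymbol ha k)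
  rw [schwartzMult_kernel ht]
  · refine integral_congr_ae (ae_of_all _ fun x => ?_)
    simp only
    rw [hs, fourier_finset_sum (fun i _ => integrable_gaussSymbol (hre i)), heatDiff]
    congr 1
    refine Finset.sum_congr rfl fun i _ => ?_
    rw [fourier_gaussSymbol (hre i)]
  · rw [hs]
    exact integrable_finsetSum _ fun i _ => (integrable_gaussSymbol (hre i)).const_mul _

theorem schwartzMult_deriv_gauss_diff {z : ℂ} (hz : 0 < z.re) {a : ℝ} (ha : 0 ≤ a) (k : ℕ)
    (φ : 𝓢(ℝ, ℂ)) (y : ℝ) :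
    schwartzMult (fun ξ => gaussSymbol z ξ * (-Complex.I * ξ * diffSymbol a k ξ)) φ y =
      ∫ x, -(((y - x : ℝ) : ℂ) / 2) * heatDiff k 1 ((y - x) ^ 2 / 4) a z * φ x := by
  have hre : ∀ i : ℕ, 0 < (z + ((i * a : ℝ) : ℂ)).re := fun i => by
    rw [Complex.add_re, Complex.ofReal_re]
    positivity
  have hs : (fun ξ : ℝ => gaussSymbol z (2 * Real.pi * ξ) *
      (-Complex.I * ((2 * Real.pi * ξ : ℝ) : ℂ)
        * diffSymbol a k (2 * Real.pi * ξ))) =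
      fun ξ => ∑ i ∈ Finset.range (k + 1), ((-1 : ℂ) ^ (k - i) * (k.choose i : ℂ)) *
        (-Complex.I * ((2 * Real.pi * ξ : ℝ) : ℂ) *
          gaussSymbol (z + ((i * a : ℝ) : ℂ)) (2 * Real.pi * ξ)) := by
    funext ξ
    rw [mul_left_comm, gaussSymbol_mul_diffSymbol z a k, Finset.mul_sum]
    refine Finset.sum_congr rfl fun i _ => by ring
  have hint : ∀ i : ℕ, Integrable fun ξ : ℝ => -Complex.I * ((2 * Real.pi * ξ : ℝ) : ℂ) *
      gaussSymbol (z + ((i * a : ℝ) : ℂ)) (2 * Real.pi * ξ) := by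
    intro i
    refine ((integrable_id_smul_gaussSymbol (hre i)).const_mul (-Complex.I * (2 * Real.pi))).congr
      (ae_of_all _ fun ξ => ?_)
    simp only [Complex.real_smul]
    push_cast
    ring
  have ht : (fun ξ : ℝ => gaussSymbol z ξ *
      (-Complex.I * ξ * diffSymbol a k ξ)).HasTemperateGrowth :=
    (temperate_gaussSymbol hz.le).mul (temperate_neg_I_mul.mul (temperate_diffSymbol ha k))
  rw [schwartzMult_kernel ht]
  · refine integral_congr_ae (ae_of_all _ fun x => ?_)
    simp only
    rw [hs, fourier_finset_sum (fun i _ => hint i), heatDiff]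
    congr 1
    rw [Finset.mul_sum]
    refine Finset.sum_congr rfl fun i _ => ?_
    rw [fourier_neg_I_mul_gaussSymbol (hre i)]
    ring
  · rw [hs]
    exact integrable_finsetSum _ fun i _ => (hint i).const_mul _

/-- On the imaginary axis the Gaussian symbol is not integrable and has no kernel as an absolutely
convergent integral. Kernel bounds are proved at ε + iτ, uniformly in ε > 0, and then passed to the
limit. -/
theorem tendsto_schwartzMult_gauss {m : ℝ → ℂ} (hm : m.HasTemperateGrowth) (φ : 𝓢(ℝ, ℂ)) (y : ℝ) :
    Tendsto (fun ε : ℝ => schwartzMult (fun ξ => gaussSymbol ε ξ * m ξ) φ y) (𝓝[>] 0)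
      (𝓝 (schwartzMult m φ y)) := by
  rw [schwartzMult_apply, SchwartzMap.fourier_coe, Real.fourier_real_eq]
  have hbd := (SchwartzMap.smulLeftCLM ℂ (fun ξ => m (2 * Real.pi * ξ)) (𝓕⁻ φ)).integrable
    (μ := volume)
  have hev : ∀ᶠ ε : ℝ in 𝓝[>] 0, schwartzMult (fun ξ => gaussSymbol ε ξ * m ξ) φ y =
      ∫ v : ℝ, Real.fourierChar (-(v * y)) • (gaussSymbol ε (2 * Real.pi * v) *
        SchwartzMap.smulLeftCLM ℂ (fun ξ => m (2 * Real.pi * ξ)) (𝓕⁻ φ) v) := by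
    filter_upwards [self_mem_nhdsWithin] with ε hε
    have ht : (fun ξ => gaussSymbol ε ξ * m ξ).HasTemperateGrowth :=
      (temperate_gaussSymbol (z := ε) (by simpa using (mem_Ioi.1 hε).le)).mul hm
    rw [schwartzMult_apply, SchwartzMap.fourier_coe, Real.fourier_real_eq]
    refine integral_congr_ae (ae_of_all _ fun v => ?_)
    simp only
    rw [SchwartzMap.smulLeftCLM_apply_apply (temperate_scale ht),
      SchwartzMap.smulLeftCLM_apply_apply (temperate_scale hm), smul_eq_mul, smul_eq_mul, mul_assoc]
  refine Tendsto.congr' (EventuallyEq.symm hev) ?_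
  refine tendsto_integral_filter_of_dominated_convergence _ ?_ ?_ hbd.norm ?_
  · refine Eventually.of_forall fun ε => ?_
    refine Continuous.aestronglyMeasurable ?_
    have := (continuous_gaussSymbol (ε : ℂ)).comp (continuous_const_mul (2 * Real.pi))
    exact Continuous.smul (by fun_prop) (this.mul (SchwartzMap.continuous _))
  · filter_upwards [self_mem_nhdsWithin] with ε hε
    refine ae_of_all _ fun v => ?_
    rw [Circle.norm_smul, norm_mul]
    exact mul_le_of_le_one_left (norm_nonneg _)
      (norm_gaussSymbol_le (by simpa using (mem_Ioi.1 hε).le) _)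
  · refine ae_of_all _ fun v => ?_
    have h1 : Tendsto (fun ε : ℝ => gaussSymbol ε (2 * Real.pi * v)) (𝓝[>] 0) (𝓝 1) := by
      have : Continuous fun ε : ℝ => gaussSymbol ε (2 * Real.pi * v) := by
        unfold gaussSymbol
        fun_prop
      have h2 := this.tendsto 0
      simp only [gaussSymbol, Complex.ofReal_zero, neg_zero, zero_mul, Complex.exp_zero] at h2
      exact h2.mono_left nhdsWithin_le_nhds
    simpa using (h1.mul_const _).const_smul (Real.fourierChar (-(v * y)))

/-! ### Pointwise kernel bounds and the dispersive estimate. -/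

/-- The bound `min(X^k, X^{3/4})`, with `X = a/τ + aY²/τ²`, for the size of the kernels. -/
def kerBound (k : ℕ) (a τ Y : ℝ) : ℝ :=
  min ((a / τ + a * Y ^ 2 / τ ^ 2) ^ k) ((a / τ + a * Y ^ 2 / τ ^ 2) ^ (3 / 4 : ℝ))

theorem min_one_pow_le {k : ℕ} (hk : 1 ≤ k) {X : ℝ} (hX : 0 < X) :
    min 1 (X ^ k) ≤ min (X ^ k) (X ^ (3 / 4 : ℝ)) := by
  refine le_min (min_le_right _ _) ?_
  rcases le_total X 1 with h | h
  · calc min 1 (X ^ k) ≤ X ^ k := min_le_right _ _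
      _ ≤ X ^ 1 := pow_le_pow_of_le_one hX.le h hk
      _ = X ^ (1 : ℝ) := by norm_num
      _ ≤ _ := Real.rpow_le_rpow_of_exponent_ge hX h (by norm_num)
  · exact (min_le_left _ _).trans (Real.one_le_rpow h (by norm_num))

/-- The factor √X pays for the |Y|/τ in the differentiated kernel. For X ≥ 1 it is absorbed because
1/2 ≤ 3/4 and 1/2 ≤ k; for X ≤ 1 it is harmless. -/
theorem sqrt_mul_min_one_pow_le {k : ℕ} (hk : 1 ≤ k) {X : ℝ} (hX : 0 < X) :
    Real.sqrt X * min 1 (X ^ k) ≤ min (X ^ k) (X ^ (3 / 4 : ℝ)) := by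
  have hkpos : 0 < X ^ k := pow_pos hX k
  rcases le_total X 1 with h | h
  · have h1 : Real.sqrt X ≤ 1 := Real.sqrt_le_one.2 h
    have h2 : Real.sqrt X * min 1 (X ^ k) ≤ min 1 (X ^ k) :=
      mul_le_of_le_one_left (le_min zero_le_one hkpos.le) h1
    exact h2.trans (min_one_pow_le hk hX)
  · have h2 : Real.sqrt X * min 1 (X ^ k) ≤ Real.sqrt X :=
      mul_le_of_le_one_right (Real.sqrt_nonneg _) (min_le_left _ _)
    refine h2.trans (le_min ?_ ?_)
    · calc Real.sqrt X ≤ X := Real.sqrt_le_iff.2 ⟨hX.le, by nlinarith⟩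
        _ = X ^ 1 := (pow_one X).symm
        _ ≤ X ^ k := pow_le_pow_right₀ h hk
    · rw [Real.sqrt_eq_rpow]
      exact Real.rpow_le_rpow_of_exponent_le h (by norm_num)

theorem norm_heatDiff_le_min {k : ℕ} {j : ℕ} (hj : j ≤ 1) {a τ Y : ℝ} (ha : 0 ≤ a) (hτ : 0 < τ)
    {z : ℂ} (hre : 0 ≤ z.re) (him : z.im = τ) : ‖heatDiff k j (Y ^ 2 / 4) a z‖ ≤
      (k.factorial * Real.exp 4 * 2 * 2 ^ k) * ((τ ^ j)⁻¹ * (Real.sqrt τ)⁻¹) *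
        min 1 ((a / τ + a * Y ^ 2 / τ ^ 2) ^ k) := by
  have h1 := norm_heatDiff_le k j (q := Y ^ 2 / 4) (by positivity) ha hτ hre him
  have h2 := norm_heatDiff_le_pow k j (q := Y ^ 2 / 4) (by positivity) ha hτ hre him
  have h2j : (2 : ℝ) ^ j ≤ 2 := by
    calc (2 : ℝ) ^ j ≤ 2 ^ 1 := pow_le_pow_right₀ (by norm_num) hj
      _ = 2 := by norm_num
  have hf : (1 : ℝ) ≤ k.factorial * Real.exp 4 := by
    have e1 : (1 : ℝ) ≤ k.factorial := by
      exact_mod_cast Nat.one_le_iff_ne_zero.2 k.factorial_ne_zero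
    have e2 : (1 : ℝ) ≤ Real.exp 4 := Real.one_le_exp (by norm_num)
    nlinarith
  set P : ℝ := (τ ^ j)⁻¹ * (Real.sqrt τ)⁻¹ with hP
  have hP0 : 0 ≤ P := by positivity
  rw [mul_min_of_nonneg _ _ (by positivity)]
  refine le_min (h1.trans ?_) (h2.trans ?_)
  · rw [mul_one]
    calc 2 ^ k * (2 ^ j * P) ≤ 2 ^ k * (2 * P) := by gcongr
      _ = 1 * (2 * 2 ^ k * P) := by ring
      _ ≤ (k.factorial * Real.exp 4) * (2 * 2 ^ k * P) := by gcongr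
      _ = _ := by ring
  · have h3 : a * (2 / τ + Y ^ 2 / 4 / τ ^ 2) ≤ 2 * (a / τ + a * Y ^ 2 / τ ^ 2) := by
      have : 0 ≤ a * Y ^ 2 / τ ^ 2 := by positivity
      have e : a * (2 / τ + Y ^ 2 / 4 / τ ^ 2) = 2 * (a / τ) + (a * Y ^ 2 / τ ^ 2) / 4 := by ring
      rw [e]
      linarith
    calc _ ≤ k.factorial * (Real.exp 4 * 2 * P) * (2 * (a / τ + a * Y ^ 2 / τ ^ 2)) ^ k := by
          gcongr
      _ = _ := by rw [mul_pow]; ring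

theorem norm_heatDiff_zero_le {k : ℕ} (hk : 1 ≤ k) {a τ Y : ℝ} (ha : 1 ≤ a) (hτ : 0 < τ)
    {z : ℂ} (hre : 0 ≤ z.re) (him : z.im = τ) : ‖heatDiff k 0 (Y ^ 2 / 4) a z‖ ≤
      (k.factorial * Real.exp 4 * 2 * 2 ^ k) * (Real.sqrt τ)⁻¹ * kerBound k a τ Y := by
  have ha0 : 0 < a := by linarith
  have := norm_heatDiff_le_min (k := k) (j := 0) (Y := Y) zero_le_one ha0.le hτ hre him
  rw [pow_zero, inv_one, one_mul] at this
  refine this.trans ?_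
  unfold kerBound
  gcongr _ * ?_
  exact min_one_pow_le hk (by positivity)

/-- Since a ≥ 1, (Y/τ)² ≤ aY²/τ² ≤ X, so the derivative costs at most √X and the bound for the
undifferentiated kernel persists. -/
theorem norm_heatDiff_one_le {k : ℕ} (hk : 1 ≤ k) {a τ Y : ℝ} (ha : 1 ≤ a) (hτ : 0 < τ)
    {z : ℂ} (hre : 0 ≤ z.re) (him : z.im = τ) :
    ‖-((Y : ℂ) / 2) * heatDiff k 1 (Y ^ 2 / 4) a z‖ ≤
      (k.factorial * Real.exp 4 * 2 * 2 ^ k) * (Real.sqrt τ)⁻¹ * kerBound k a τ Y := by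
  have ha0 : 0 < a := by linarith
  have h1 := norm_heatDiff_le_min (k := k) (j := 1) (Y := Y) le_rfl ha0.le hτ hre him
  set X : ℝ := a / τ + a * Y ^ 2 / τ ^ 2 with hX
  have hXpos : 0 < X := by positivity
  have h2 : |Y| / τ ≤ Real.sqrt X := by
    apply Real.le_sqrt_of_sq_le
    rw [div_pow, sq_abs, hX]
    have e1 : Y ^ 2 / τ ^ 2 ≤ a * Y ^ 2 / τ ^ 2 := by
      gcongr
      nlinarith [sq_nonneg Y]
    have : 0 ≤ a / τ := by positivity
    linarith
  rw [norm_mul, norm_neg, norm_div, Complex.norm_real, Real.norm_eq_abs, Complex.norm_ofNat]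
  calc |Y| / 2 * ‖heatDiff k 1 (Y ^ 2 / 4) a z‖ ≤ |Y| * ((k.factorial * Real.exp 4 * 2 * 2 ^ k) *
        ((τ ^ 1)⁻¹ * (Real.sqrt τ)⁻¹) * min 1 (X ^ k)) := by
        gcongr
        linarith [abs_nonneg Y]
    _ = (k.factorial * Real.exp 4 * 2 * 2 ^ k) * (Real.sqrt τ)⁻¹ *
        (|Y| / τ * min 1 (X ^ k)) := by
        rw [pow_one]
        ring
    _ ≤ (k.factorial * Real.exp 4 * 2 * 2 ^ k) * (Real.sqrt τ)⁻¹ *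
        (Real.sqrt X * min 1 (X ^ k)) := by gcongr
    _ ≤ _ := by
        unfold kerBound
        gcongr _ * ?_
        exact sqrt_mul_min_one_pow_le hk hXpos

theorem one_add_pow_mul_exp_le (k : ℕ) {s : ℝ} (hs : 0 ≤ s) :
    (1 + s) ^ k * Real.exp (-s) ≤ 2 ^ k * k.factorial * Real.exp 1 * Real.exp (-(s / 2)) := by
  have h1 := Real.pow_div_factorial_le_exp ((1 + s) / 2) (by positivity) k
  rw [div_le_iff₀ (by positivity), div_pow, div_le_iff₀ (by positivity)] at h1
  have h2 : Real.exp ((1 + s) / 2) ≤ Real.exp 1 * Real.exp (s / 2) := by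
    rw [← Real.exp_add]
    exact Real.exp_le_exp.2 (by linarith)
  have h3 : Real.exp (s / 2) * Real.exp (-s) = Real.exp (-(s / 2)) := by
    rw [← Real.exp_add]
    congr 1
    ring
  calc (1 + s) ^ k * Real.exp (-s)
      ≤ (Real.exp 1 * Real.exp (s / 2) * k.factorial * 2 ^ k) * Real.exp (-s) := by
        gcongr
        exact h1.trans (by gcongr)
    _ = 2 ^ k * k.factorial * Real.exp 1 * (Real.exp (s / 2) * Real.exp (-s)) := by ring
    _ = _ := by rw [h3]

/-- With s = x²/b² and E = a/τ + ab²/τ² one has X ≤ 2E(1 + s) + 2ay²/τ². If the source part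
dominates, the power X^k is used and half of the Gaussian absorbs (1 + s)^k; if the observer part
dominates, the power X^{3/4} is used. -/
theorem kerBound_mul_exp_le (k : ℕ) {a τ b : ℝ} (ha : 0 < a) (hτ : 0 < τ) (hb : 0 < b) (x y : ℝ) :
    kerBound k a τ (y - x) * Real.exp (-(b ^ 2)⁻¹ * x ^ 2) ≤
      (4 ^ k * (2 ^ k * k.factorial * Real.exp 1) + 4) *
        ((a / τ + a * b ^ 2 / τ ^ 2) ^ k + (a * y ^ 2 / τ ^ 2) ^ (3 / 4 : ℝ)) *
          Real.exp (-((b ^ 2)⁻¹ * x ^ 2 / 2)) := by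
  set s : ℝ := (b ^ 2)⁻¹ * x ^ 2 with hs
  have hs0 : 0 ≤ s := by positivity
  have hE0 : 0 ≤ a / τ + a * b ^ 2 / τ ^ 2 := by positivity
  set E := a / τ + a * b ^ 2 / τ ^ 2 with hE
  have hX0 : 0 ≤ a / τ + a * (y - x) ^ 2 / τ ^ 2 := by positivity
  have hy0 : 0 ≤ a * y ^ 2 / τ ^ 2 := by positivity
  have hxs : a * x ^ 2 / τ ^ 2 = a * b ^ 2 / τ ^ 2 * s := by
    rw [hs]
    field_simp
  have hX : a / τ + a * (y - x) ^ 2 / τ ^ 2 ≤ 2 * E * (1 + s) + 2 * (a * y ^ 2 / τ ^ 2) := by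
    have h1 : a * (y - x) ^ 2 / τ ^ 2 ≤ 2 * (a * x ^ 2 / τ ^ 2) + 2 * (a * y ^ 2 / τ ^ 2) := by
      have : a * (y - x) ^ 2 / τ ^ 2 + a * (y + x) ^ 2 / τ ^ 2 =
        2 * (a * x ^ 2 / τ ^ 2) + 2 * (a * y ^ 2 / τ ^ 2) := by ring
      have h2 : 0 ≤ a * (y + x) ^ 2 / τ ^ 2 := by positivity
      linarith
    rw [hxs] at h1
    have h2 : 0 ≤ a / τ := by positivity
    have h3 : 0 ≤ a * b ^ 2 / τ ^ 2 := by positivity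
    have h4 : 0 ≤ a / τ * s := by positivity
    rw [hE]
    nlinarith
  have hexp : Real.exp (-s) ≤ Real.exp (-(s / 2)) := Real.exp_le_exp.2 (by linarith)
  have hK0 : 0 ≤ kerBound k a τ (y - x) := le_min (by positivity) (by positivity)
  rw [neg_mul, ← hs]
  rcases le_total (2 * (a * y ^ 2 / τ ^ 2)) (2 * E * (1 + s)) with h | h
  · have h1 : kerBound k a τ (y - x) ≤ (4 * E * (1 + s)) ^ k :=
      (min_le_left _ _).trans (pow_le_pow_left₀ hX0 (by linarith) k)
    calc kerBound k a τ (y - x) * Real.exp (-s)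
        ≤ (4 * E * (1 + s)) ^ k * Real.exp (-s) := by gcongr
      _ = 4 ^ k * E ^ k * ((1 + s) ^ k * Real.exp (-s)) := by rw [mul_pow, mul_pow]; ring
      _ ≤ 4 ^ k * E ^ k * (2 ^ k * k.factorial * Real.exp 1 * Real.exp (-(s / 2))) := by
        exact mul_le_mul_of_nonneg_left (one_add_pow_mul_exp_le k hs0) (by positivity)
      _ = 4 ^ k * (2 ^ k * k.factorial * Real.exp 1) * E ^ k * Real.exp (-(s / 2)) := by ring
      _ ≤ _ := by
        gcongr
        · linarith
        · have : 0 ≤ (a * y ^ 2 / τ ^ 2) ^ (3 / 4 : ℝ) := by positivity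
          linarith
  · have h1 : kerBound k a τ (y - x) ≤ 4 * (a * y ^ 2 / τ ^ 2) ^ (3 / 4 : ℝ) := by
      refine (min_le_right _ _).trans ?_
      calc _ ≤ (4 * (a * y ^ 2 / τ ^ 2)) ^ (3 / 4 : ℝ) :=
            Real.rpow_le_rpow hX0 (by linarith) (by norm_num)
        _ = 4 ^ (3 / 4 : ℝ) * (a * y ^ 2 / τ ^ 2) ^ (3 / 4 : ℝ) :=
            Real.mul_rpow (by norm_num) hy0
        _ ≤ 4 ^ (1 : ℝ) * (a * y ^ 2 / τ ^ 2) ^ (3 / 4 : ℝ) := by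
            gcongr <;> norm_num
        _ = _ := by norm_num
    calc kerBound k a τ (y - x) * Real.exp (-s)
        ≤ 4 * (a * y ^ 2 / τ ^ 2) ^ (3 / 4 : ℝ) * Real.exp (-(s / 2)) := by gcongr
      _ ≤ _ := by
        gcongr
        · have : 0 ≤ (4 : ℝ) ^ k * (2 ^ k * k.factorial * Real.exp 1) := by positivity
          linarith
        · have : 0 ≤ E ^ k := by positivity
          linarith

theorem integral_exp_mul_norm_le {b : ℝ} (hb : 0 < b) (ψ : 𝓢(ℝ, ℂ)) :
    ∫ x, Real.exp (-((b ^ 2)⁻¹ * x ^ 2 / 2)) * ‖ψ x‖ ≤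
      2 * Real.sqrt b * ‖(ψ.toLp 2 : L2)‖ := by
  have hg : ∀ x : ℝ, Real.exp (-((b ^ 2)⁻¹ * x ^ 2 / 2)) ^ 2 = Real.exp (-(b ^ 2)⁻¹ * x ^ 2) := by
    intro x
    rw [← Real.exp_nat_mul]
    congr 1
    push_cast
    ring
  have hint : Integrable fun x : ℝ => Real.exp (-(b ^ 2)⁻¹ * x ^ 2) :=
    integrable_exp_neg_mul_sq (by positivity)
  have hm : MemLp (fun x : ℝ => Real.exp (-((b ^ 2)⁻¹ * x ^ 2 / 2))) 2 volume := by
    rw [memLp_two_iff_integrable_sq (Continuous.aestronglyMeasurable (by fun_prop))]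
    simpa only [hg] using hint
  have h1 := integral_mul_le_Lp_mul_Lq_of_nonneg (μ := volume) (p := 2) (q := 2)
    Real.HolderConjugate.two_two
    (f := fun x : ℝ => Real.exp (-((b ^ 2)⁻¹ * x ^ 2 / 2))) (g := fun x => ‖ψ x‖)
    (ae_of_all _ fun x => (Real.exp_pos _).le) (ae_of_all _ fun x => norm_nonneg _)
    (by simpa using hm) (by simpa using (ψ.memLp 2).norm)
  refine h1.trans ?_
  have e1 : ∫ x, ‖ψ x‖ ^ (2 : ℝ) = ‖(ψ.toLp 2 : L2)‖ ^ 2 := by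
    rw [norm_sq_eq_integral]
    apply integral_congr_ae
    filter_upwards [ψ.coeFn_toLp 2 volume] with x hx
    rw [hx, Real.rpow_two]
  have e2 : ∫ x, Real.exp (-((b ^ 2)⁻¹ * x ^ 2 / 2)) ^ (2 : ℝ) = Real.sqrt Real.pi * b := by
    simp_rw [Real.rpow_two, hg]
    rw [integral_gaussian, div_inv_eq_mul, Real.sqrt_mul Real.pi_pos.le, Real.sqrt_sq hb.le]
  rw [e1, e2, ← Real.sqrt_eq_rpow, ← Real.sqrt_eq_rpow, Real.sqrt_sq (norm_nonneg _),
    Real.sqrt_mul (Real.sqrt_nonneg _)]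
  gcongr
  rw [Real.sqrt_le_left (by norm_num), Real.sqrt_le_left (by norm_num)]
  nlinarith [Real.pi_lt_four]

/-- Multiplication of a Schwartz function with the Gaussian `exp(-x²/b²)`. -/
def gaussMul (b : ℝ) (ψ : 𝓢(ℝ, ℂ)) : 𝓢(ℝ, ℂ) :=
  SchwartzMap.smulLeftCLM ℂ (gaussSymbol (((b ^ 2)⁻¹ : ℝ) : ℂ)) ψ

theorem inv_sq_re_nonneg (b : ℝ) : 0 ≤ (((b ^ 2)⁻¹ : ℝ) : ℂ).re := by
  rw [Complex.ofReal_re]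
  positivity

theorem norm_gaussMul (b : ℝ) (ψ : 𝓢(ℝ, ℂ)) (x : ℝ) :
    ‖gaussMul b ψ x‖ = Real.exp (-(b ^ 2)⁻¹ * x ^ 2) * ‖ψ x‖ := by
  rw [gaussMul, SchwartzMap.smulLeftCLM_apply_apply (temperate_gaussSymbol (inv_sq_re_nonneg b)),
    norm_smul, norm_gaussSymbol, Complex.ofReal_re]

theorem norm_integral_kernel_le {k : ℕ} {a τ b : ℝ} (ha : 0 < a) (hτ : 0 < τ) (hb : 0 < b)
    (ψ : 𝓢(ℝ, ℂ)) (y : ℝ) {K : ℝ → ℂ} {A : ℝ} (hA : 0 ≤ A)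
    (hK : ∀ Y, ‖K Y‖ ≤ A * kerBound k a τ Y) :
    ‖∫ x, K (y - x) * gaussMul b ψ x‖ ≤
      A * (2 * (4 ^ k * (2 ^ k * k.factorial * Real.exp 1) + 4)) *
        ((a / τ + a * b ^ 2 / τ ^ 2) ^ k + (a * y ^ 2 / τ ^ 2) ^ (3 / 4 : ℝ)) *
          (Real.sqrt b * ‖(ψ.toLp 2 : L2)‖) := by
  set W : ℝ := (4 ^ k * (2 ^ k * k.factorial * Real.exp 1) + 4) *
        ((a / τ + a * b ^ 2 / τ ^ 2) ^ k + (a * y ^ 2 / τ ^ 2) ^ (3 / 4 : ℝ)) with hW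
  have hW0 : 0 ≤ W := by positivity
  have hb' : ∀ x, ‖K (y - x) * gaussMul b ψ x‖ ≤
      A * W * (Real.exp (-((b ^ 2)⁻¹ * x ^ 2 / 2)) * ‖ψ x‖) := by
    intro x
    rw [norm_mul, norm_gaussMul]
    calc _ ≤ A * kerBound k a τ (y - x) * (Real.exp (-(b ^ 2)⁻¹ * x ^ 2) * ‖ψ x‖) := by
          gcongr
          exact hK _
      _ = A * (kerBound k a τ (y - x) * Real.exp (-(b ^ 2)⁻¹ * x ^ 2)) * ‖ψ x‖ := by ring
      _ ≤ A * (W * Real.exp (-((b ^ 2)⁻¹ * x ^ 2 / 2))) * ‖ψ x‖ := by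
          exact mul_le_mul_of_nonneg_right (mul_le_mul_of_nonneg_left
            (kerBound_mul_exp_le k ha hτ hb x y) hA) (norm_nonneg _)
      _ = _ := by ring
  have hint : Integrable fun x : ℝ => Real.exp (-((b ^ 2)⁻¹ * x ^ 2 / 2)) * ‖ψ x‖ := by
    refine ψ.integrable.norm.bdd_mul (c := 1) (Continuous.aestronglyMeasurable (by fun_prop))
      (ae_of_all _ fun x => ?_)
    rw [Real.norm_eq_abs, abs_of_pos (Real.exp_pos _), Real.exp_le_one_iff]
    have : 0 ≤ (b ^ 2)⁻¹ * x ^ 2 / 2 := by positivity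
    linarith
  refine (norm_integral_le_of_norm_le (hint.const_mul (A * W)) (ae_of_all _ hb')).trans ?_
  rw [integral_const_mul]
  calc _ ≤ A * W * (2 * Real.sqrt b * ‖(ψ.toLp 2 : L2)‖) := by
        gcongr
        exact integral_exp_mul_norm_le hb ψ
    _ = _ := by
        rw [hW]
        ring

/-- The dispersive estimate: pointwise bounds for `e^{iτΔ} n(D) (e^{-x²/b²} ψ)` and its
derivative, where `n(ξ) = (e^{-aξ²} - 1)^k`. -/
theorem exists_dispersive_bound {k : ℕ} (hk : 1 ≤ k) : ∃ C : ℝ, 0 ≤ C ∧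
    ∀ {a τ b : ℝ}, 1 ≤ a → 0 < τ → 0 < b → ∀ (ψ : 𝓢(ℝ, ℂ)) (y : ℝ),
      ‖schwartzMult (fun ξ => gaussSymbol (Complex.I * τ) ξ * diffSymbol a k ξ)
        (gaussMul b ψ) y‖ ≤ C * (Real.sqrt τ)⁻¹ *
        ((a / τ + a * b ^ 2 / τ ^ 2) ^ k + (a * y ^ 2 / τ ^ 2) ^ (3 / 4 : ℝ)) *
          (Real.sqrt b * ‖(ψ.toLp 2 : L2)‖) ∧
      ‖schwartzMult (fun ξ => gaussSymbol (Complex.I * τ) ξ * (-Complex.I * ξ * diffSymbol a k ξ))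
        (gaussMul b ψ) y‖ ≤ C * (Real.sqrt τ)⁻¹ *
        ((a / τ + a * b ^ 2 / τ ^ 2) ^ k + (a * y ^ 2 / τ ^ 2) ^ (3 / 4 : ℝ)) *
          (Real.sqrt b * ‖(ψ.toLp 2 : L2)‖) := by
  refine ⟨(k.factorial * Real.exp 4 * 2 * 2 ^ k) *
    (2 * (4 ^ k * (2 ^ k * k.factorial * Real.exp 1) + 4)), by positivity, ?_⟩
  intro a τ b ha hτ hb ψ y
  have ha0 : 0 < a := by linarith
  have hre : ∀ ε : ℝ, ((ε : ℂ) + Complex.I * τ).re = ε := fun ε => by simp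
  have him : ∀ ε : ℝ, ((ε : ℂ) + Complex.I * τ).im = τ := fun ε => by simp
  have hI : 0 ≤ (Complex.I * (τ : ℂ)).re := by simp
  constructor
  · have ht : (fun ξ => gaussSymbol (Complex.I * τ) ξ * diffSymbol a k ξ).HasTemperateGrowth :=
      (temperate_gaussSymbol hI).mul (temperate_diffSymbol ha0.le k)
    refine le_of_tendsto (tendsto_schwartzMult_gauss ht (gaussMul b ψ) y).norm ?_
    filter_upwards [self_mem_nhdsWithin] with ε hε
    have hε' : 0 < ((ε : ℂ) + Complex.I * τ).re := by rw [hre]; exact hε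
    have e : (fun ξ => gaussSymbol ε ξ * (gaussSymbol (Complex.I * τ) ξ * diffSymbol a k ξ)) =
        fun ξ => gaussSymbol ((ε : ℂ) + Complex.I * τ) ξ * diffSymbol a k ξ := by
      funext ξ
      rw [gaussSymbol_add, mul_assoc]
    rw [e, schwartzMult_gauss_diff hε' ha0.le]
    refine (norm_integral_kernel_le ha0 hτ hb ψ y
      (K := fun Y => heatDiff k 0 (Y ^ 2 / 4) a ((ε : ℂ) + Complex.I * τ))
      (A := (k.factorial * Real.exp 4 * 2 * 2 ^ k) * (Real.sqrt τ)⁻¹) (by positivity)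
      (fun Y => norm_heatDiff_zero_le hk ha hτ hε'.le (him ε))).trans (le_of_eq (by ring))
  · have ht : (fun ξ : ℝ => gaussSymbol (Complex.I * τ) ξ *
        (-Complex.I * ξ * diffSymbol a k ξ)).HasTemperateGrowth :=
      (temperate_gaussSymbol hI).mul (temperate_neg_I_mul.mul (temperate_diffSymbol ha0.le k))
    refine le_of_tendsto (tendsto_schwartzMult_gauss ht (gaussMul b ψ) y).norm ?_
    filter_upwards [self_mem_nhdsWithin] with ε hε
    have hε' : 0 < ((ε : ℂ) + Complex.I * τ).re := by rw [hre]; exact hε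
    have e : (fun ξ : ℝ => gaussSymbol ε ξ * (gaussSymbol (Complex.I * τ) ξ *
        (-Complex.I * ξ * diffSymbol a k ξ))) =
        fun ξ : ℝ => gaussSymbol ((ε : ℂ) + Complex.I * τ) ξ *
          (-Complex.I * ξ * diffSymbol a k ξ) := by
      funext ξ
      rw [gaussSymbol_add]
      ring
    rw [e, schwartzMult_deriv_gauss_diff hε' ha0.le]
    refine (norm_integral_kernel_le ha0 hτ hb ψ y
      (K := fun Y => -((Y : ℂ) / 2) * heatDiff k 1 (Y ^ 2 / 4) a ((ε : ℂ) + Complex.I * τ))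
      (A := (k.factorial * Real.exp 4 * 2 * 2 ^ k) * (Real.sqrt τ)⁻¹) (by positivity)
      (fun Y => norm_heatDiff_one_le hk ha hτ hε'.le (him ε))).trans (le_of_eq (by ring))

/-! ### Choice of exponents: integrable decay at the scales a = t^{2δ}, b = t^β. -/

/-- The base is at most 2t^{-κ}(t/τ). Two of the k factors t/τ supply τ^{-2}, and the k factors
t^{-κ} pay for all positive powers of t, whence the condition on κk. -/
theorem low_term_le {β δ κ γ t τ : ℝ} {k : ℕ} (hk : 2 ≤ k) (hκ1 : κ ≤ 1 - 2 * δ)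
    (hκ2 : κ ≤ 2 - 2 * δ - 2 * β) (hkκ : β / 2 + 1 + γ ≤ κ * k) (ht : 1 ≤ t) (hτ : t ≤ τ) :
    (t ^ (2 * δ) / τ + t ^ (2 * δ) * (t ^ β) ^ 2 / τ ^ 2) ^ k * t ^ (β / 2) ≤
      2 ^ k * t ^ (1 - γ) * (τ ^ 2)⁻¹ := by
  have ht0 : 0 < t := by linarith
  have hτ0 : 0 < τ := by linarith
  have hq : t / τ ≤ 1 := (div_le_one hτ0).2 hτ
  have hq0 : 0 ≤ t / τ := by positivity
  have h1 : t ^ (2 * δ) / τ ≤ t ^ (-κ) * (t / τ) := by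
    have : t ^ (2 * δ) / τ = t ^ (2 * δ - 1) * (t / τ) := by
      rw [Real.rpow_sub_one ht0.ne']
      field_simp
    rw [this]
    exact mul_le_mul_of_nonneg_right (Real.rpow_le_rpow_of_exponent_le ht (by linarith)) hq0
  have h2 : t ^ (2 * δ) * (t ^ β) ^ 2 / τ ^ 2 ≤ t ^ (-κ) * (t / τ) := by
    have : t ^ (2 * δ) * (t ^ β) ^ 2 / τ ^ 2 = t ^ (2 * δ + 2 * β - 2) * (t / τ) ^ 2 := by
      rw [Real.rpow_sub ht0, Real.rpow_add ht0, mul_comm 2 β, Real.rpow_mul ht0.le β 2,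
        Real.rpow_two, Real.rpow_two]
      field_simp
    rw [this]
    have e : (t / τ) ^ 2 ≤ t / τ := by nlinarith
    have e2 : t ^ (2 * δ + 2 * β - 2) ≤ t ^ (-κ) :=
      Real.rpow_le_rpow_of_exponent_le ht (by linarith)
    gcongr
  have h3 : (t ^ (2 * δ) / τ + t ^ (2 * δ) * (t ^ β) ^ 2 / τ ^ 2) ^ k ≤
      2 ^ k * t ^ (-κ * k) * (t / τ) ^ 2 := by
    calc _ ≤ (2 * t ^ (-κ) * (t / τ)) ^ k := by
          refine pow_le_pow_left₀ (by positivity) ?_ k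
          linarith
      _ = 2 ^ k * t ^ (-κ * k) * (t / τ) ^ k := by
          rw [mul_pow, mul_pow, Real.rpow_mul_natCast ht0.le]
      _ ≤ _ := by
          gcongr ?_ * ?_
          exact pow_le_pow_of_le_one hq0 hq hk
  calc _ ≤ 2 ^ k * t ^ (-κ * k) * (t / τ) ^ 2 * t ^ (β / 2) := by gcongr
    _ = 2 ^ k * t ^ (-κ * k + 2 + β / 2) * (τ ^ 2)⁻¹ := by
        rw [Real.rpow_add ht0, Real.rpow_add ht0, Real.rpow_two]
        field_simp
    _ ≤ _ := by
        have := Real.rpow_le_rpow_of_exponent_le ht (x := t) (y := -κ * k + 2 + β / 2)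
          (z := 1 - γ) (by linarith)
        gcongr

/-- The exponent 3/4 is chosen so that τ^{-1/2}(τ^{-2})^{3/4} = τ^{-2}, at the price of the growth
|y|^{3/2}. -/
theorem high_term_le {β δ t τ y : ℝ} (ht : 1 ≤ t) (hτ : t ≤ τ) :
    (Real.sqrt τ)⁻¹ * (t ^ (2 * δ) * y ^ 2 / τ ^ 2) ^ (3 / 4 : ℝ) * t ^ (β / 2) ≤
      t ^ (β / 2 + 3 * δ / 2) * (τ ^ 2)⁻¹ * (1 + y ^ 2) ^ (3 / 4 : ℝ) := by
  have ht0 : 0 < t := by linarith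
  have hτ0 : 0 < τ := by linarith
  have e1 : (t ^ (2 * δ) * y ^ 2 / τ ^ 2) ^ (3 / 4 : ℝ) =
      t ^ (3 * δ / 2) * (y ^ 2) ^ (3 / 4 : ℝ) * (τ ^ (3 / 2 : ℝ))⁻¹ := by
    rw [Real.div_rpow (by positivity) (by positivity),
      Real.mul_rpow (by positivity) (by positivity),
      ← Real.rpow_mul ht0.le, ← Real.rpow_natCast τ 2, ← Real.rpow_mul hτ0.le, div_eq_mul_inv]
    congr 3
    · ring
    · norm_num
  have e2 : (Real.sqrt τ)⁻¹ * (τ ^ (3 / 2 : ℝ))⁻¹ = (τ ^ 2)⁻¹ := by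
    rw [← mul_inv, Real.sqrt_eq_rpow, ← Real.rpow_add hτ0]
    norm_num
  calc _ = t ^ (β / 2) * t ^ (3 * δ / 2) * (y ^ 2) ^ (3 / 4 : ℝ) *
        ((Real.sqrt τ)⁻¹ * (τ ^ (3 / 2 : ℝ))⁻¹) := by rw [e1]; ring
    _ = t ^ (β / 2 + 3 * δ / 2) * (τ ^ 2)⁻¹ * (y ^ 2) ^ (3 / 4 : ℝ) := by
        rw [e2, Real.rpow_add ht0]
        ring
    _ ≤ _ := by
        gcongr
        linarith

theorem combined_term_le {β δ κ γ t τ C N : ℝ} {k : ℕ} (hk : 2 ≤ k) (hκ1 : κ ≤ 1 - 2 * δ)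
    (hκ2 : κ ≤ 2 - 2 * δ - 2 * β) (hkκ : β / 2 + 1 + γ ≤ κ * k)
    (hγ : β / 2 + 3 * δ / 2 = 1 - γ) (ht : 1 ≤ t) (hτ : t ≤ τ) (hC : 0 ≤ C) (hN : 0 ≤ N) (y : ℝ) :
    C * (Real.sqrt τ)⁻¹ * ((t ^ (2 * δ) / τ + t ^ (2 * δ) * (t ^ β) ^ 2 / τ ^ 2) ^ k +
      (t ^ (2 * δ) * y ^ 2 / τ ^ 2) ^ (3 / 4 : ℝ)) * (Real.sqrt (t ^ β) * N) ≤
        C * (2 ^ k + 1) * t ^ (1 - γ) * N * (τ ^ 2)⁻¹ * (1 + y ^ 2) ^ (3 / 4 : ℝ) := by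
  have ht0 : 0 < t := by linarith
  have hτ0 : 0 < τ := by linarith
  have hsb : Real.sqrt (t ^ β) = t ^ (β / 2) := by
    rw [Real.sqrt_eq_rpow, ← Real.rpow_mul ht0.le]
    congr 1
    ring
  have hsτ : (Real.sqrt τ)⁻¹ ≤ 1 := inv_le_one_of_one_le₀ (Real.one_le_sqrt.2 (ht.trans hτ))
  have hy : 1 ≤ (1 + y ^ 2) ^ (3 / 4 : ℝ) := Real.one_le_rpow (by nlinarith) (by norm_num)
  have h1 := low_term_le hk hκ1 hκ2 hkκ ht hτ
  have h2 := high_term_le (β := β) (δ := δ) (y := y) ht hτ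
  rw [hγ] at h2
  have hE0 : 0 ≤ (t ^ (2 * δ) / τ + t ^ (2 * δ) * (t ^ β) ^ 2 / τ ^ 2) ^ k := by positivity
  rw [hsb]
  generalize (t ^ (2 * δ) / τ + t ^ (2 * δ) * (t ^ β) ^ 2 / τ ^ 2) ^ k = E at *
  generalize (t ^ (2 * δ) * y ^ 2 / τ ^ 2) ^ (3 / 4 : ℝ) = Z at *
  generalize (1 + y ^ 2) ^ (3 / 4 : ℝ) = Y at *
  have h3 : (Real.sqrt τ)⁻¹ * (E * t ^ (β / 2)) ≤ 2 ^ k * t ^ (1 - γ) * (τ ^ 2)⁻¹ * Y := by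
    calc _ ≤ 1 * (E * t ^ (β / 2)) := by gcongr
      _ ≤ 2 ^ k * t ^ (1 - γ) * (τ ^ 2)⁻¹ := by rwa [one_mul]
      _ ≤ _ := le_mul_of_one_le_right (by positivity) hy
  calc C * (Real.sqrt τ)⁻¹ * (E + Z) * (t ^ (β / 2) * N)
      = C * N * ((Real.sqrt τ)⁻¹ * (E * t ^ (β / 2)) + (Real.sqrt τ)⁻¹ * Z * t ^ (β / 2)) := by
        ring
    _ ≤ C * N * (2 ^ k * t ^ (1 - γ) * (τ ^ 2)⁻¹ * Y + t ^ (1 - γ) * (τ ^ 2)⁻¹ * Y) :=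
        mul_le_mul_of_nonneg_left (add_le_add h3 h2) (by positivity)
    _ = _ := by ring

/-- Integrable decay in time of `e^{iτΔ} n(D) (e^{-x²/b²} ψ)` and of its derivative, uniformly in
`τ ≥ t`, at the scales `a = t^{2δ}` and `b = t^β`. -/
theorem exists_decay_bound {β δ : ℝ} (hδ0 : 0 ≤ δ) (hδ' : δ < 1 / 2) (hβδ : β + δ < 1) :
    ∃ k : ℕ, ∃ C γ : ℝ, 0 ≤ C ∧ 0 < γ ∧ ∀ {t τ : ℝ}, 1 ≤ t → t ≤ τ →
      ∀ (ψ : 𝓢(ℝ, ℂ)) (y : ℝ),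
      ‖schwartzMult (fun ξ => gaussSymbol (Complex.I * τ) ξ * diffSymbol (t ^ (2 * δ)) k ξ)
        (gaussMul (t ^ β) ψ) y‖ ≤
          C * t ^ (1 - γ) * ‖(ψ.toLp 2 : L2)‖ * (τ ^ 2)⁻¹ * (1 + y ^ 2) ^ (3 / 4 : ℝ) ∧
      ‖schwartzMult (fun ξ => gaussSymbol (Complex.I * τ) ξ *
        (-Complex.I * ξ * diffSymbol (t ^ (2 * δ)) k ξ)) (gaussMul (t ^ β) ψ) y‖ ≤
          C * t ^ (1 - γ) * ‖(ψ.toLp 2 : L2)‖ * (τ ^ 2)⁻¹ * (1 + y ^ 2) ^ (3 / 4 : ℝ) := by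
  -- Positive because β/2 + 3δ/2 = (β + δ)/2 + δ < 1/2 + 1/2.
  obtain ⟨γ, hγ⟩ : ∃ γ : ℝ, γ = 1 - β / 2 - 3 * δ / 2 := ⟨_, rfl⟩
  have hγ0 : 0 < γ := by linarith
  obtain ⟨κ, hκ0, hκ1, hκ2⟩ : ∃ κ : ℝ, 0 < κ ∧ κ ≤ 1 - 2 * δ ∧ κ ≤ 2 - 2 * δ - 2 * β :=
    ⟨min (1 - 2 * δ) (2 - 2 * δ - 2 * β), lt_min (by linarith) (by linarith), min_le_left _ _,
      min_le_right _ _⟩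
  -- Only here is the order of vanishing of the cutoff at zero frequency fixed: it must be large
  -- compared with 1/κ. Adding 2 secures k ≥ 2.
  obtain ⟨k, hk, hkκ⟩ : ∃ k : ℕ, 2 ≤ k ∧ β / 2 + 1 + γ ≤ κ * k := by
    obtain ⟨k₀, hk₀⟩ := exists_nat_ge ((β / 2 + 1 + γ) / κ)
    refine ⟨k₀ + 2, by omega, ?_⟩
    rw [div_le_iff₀ hκ0] at hk₀
    push_cast
    nlinarith
  obtain ⟨C, hC0, hC⟩ := exists_dispersive_bound (k := k) (by omega)
  refine ⟨k, C * (2 ^ k + 1), γ, by positivity, hγ0, ?_⟩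
  intro t τ ht hτ ψ y
  have ht0 : 0 < t := by linarith
  have hτ0 : 0 < τ := by linarith
  have ha : 1 ≤ t ^ (2 * δ) := Real.one_le_rpow ht (by linarith)
  have key := combined_term_le hk hκ1 hκ2 hkκ (by linarith) ht hτ hC0
    (norm_nonneg (ψ.toLp 2 : L2)) y
  have hb : 0 < t ^ β := by positivity
  exact ⟨(hC ha hτ0 hb ψ y).1.trans key, (hC ha hτ0 hb ψ y).2.trans key⟩

/-! ### The potential and its pairing with test functions. -/

theorem jBra_pos (x : ℝ) : 0 < jBra x := Real.sqrt_pos.2 (by positivity)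

theorem continuous_jBra : Continuous jBra := by
  unfold jBra
  fun_prop

theorem one_le_jBra (x : ℝ) : 1 ≤ jBra x := Real.one_le_sqrt.2 (by nlinarith [sq_nonneg x])

theorem continuous_jBra_rpow (σ : ℝ) : Continuous fun x => jBra x ^ σ :=
  continuous_jBra.rpow_const fun x => Or.inl (jBra_pos x).ne'

/-- A decaying potential has a jointly measurable representative satisfying the decay bound
everywhere. -/
theorem IsDecayingPotential.exists_representative {σ : ℝ} {V : ℝ → ℝ → ℂ}
    (hV : IsDecayingPotential σ V) : ∃ V' : ℝ → ℝ → ℂ, StronglyMeasurable (Function.uncurry V') ∧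
      (∃ C : ℝ, 0 ≤ C ∧ ∀ s x, ‖V' s x‖ ≤ C * (jBra x ^ σ)⁻¹) ∧
      ∀ᵐ s ∂(volume.restrict (Ioi (0 : ℝ))), V s =ᵐ[volume] V' s := by
  obtain ⟨⟨hm, hfin⟩, -⟩ := hV
  set g := hm.mk _ with hg
  have hgm : StronglyMeasurable g := hm.stronglyMeasurable_mk
  set C : ℝ := (eLpNorm (fun p : ℝ × ℝ => ((jBra p.2 ^ σ : ℝ) : ℂ) * V p.1 p.2) ∞
    spaceTime).toReal with hC
  have hjm : StronglyMeasurable fun p : ℝ × ℝ => (((jBra p.2 ^ σ)⁻¹ : ℝ) : ℂ) := by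
    refine Continuous.stronglyMeasurable ?_
    refine Complex.continuous_ofReal.comp (Continuous.inv₀ ?_ fun p => ?_)
    · exact (continuous_jBra_rpow σ).comp continuous_snd
    · exact (Real.rpow_pos_of_pos (jBra_pos _) _).ne'
  -- Cutting `g` off where it exceeds the essential supremum makes the decay bound hold at every
  -- point. The change is on a null set, so by Fubini almost every time slice is unaffected.
  set A : Set (ℝ × ℝ) := {p | ‖g p‖ ≤ C} with hA
  have hAm : MeasurableSet A := measurableSet_le hgm.norm.measurable measurable_const
  refine ⟨fun s x => A.indicator (fun p => (((jBra p.2 ^ σ)⁻¹ : ℝ) : ℂ) * g p) (s, x),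
    (hjm.mul hgm).indicator hAm, ⟨C, ENNReal.toReal_nonneg, fun s x => ?_⟩, ?_⟩
  · have hpos : 0 < (jBra x ^ σ)⁻¹ := inv_pos.2 (Real.rpow_pos_of_pos (jBra_pos _) _)
    beta_reduce
    by_cases h : (s, x) ∈ A
    · rw [indicator_of_mem h, norm_mul, Complex.norm_real, Real.norm_of_nonneg hpos.le, mul_comm]
      exact mul_le_mul_of_nonneg_right h hpos.le
    · rw [indicator_of_notMem h, norm_zero]
      exact mul_nonneg ENNReal.toReal_nonneg hpos.le
  · have h1 : ∀ᵐ p ∂spaceTime, ((jBra p.2 ^ σ : ℝ) : ℂ) * V p.1 p.2 = g p := hm.ae_eq_mk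
    have h2 : ∀ᵐ p ∂spaceTime, ‖((jBra p.2 ^ σ : ℝ) : ℂ) * V p.1 p.2‖ ≤ C := by
      have := ae_le_eLpNormEssSup (f := fun p : ℝ × ℝ => ((jBra p.2 ^ σ : ℝ) : ℂ) * V p.1 p.2)
        (μ := spaceTime)
      rw [eLpNorm_exponent_top] at hfin hC
      filter_upwards [this] with p hp
      rw [hC, ← toReal_enorm]
      exact ENNReal.toReal_mono hfin.ne hp
    have h3 : ∀ᵐ p ∂spaceTime, V p.1 p.2 =
        A.indicator (fun p => (((jBra p.2 ^ σ)⁻¹ : ℝ) : ℂ) * g p) p := by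
      filter_upwards [h1, h2] with p hp1 hp2
      have hp : p ∈ A := by
        change ‖g p‖ ≤ C
        rwa [← hp1]
      have hne : ((jBra p.2 ^ σ : ℝ) : ℂ) ≠ 0 := by
        exact_mod_cast (Real.rpow_pos_of_pos (jBra_pos _) _).ne'
      rw [indicator_of_mem hp, ← hp1, Complex.ofReal_inv, inv_mul_cancel_left₀ hne]
    exact Measure.ae_ae_of_ae_prod h3

section Potential

variable {σ C : ℝ} {V : ℝ → ℝ → ℂ} {u : ℝ → L2}

/-- The pairing of `V(s) f` with a Schwartz function. -/
def potPair (V : ℝ → ℝ → ℂ) (φ : 𝓢(ℝ, ℂ)) (f : L2) (s : ℝ) : ℂ := ∫ x, V s x * f x * φ x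

theorem memLp_potential_mul (hVm : StronglyMeasurable (Function.uncurry V))
    (hσ : 0 ≤ σ) (hC : 0 ≤ C) (hVb : ∀ s x, ‖V s x‖ ≤ C * (jBra x ^ σ)⁻¹) (φ : 𝓢(ℝ, ℂ)) (s : ℝ) :
    MemLp (fun x => V s x * φ x) 2 volume := by
  refine MemLp.of_le_mul (c := C) (φ.memLp 2) ?_ (ae_of_all _ fun x => ?_)
  · exact ((hVm.comp_measurable measurable_prodMk_left).mul
      φ.continuous.stronglyMeasurable).aestronglyMeasurable
  · rw [norm_mul]
    gcongr
    refine (hVb s x).trans (mul_le_of_le_one_right hC ?_)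
    exact inv_le_one_of_one_le₀ (Real.one_le_rpow (one_le_jBra x) hσ)

theorem norm_potPair_le (hVm : StronglyMeasurable (Function.uncurry V))
    (hσ : 0 ≤ σ) (hC : 0 ≤ C) (hVb : ∀ s x, ‖V s x‖ ≤ C * (jBra x ^ σ)⁻¹) (φ : 𝓢(ℝ, ℂ)) (f : L2)
    (s : ℝ) {B : ℝ} (hB : 0 ≤ B) (hB2 : ∫ x, ‖V s x * φ x‖ ^ 2 ≤ B ^ 2) :
    ‖potPair V φ f s‖ ≤ B * ‖f‖ := by
  have hmem := memLp_potential_mul hVm hσ hC hVb φ s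
  have e : potPair V φ f s = inner ℂ (star (hmem.toLp _ : L2)) f := by
    rw [potPair, L2.inner_def]
    apply integral_congr_ae
    filter_upwards [Lp.coeFn_star (hmem.toLp _ : L2), hmem.coeFn_toLp] with x h1 h2
    rw [h1, Pi.star_apply, h2]
    simp only [RCLike.inner_apply, RCLike.star_def, RingHomCompTriple.comp_apply, RingHom.id_apply]
    ring
  have h2 : ‖(hmem.toLp _ : L2)‖ ≤ B := by
    refine (pow_le_pow_iff_left₀ (norm_nonneg _) hB two_ne_zero).1 ?_
    rw [norm_sq_eq_integral]
    refine le_trans (le_of_eq ?_) hB2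
    apply integral_congr_ae
    filter_upwards [hmem.coeFn_toLp] with x h2
    rw [h2]
  rw [e]
  refine (norm_inner_le_norm _ _).trans ?_
  rw [norm_star_L2]
  gcongr

theorem norm_potPair_le_norm (hVm : StronglyMeasurable (Function.uncurry V))
    (hσ : 0 ≤ σ) (hC : 0 ≤ C) (hVb : ∀ s x, ‖V s x‖ ≤ C * (jBra x ^ σ)⁻¹) (φ : 𝓢(ℝ, ℂ)) (f : L2)
    (s : ℝ) : ‖potPair V φ f s‖ ≤ C * ‖(φ.toLp 2 : L2)‖ * ‖f‖ := by
  refine norm_potPair_le hVm hσ hC hVb φ f s (by positivity) ?_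
  rw [mul_pow, norm_sq_eq_integral, ← integral_const_mul]
  have hi : Integrable fun x => C ^ 2 * ‖(φ.toLp 2 : L2) x‖ ^ 2 :=
    ((memLp_two_iff_integrable_sq_norm (Lp.aestronglyMeasurable _)).1 (Lp.memLp _)).const_mul _
  refine integral_mono_of_nonneg (ae_of_all _ fun x => by positivity) hi ?_
  filter_upwards [φ.coeFn_toLp 2 volume] with x hx
  rw [hx, norm_mul, mul_pow]
  gcongr
  refine (hVb s x).trans (mul_le_of_le_one_right hC ?_)
  exact inv_le_one_of_one_le₀ (Real.one_le_rpow (one_le_jBra x) hσ)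

/-- The constant `‖⟨x⟩^{3/2-σ}‖_{L²}`. -/
def weightConst (σ : ℝ) : ℝ :=
  Real.sqrt (∫ x : ℝ, ((jBra x ^ σ)⁻¹ * (1 + x ^ 2) ^ (3 / 4 : ℝ)) ^ 2)

theorem weight_sq (σ x : ℝ) : ((jBra x ^ σ)⁻¹ * (1 + x ^ 2) ^ (3 / 4 : ℝ)) ^ 2 =
    (1 + ‖x‖ ^ 2) ^ (-(2 * σ - 3) / 2) := by
  have h0 : (0 : ℝ) ≤ 1 + x ^ 2 := by positivity
  have h0' : (0 : ℝ) < 1 + x ^ 2 := by positivity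
  rw [Real.norm_eq_abs, sq_abs, jBra, Real.sqrt_eq_rpow, ← Real.rpow_mul h0, ← Real.rpow_neg h0,
    ← Real.rpow_add h0', ← Real.rpow_natCast, ← Real.rpow_mul h0]
  congr 1
  push_cast
  ring

/-- The squared weight is (1 + x²)^{-(2σ-3)/2}, integrable on the line when 2σ - 3 > 1. The
hypothesis σ > 2 enters here. -/
theorem integrable_weight_sq (hσ : 2 < σ) :
    Integrable fun x : ℝ => ((jBra x ^ σ)⁻¹ * (1 + x ^ 2) ^ (3 / 4 : ℝ)) ^ 2 := by
  simp_rw [weight_sq]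
  exact integrable_rpow_neg_one_add_norm_sq (by simp; linarith)

theorem norm_potPair_le_weight (hVm : StronglyMeasurable (Function.uncurry V))
    (hσ : 2 < σ) (hC : 0 ≤ C) (hVb : ∀ s x, ‖V s x‖ ≤ C * (jBra x ^ σ)⁻¹) (φ : 𝓢(ℝ, ℂ)) (f : L2)
    (s : ℝ) {A : ℝ} (hA : 0 ≤ A) (hφ : ∀ y, ‖φ y‖ ≤ A * (1 + y ^ 2) ^ (3 / 4 : ℝ)) :
    ‖potPair V φ f s‖ ≤ C * A * weightConst σ * ‖f‖ := by
  have hw : 0 ≤ weightConst σ := Real.sqrt_nonneg _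
  refine norm_potPair_le hVm (by linarith) hC hVb φ f s (by positivity) ?_
  rw [mul_pow, weightConst, Real.sq_sqrt (integral_nonneg fun x => by positivity),
    ← integral_const_mul]
  refine integral_mono_of_nonneg (ae_of_all _ fun x => by positivity)
    ((integrable_weight_sq hσ).const_mul _) (ae_of_all _ fun x => ?_)
  simp only
  rw [← mul_pow, norm_mul]
  refine pow_le_pow_left₀ (by positivity) ?_ 2
  calc ‖V s x‖ * ‖φ x‖ ≤ (C * (jBra x ^ σ)⁻¹) * (A * (1 + x ^ 2) ^ (3 / 4 : ℝ)) :=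
        mul_le_mul (hVb s x) (hφ x) (norm_nonneg _) ((norm_nonneg _).trans (hVb s x))
    _ = _ := by ring

theorem integrable_potPair (hVm : StronglyMeasurable (Function.uncurry V))
    (hσ : 0 ≤ σ) (hC : 0 ≤ C) (hVb : ∀ s x, ‖V s x‖ ≤ C * (jBra x ^ σ)⁻¹) (φ : 𝓢(ℝ, ℂ)) (f : L2)
    (s : ℝ) : Integrable fun x => V s x * f x * φ x := by
  have := (Lp.memLp f).integrable_mul (memLp_potential_mul hVm hσ hC hVb φ s)
  refine this.congr (ae_of_all _ fun x => ?_)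
  simp only [Pi.mul_apply]
  ring

theorem potPair_sub (hVm : StronglyMeasurable (Function.uncurry V))
    (hσ : 0 ≤ σ) (hC : 0 ≤ C) (hVb : ∀ s x, ‖V s x‖ ≤ C * (jBra x ^ σ)⁻¹) (φ : 𝓢(ℝ, ℂ)) (f g : L2)
    (s : ℝ) : potPair V φ (f - g) s = potPair V φ f s - potPair V φ g s := by
  rw [potPair, potPair, potPair, ← integral_sub (integrable_potPair hVm hσ hC hVb φ f s)
    (integrable_potPair hVm hσ hC hVb φ g s)]
  apply integral_congr_ae
  filter_upwards [Lp.coeFn_sub f g] with x hx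
  rw [hx, Pi.sub_apply]
  ring

/-- A Carathéodory argument: the pairing is Lipschitz in the L² function and measurable in time,
hence jointly measurable in (r, s) along the continuous curve `u r`; the claim is its restriction to
r = s. -/
theorem stronglyMeasurable_potPair (hVm : StronglyMeasurable (Function.uncurry V))
    (hσ : 0 ≤ σ) (hC : 0 ≤ C) (hVb : ∀ s x, ‖V s x‖ ≤ C * (jBra x ^ σ)⁻¹) (φ : 𝓢(ℝ, ℂ)) {u : ℝ → L2}
    (hu : Continuous u) : StronglyMeasurable fun s => potPair V φ (u s) s := by
  have hcont : ∀ s, Continuous fun f : L2 => potPair V φ f s := by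
    intro s
    refine (LipschitzWith.of_dist_le_mul (K := ⟨C * ‖(φ.toLp 2 : L2)‖, by positivity⟩)
      fun f g => ?_).continuous
    rw [dist_eq_norm, dist_eq_norm, ← potPair_sub hVm hσ hC hVb]
    exact norm_potPair_le_norm hVm hσ hC hVb φ _ s
  have hmeas : ∀ f : L2, StronglyMeasurable fun s => potPair V φ f s := by
    intro f
    have : StronglyMeasurable (Function.uncurry fun s x => V s x * f x * φ x) :=
      (hVm.mul ((Lp.stronglyMeasurable f).comp_measurable measurable_snd)).mul
        (φ.continuous.stronglyMeasurable.comp_measurable measurable_snd)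
    exact this.integral_prod_right
  set c : ℝ → ℝ → ℂ := fun r s => potPair V φ (u r) s with hc
  have h := stronglyMeasurable_uncurry_of_continuous_of_stronglyMeasurable (u := c)
    (fun s => (hcont s).comp hu) (fun r => hmeas (u r))
  exact h.comp_measurable (measurable_id.prodMk measurable_id)

end Potential

/-! ### The free evolution of functions and of test functions. -/

theorem freeProp_eq (t : ℝ) (f : L2) :
    freeProp t f = fourierMult (gaussSymbol (Complex.I * t)) f := by
  unfold freeProp gaussSymbol
  simp only [neg_mul]

theorem re_I_mul (t : ℝ) : (Complex.I * (t : ℂ)).re = 0 := by simp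

theorem isSymbol_free (t : ℝ) : IsSymbol (gaussSymbol (Complex.I * t)) :=
  isSymbol_gaussSymbol (re_I_mul t).ge

theorem temperate_free (t : ℝ) : (gaussSymbol (Complex.I * t)).HasTemperateGrowth :=
  temperate_gaussSymbol (re_I_mul t).ge

theorem norm_free (t ξ : ℝ) : ‖gaussSymbol (Complex.I * t) ξ‖ = 1 := by
  rw [norm_gaussSymbol, re_I_mul]
  simp

theorem gaussSymbol_zero (ξ : ℝ) : gaussSymbol 0 ξ = 1 := by simp [gaussSymbol]

theorem schwartzMult_symbol_sub {m m' : ℝ → ℂ} (hm : m.HasTemperateGrowth)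
    (hm' : m'.HasTemperateGrowth) (φ : 𝓢(ℝ, ℂ)) :
    schwartzMult (fun ξ => m ξ - m' ξ) φ = schwartzMult m φ - schwartzMult m' φ := by
  rw [schwartzMult_apply, schwartzMult_apply, schwartzMult_apply]
  have : SchwartzMap.smulLeftCLM ℂ (fun ξ => m (2 * Real.pi * ξ) - m' (2 * Real.pi * ξ)) (𝓕⁻ φ) =
      SchwartzMap.smulLeftCLM ℂ (fun ξ => m (2 * Real.pi * ξ)) (𝓕⁻ φ) -
        SchwartzMap.smulLeftCLM ℂ (fun ξ => m' (2 * Real.pi * ξ)) (𝓕⁻ φ) := by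
    ext ξ
    have hs : (fun ξ : ℝ => m (2 * Real.pi * ξ) - m' (2 * Real.pi * ξ)).HasTemperateGrowth :=
      (temperate_scale hm).sub (temperate_scale hm')
    rw [SchwartzMap.smulLeftCLM_apply_apply hs, sub_apply,
      SchwartzMap.smulLeftCLM_apply_apply (temperate_scale hm),
      SchwartzMap.smulLeftCLM_apply_apply (temperate_scale hm'), sub_smul]
  rw [this]
  exact map_sub (FourierTransform.fourierCLM ℂ 𝓢(ℝ, ℂ)) _ _

theorem schwartzMult_symbol_const_mul {m : ℝ → ℂ} (hm : m.HasTemperateGrowth) (c : ℂ)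
    (φ : 𝓢(ℝ, ℂ)) : schwartzMult (fun ξ => c * m ξ) φ = c • schwartzMult m φ := by
  rw [schwartzMult_apply, schwartzMult_apply]
  have : SchwartzMap.smulLeftCLM ℂ (fun ξ => c * m (2 * Real.pi * ξ)) (𝓕⁻ φ) =
      c • SchwartzMap.smulLeftCLM ℂ (fun ξ => m (2 * Real.pi * ξ)) (𝓕⁻ φ) := by
    ext ξ
    have hs : (fun ξ : ℝ => c * m (2 * Real.pi * ξ)).HasTemperateGrowth := by
      have := temperate_scale hm
      fun_prop
    rw [SchwartzMap.smulLeftCLM_apply_apply hs, smul_apply,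
      SchwartzMap.smulLeftCLM_apply_apply (temperate_scale hm), smul_eq_mul, smul_eq_mul,
      smul_eq_mul, mul_assoc]
  rw [this]
  exact map_smul (FourierTransform.fourierCLM ℂ 𝓢(ℝ, ℂ)) _ _

/-- The free evolution of a test function. -/
def freeTest (φ : 𝓢(ℝ, ℂ)) (t : ℝ) : 𝓢(ℝ, ℂ) := schwartzMult (gaussSymbol (Complex.I * t)) φ

theorem pair_freeProp (f : L2) (φ : 𝓢(ℝ, ℂ)) (t : ℝ) :
    pair (freeProp t f) φ = pair f (freeTest φ t) := by
  rw [freeProp_eq, pair_fourierMult (isSymbol_free t) (temperate_free t), freeTest]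

theorem norm_freeProp_le (t : ℝ) (f : L2) : ‖freeProp t f‖ ≤ ‖f‖ := by
  rw [freeProp_eq, ← one_mul ‖f‖]
  exact norm_fourierMult_le (isSymbol_free t) (fun ξ => (norm_free t ξ).le) f

theorem IsWeakDeriv.freeProp {f g : L2} (h : IsWeakDeriv f g) (t : ℝ) :
    IsWeakDeriv (freeProp t f) (freeProp t g) := by
  rw [freeProp_eq, freeProp_eq]
  exact h.fourierMult (isSymbol_free t)

theorem temperate_sq : (fun ξ : ℝ => (ξ : ℂ) ^ 2).HasTemperateGrowth := by
  have : (fun ξ : ℝ => (ξ : ℂ)).HasTemperateGrowth := Function.Complex.hasTemperateGrowth_ofReal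
  fun_prop

theorem temperate_pow_four : (fun ξ : ℝ => (ξ : ℂ) ^ 4).HasTemperateGrowth := by
  have : (fun ξ : ℝ => (ξ : ℂ)).HasTemperateGrowth := Function.Complex.hasTemperateGrowth_ofReal
  fun_prop

theorem schwartzMult_one (φ : 𝓢(ℝ, ℂ)) : schwartzMult (fun _ => 1) φ = φ := by
  rw [schwartzMult_apply]
  have : SchwartzMap.smulLeftCLM ℂ (fun _ : ℝ => (1 : ℂ)) (𝓕⁻ φ) = 𝓕⁻ φ := by
    ext ξ
    rw [SchwartzMap.smulLeftCLM_apply_apply (Function.HasTemperateGrowth.const 1), one_smul]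
  rw [this]
  exact FourierTransform.fourier_fourierInv_eq φ

theorem norm_freeTest_le (φ : 𝓢(ℝ, ℂ)) (t : ℝ) :
    ‖((freeTest φ t).toLp 2 : L2)‖ ≤ ‖(φ.toLp 2 : L2)‖ := by
  have := norm_schwartzMult_le (temperate_free t) (Function.HasTemperateGrowth.const (1 : ℂ))
    (C := 1) (fun ξ => by rw [norm_free]; simp) φ
  rwa [one_mul, schwartzMult_one] at this

theorem norm_exp_I_mul_sub_one_sub_le (θ : ℝ) :
    ‖Complex.exp (-(Complex.I * θ)) - 1 + Complex.I * θ‖ ≤ 2 * θ ^ 2 := by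
  rcases le_total |θ| 1 with h | h
  · have hn : ‖-(Complex.I * (θ : ℂ))‖ = |θ| := by simp
    have := Complex.norm_exp_sub_one_sub_id_le (x := -(Complex.I * θ)) (by rw [hn]; exact h)
    rw [hn, sub_neg_eq_add, sq_abs] at this
    nlinarith [sq_nonneg θ]
  · have h1 : ‖Complex.exp (-(Complex.I * θ))‖ = 1 := by
      rw [Complex.norm_exp]
      simp
    have h2 : ‖Complex.I * (θ : ℂ)‖ = |θ| := by simp
    have h3 := norm_add_le (Complex.exp (-(Complex.I * θ)) - 1) (Complex.I * θ)
    have h4 := norm_sub_le (Complex.exp (-(Complex.I * θ))) 1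
    rw [h1, norm_one] at h4
    rw [h2] at h3
    have h5 : θ ^ 2 = |θ| * |θ| := by rw [← sq, sq_abs]
    have h6 : ‖Complex.exp (-(Complex.I * θ)) - 1‖ ≤ |θ| := by
      have := Real.norm_exp_I_mul_ofReal_sub_one_le (x := -θ)
      rw [Real.norm_eq_abs, abs_neg] at this
      simpa using this
    nlinarith

theorem free_eq_exp (t ξ : ℝ) :
    gaussSymbol (Complex.I * t) ξ = Complex.exp (-(Complex.I * ((t * ξ ^ 2 : ℝ) : ℂ))) := by
  rw [gaussSymbol]
  congr 1
  push_cast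
  ring

theorem free_add (t h ξ : ℝ) : gaussSymbol (Complex.I * ((t + h : ℝ) : ℂ)) ξ =
    gaussSymbol (Complex.I * t) ξ * gaussSymbol (Complex.I * h) ξ := by
  rw [← gaussSymbol_add]
  congr 1
  push_cast
  ring

theorem norm_freeTest_sub_le (φ : 𝓢(ℝ, ℂ)) (t h : ℝ) :
    ‖((freeTest φ (t + h) - freeTest φ t).toLp 2 : L2)‖ ≤
      |h| * ‖((schwartzMult (fun ξ : ℝ => (ξ : ℂ) ^ 2) φ).toLp 2 : L2)‖ := by
  rw [freeTest, freeTest, ← schwartzMult_symbol_sub (temperate_free _) (temperate_free _)]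
  refine norm_schwartzMult_le ((temperate_free _).sub (temperate_free _)) temperate_sq
    (fun ξ => ?_) φ
  have e : gaussSymbol (Complex.I * ((t + h : ℝ) : ℂ)) ξ - gaussSymbol (Complex.I * t) ξ =
      gaussSymbol (Complex.I * t) ξ *
        (Complex.exp (Complex.I * ((-(h * ξ ^ 2) : ℝ) : ℂ)) - 1) := by
    rw [free_add, free_eq_exp h]
    push_cast
    ring_nf
  simp only [Pi.sub_apply]
  rw [e, norm_mul, norm_free, one_mul]
  refine Real.norm_exp_I_mul_ofReal_sub_one_le.trans (le_of_eq ?_)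
  rw [norm_neg, norm_mul, Real.norm_eq_abs, norm_pow, norm_pow, Complex.norm_real]

/-- On the Fourier side this is the Taylor bound for e^{-iθ} at θ = hξ². The first order term is +ih
φ'' because ∂ₓ² has the symbol -ξ². -/
theorem norm_freeTest_taylor_le (φ : 𝓢(ℝ, ℂ)) (t h : ℝ) :
    ‖((freeTest φ (t + h) - freeTest φ t -
      (Complex.I * h) • freeTest (SchwartzMap.derivCLM ℂ ℂ (SchwartzMap.derivCLM ℂ ℂ φ)) t).toLp 2
        : L2)‖ ≤ 2 * h ^ 2 *
          ‖((schwartzMult (fun ξ : ℝ => (ξ : ℂ) ^ 4) φ).toLp 2 : L2)‖ := by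
  have hq : (fun ξ : ℝ => (-Complex.I * ξ) * (-Complex.I * ξ)).HasTemperateGrowth :=
    temperate_neg_I_mul.mul temperate_neg_I_mul
  have hd : (Complex.I * h) • freeTest (SchwartzMap.derivCLM ℂ ℂ (SchwartzMap.derivCLM ℂ ℂ φ)) t =
      schwartzMult (fun ξ : ℝ => (Complex.I * h) * (gaussSymbol (Complex.I * t) ξ *
        ((-Complex.I * ξ) * (-Complex.I * ξ)))) φ := by
    rw [freeTest, derivCLM_eq_schwartzMult, derivCLM_eq_schwartzMult,
      schwartzMult_schwartzMult temperate_neg_I_mul temperate_neg_I_mul,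
      schwartzMult_schwartzMult (temperate_free t) hq]
    rw [schwartzMult_symbol_const_mul]
    exact (temperate_free t).mul (temperate_neg_I_mul.mul temperate_neg_I_mul)
  have ht : (fun ξ : ℝ => (Complex.I * h) * (gaussSymbol (Complex.I * t) ξ *
        ((-Complex.I * ξ) * (-Complex.I * ξ)))).HasTemperateGrowth :=
    (Function.HasTemperateGrowth.const (Complex.I * (h : ℂ))).mul
      ((temperate_free t).mul (temperate_neg_I_mul.mul temperate_neg_I_mul))
  have ht' : (fun ξ => gaussSymbol (Complex.I * ((t + h : ℝ) : ℂ)) ξ -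
      gaussSymbol (Complex.I * t) ξ).HasTemperateGrowth := (temperate_free _).sub (temperate_free _)
  rw [hd, freeTest, freeTest, ← schwartzMult_symbol_sub (temperate_free _) (temperate_free _),
    ← schwartzMult_symbol_sub ht' ht]
  refine norm_schwartzMult_le (ht'.sub ht) temperate_pow_four (fun ξ => ?_) φ
  have e : gaussSymbol (Complex.I * ((t + h : ℝ) : ℂ)) ξ - gaussSymbol (Complex.I * t) ξ -
      (Complex.I * h) * (gaussSymbol (Complex.I * t) ξ * ((-Complex.I * ξ) * (-Complex.I * ξ))) =
      gaussSymbol (Complex.I * t) ξ * (Complex.exp (-(Complex.I * ((h * ξ ^ 2 : ℝ) : ℂ))) - 1 +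
        Complex.I * ((h * ξ ^ 2 : ℝ) : ℂ)) := by
    rw [free_add, free_eq_exp h]
    have hI : Complex.I ^ 2 = -1 := Complex.I_sq
    push_cast
    linear_combination (-Complex.I * h * gaussSymbol (Complex.I * t) ξ * (ξ : ℂ) ^ 2) * hI
  simp only [Pi.sub_apply]
  rw [e, norm_mul, norm_free, one_mul]
  refine (norm_exp_I_mul_sub_one_sub_le _).trans (le_of_eq ?_)
  rw [norm_pow, Complex.norm_real, Real.norm_eq_abs, mul_pow]
  have : |ξ| ^ 4 = (ξ ^ 2) ^ 2 := by
    rw [← sq_abs ξ]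
    ring
  rw [this]
  ring

/-! ### Cook's method for a weak solution. -/

section Duhamel

variable {σ C M : ℝ} {V : ℝ → ℝ → ℂ} {u : ℝ → L2}

/-- A solution for a potential with representative `V'` satisfies the integrated equation between
any two times, with an integrable right hand side. -/
theorem IsSolution.pair_sub_pair {V' : ℝ → ℝ → ℂ} (hu : IsSolution V u)
    (hVm : StronglyMeasurable (Function.uncurry V')) (hσ : 0 ≤ σ) (hC : 0 ≤ C)
    (hVb : ∀ s x, ‖V' s x‖ ≤ C * (jBra x ^ σ)⁻¹)
    (hVV : ∀ᵐ s ∂(volume.restrict (Ioi (0 : ℝ))), V s =ᵐ[volume] V' s)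
    (hM : ∀ t, 0 ≤ t → ‖u t‖ ≤ M) (φ : 𝓢(ℝ, ℂ)) {x z : ℝ} (hx : 0 ≤ x) (hxz : x ≤ z) :
    IntervalIntegrable (fun s => -Complex.I * pair (u s)
      (SchwartzMap.derivCLM ℂ ℂ (SchwartzMap.derivCLM ℂ ℂ φ)) +
        Complex.I * potPair V' φ (u s) s) volume x z ∧
    pair (u z) φ - pair (u x) φ = ∫ s in x..z, (-Complex.I * pair (u s)
      (SchwartzMap.derivCLM ℂ ℂ (SchwartzMap.derivCLM ℂ ℂ φ)) +
        Complex.I * potPair V' φ (u s) s) := by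
  set φ'' := SchwartzMap.derivCLM ℂ ℂ (SchwartzMap.derivCLM ℂ ℂ φ) with hφ''
  set g : ℝ → ℂ := fun s => -Complex.I * pair (u s) φ'' + Complex.I * potPair V' φ (u s) s with hg
  have hz : 0 ≤ z := hx.trans hxz
  have hint : ∀ t, 0 ≤ t → IntervalIntegrable g volume 0 t := by
    intro t ht
    have h1 : ContinuousOn (fun s => pair (u s) φ'') (Ici 0) := by
      simp_rw [pair_eq_inner]
      exact continuousOn_const.inner hu.1
    have i1 : IntervalIntegrable (fun s => pair (u s) φ'') volume 0 t :=
      (h1.mono (by rw [uIcc_of_le ht]; exact Icc_subset_Ici_self)).intervalIntegrable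
    -- Freezing `u` at its initial value for negative times gives a curve that is continuous on the
    -- whole line.
    have hmeas : StronglyMeasurable fun s => potPair V' φ (u (max s 0)) s := by
      refine stronglyMeasurable_potPair hVm hσ hC hVb φ (u := fun s => u (max s 0)) ?_
      exact hu.1.comp_continuous (by fun_prop) fun s => mem_Ici.2 (le_max_right _ _)
    have i2 : IntervalIntegrable (fun s => potPair V' φ (u s) s) volume 0 t := by
      rw [intervalIntegrable_iff_integrableOn_Ioc_of_le ht]
      refine Integrable.of_bound (C := C * ‖(φ.toLp 2 : L2)‖ * M) ?_ ?_
      · refine hmeas.aestronglyMeasurable.congr ?_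
        filter_upwards [ae_restrict_mem measurableSet_Ioc] with s hs
        rw [max_eq_left hs.1.le]
      · filter_upwards [ae_restrict_mem measurableSet_Ioc] with s hs
        refine (norm_potPair_le_norm hVm hσ hC hVb φ (u s) s).trans ?_
        gcongr
        exact hM s hs.1.le
    exact (i1.const_mul _).add (i2.const_mul _)
  have heq : ∀ t, 0 ≤ t → pair (u t) φ = pair (u 0) φ + ∫ s in (0 : ℝ)..t, g s := by
    intro t ht
    have h := hu.2 φ t ht
    refine h.trans ?_
    congr 1
    apply intervalIntegral.integral_congr_ae
    rw [uIoc_of_le ht, ← ae_restrict_iff' measurableSet_Ioc]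
    have h2 := ae_restrict_of_ae_restrict_of_subset (μ := volume)
      (Ioc_subset_Ioi_self : Ioc (0 : ℝ) t ⊆ Ioi 0) hVV
    filter_upwards [h2] with s hs
    rw [hg]
    simp only
    congr 2
    · apply integral_congr_ae
      filter_upwards [hs] with y hy
      rw [hy]
  refine ⟨(hint x hx).symm.trans (hint z hz), ?_⟩
  rw [heq z hz, heq x hx, add_sub_add_left_eq_sub, intervalIntegral.integral_interval_sub_left
    (hint z hz) (hint x hx)]

/-- The equation is tested with the function `freeTest φ z`, frozen at the final time, and the
change of the test function from x to z is expanded to first order. The two Laplacian terms then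
cancel up to an error that is small compared with z - x, and the potential term is what remains. -/
theorem pair_freeProp_sub_eq {V' : ℝ → ℝ → ℂ} (hu : IsSolution V u)
    (hVm : StronglyMeasurable (Function.uncurry V')) (hσ : 0 ≤ σ) (hC : 0 ≤ C)
    (hVb : ∀ s x, ‖V' s x‖ ≤ C * (jBra x ^ σ)⁻¹)
    (hVV : ∀ᵐ s ∂(volume.restrict (Ioi (0 : ℝ))), V s =ᵐ[volume] V' s)
    (hM : ∀ t, 0 ≤ t → ‖u t‖ ≤ M) (φ : 𝓢(ℝ, ℂ)) {x z : ℝ} (hx : 0 ≤ x) (hxz : x ≤ z) :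
    pair (freeProp z (u z)) φ - pair (freeProp x (u x)) φ =
      (∫ s in x..z, (Complex.I * (pair (u x) (freeTest (SchwartzMap.derivCLM ℂ ℂ
        (SchwartzMap.derivCLM ℂ ℂ φ)) x) - pair (u s) (freeTest (SchwartzMap.derivCLM ℂ ℂ
        (SchwartzMap.derivCLM ℂ ℂ φ)) z)) + Complex.I * potPair V' (freeTest φ z) (u s) s)) +
      pair (u x) (freeTest φ z - freeTest φ x - (Complex.I * ((z - x : ℝ) : ℂ)) •
        freeTest (SchwartzMap.derivCLM ℂ ℂ (SchwartzMap.derivCLM ℂ ℂ φ)) x) := by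
  set φ'' := SchwartzMap.derivCLM ℂ ℂ (SchwartzMap.derivCLM ℂ ℂ φ) with hφ''
  have hcomm : SchwartzMap.derivCLM ℂ ℂ (SchwartzMap.derivCLM ℂ ℂ (freeTest φ z)) =
      freeTest φ'' z := by
    rw [freeTest, derivCLM_schwartzMult (temperate_free z),
      derivCLM_schwartzMult (temperate_free z), freeTest]
  obtain ⟨hi, he⟩ := hu.pair_sub_pair hVm hσ hC hVb hVV hM (freeTest φ z) hx hxz
  rw [hcomm] at hi he
  have h1 : ∫ s in x..z, (Complex.I * (pair (u x) (freeTest φ'' x) - pair (u s) (freeTest φ'' z)) +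
      Complex.I * potPair V' (freeTest φ z) (u s) s) =
      (∫ s in x..z, Complex.I * pair (u x) (freeTest φ'' x)) +
      ∫ s in x..z, (-Complex.I * pair (u s) (freeTest φ'' z) +
        Complex.I * potPair V' (freeTest φ z) (u s) s) := by
    rw [← intervalIntegral.integral_add (by simp) hi]
    congr 1
    funext s
    ring
  rw [h1, ← he, intervalIntegral.integral_const, pair_freeProp, pair_freeProp, pair_sub_right,
    pair_sub_right, pair_smul_right, Complex.real_smul]
  ring

/-- After division by z - x, the first term is the Cook integrand, while the terms in `δ` and z - x
vanish as z ↓ x by continuity of `u`. -/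
theorem norm_pair_freeProp_sub_le {V' : ℝ → ℝ → ℂ} (hu : IsSolution V u)
    (hVm : StronglyMeasurable (Function.uncurry V')) (hσ : 2 < σ) (hC : 0 ≤ C)
    (hVb : ∀ s x, ‖V' s x‖ ≤ C * (jBra x ^ σ)⁻¹)
    (hVV : ∀ᵐ s ∂(volume.restrict (Ioi (0 : ℝ))), V s =ᵐ[volume] V' s) (hM0 : 0 ≤ M)
    (hM : ∀ t, 0 ≤ t → ‖u t‖ ≤ M) (φ : 𝓢(ℝ, ℂ)) {x z A δ : ℝ} (hx : 0 ≤ x) (hxz : x ≤ z)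
    (hA : 0 ≤ A) (hφ : ∀ y, ‖freeTest φ z y‖ ≤ A * (1 + y ^ 2) ^ (3 / 4 : ℝ))
    (hδ : ∀ s ∈ Icc x z, ‖u s - u x‖ ≤ δ) :
    ‖pair (freeProp z (u z)) φ - pair (freeProp x (u x)) φ‖ ≤
      (C * A * weightConst σ * M +
        (δ * ‖((SchwartzMap.derivCLM ℂ ℂ (SchwartzMap.derivCLM ℂ ℂ φ)).toLp 2 : L2)‖ +
        (z - x) * (M * (‖((schwartzMult (fun ξ : ℝ => (ξ : ℂ) ^ 2) (SchwartzMap.derivCLM ℂ ℂ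
          (SchwartzMap.derivCLM ℂ ℂ φ))).toLp 2 : L2)‖ +
          2 * ‖((schwartzMult (fun ξ : ℝ => (ξ : ℂ) ^ 4) φ).toLp 2 : L2)‖)))) * (z - x) := by
  rw [pair_freeProp_sub_eq hu hVm (by linarith) hC hVb hVV hM φ hx hxz]
  set φ'' := SchwartzMap.derivCLM ℂ ℂ (SchwartzMap.derivCLM ℂ ℂ φ) with hφ''
  have hzx : 0 ≤ z - x := sub_nonneg.2 hxz
  have hz : x + (z - x) = z := by ring
  have h1 := norm_freeTest_sub_le φ'' x (z - x)
  have h2 := norm_freeTest_taylor_le φ x (z - x)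
  rw [hz, abs_of_nonneg hzx] at h1
  rw [hz] at h2
  set N₂ := ‖((schwartzMult (fun ξ : ℝ => (ξ : ℂ) ^ 2) φ'').toLp 2 : L2)‖
  set N₄ := ‖((schwartzMult (fun ξ : ℝ => (ξ : ℂ) ^ 4) φ).toLp 2 : L2)‖
  have hb : ∀ s ∈ uIoc x z, ‖Complex.I * (pair (u x) (freeTest φ'' x) -
      pair (u s) (freeTest φ'' z)) + Complex.I * potPair V' (freeTest φ z) (u s) s‖ ≤
      C * A * weightConst σ * M + (δ * ‖(φ''.toLp 2 : L2)‖ + M * ((z - x) * N₂)) := by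
    intro s hs
    rw [uIoc_of_le hxz] at hs
    have hs0 : 0 ≤ s := hx.trans hs.1.le
    have e : pair (u x) (freeTest φ'' x) - pair (u s) (freeTest φ'' z) =
        -(pair (u s - u x) (freeTest φ'' z) + pair (u x) (freeTest φ'' z - freeTest φ'' x)) := by
      rw [pair_sub_left, pair_sub_right]
      ring
    refine (norm_add_le _ _).trans ?_
    rw [norm_mul, norm_mul, Complex.norm_I, one_mul, one_mul, add_comm, e, norm_neg]
    refine add_le_add ?_ ((norm_add_le _ _).trans (add_le_add ?_ ?_))
    · refine (norm_potPair_le_weight hVm hσ hC hVb _ (u s) s hA hφ).trans ?_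
      have : 0 ≤ weightConst σ := Real.sqrt_nonneg _
      gcongr
      exact hM s hs0
    · refine (norm_pair_le _ _).trans ?_
      gcongr
      · exact (norm_nonneg _).trans (hδ s ⟨hs.1.le, hs.2⟩)
      · exact hδ s ⟨hs.1.le, hs.2⟩
      · exact norm_freeTest_le φ'' z
    · refine (norm_pair_le _ _).trans ?_
      gcongr
      exact hM x hx
  refine (norm_add_le _ _).trans ?_
  have h3 := intervalIntegral.norm_integral_le_of_norm_le_const hb
  rw [abs_of_nonneg hzx] at h3
  have h4 : ‖pair (u x) (freeTest φ z - freeTest φ x - (Complex.I * ((z - x : ℝ) : ℂ)) •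
        freeTest φ'' x)‖ ≤ M * (2 * (z - x) ^ 2 * N₄) := by
    refine (norm_pair_le _ _).trans ?_
    gcongr
    exact hM x hx
  refine (add_le_add h3 h4).trans (le_of_eq ?_)
  ring

/-- The scalar Cook estimate. -/
theorem exists_cook_bound (hσ : 2 < σ) (hV : IsDecayingPotential σ V) (hu : IsSolution V u)
    (hM0 : 0 ≤ M) (hM : ∀ t, 0 ≤ t → ‖u t‖ ≤ M) : ∃ K : ℝ, 0 ≤ K ∧
    ∀ (φ : 𝓢(ℝ, ℂ)) (t A : ℝ), 0 < t → 0 ≤ A →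
      (∀ τ, t ≤ τ → ∀ y, ‖freeTest φ τ y‖ ≤ A * (τ ^ 2)⁻¹ * (1 + y ^ 2) ^ (3 / 4 : ℝ)) →
      ∀ t', t ≤ t' →
        ‖pair (freeProp t' (u t')) φ - pair (freeProp t (u t)) φ‖ ≤ K * A / t := by
  obtain ⟨V', hVm, ⟨C, hC, hVb⟩, hVV⟩ := hV.exists_representative
  have hw : 0 ≤ weightConst σ := Real.sqrt_nonneg _
  refine ⟨C * weightConst σ * M, by positivity, ?_⟩
  intro φ t A ht hA hφ t' ht'
  set K := C * weightConst σ * M with hK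
  have hK0 : 0 ≤ K := by positivity
  set G : ℝ → ℂ := fun z => pair (freeProp z (u z)) φ with hG
  set φ'' := SchwartzMap.derivCLM ℂ ℂ (SchwartzMap.derivCLM ℂ ℂ φ) with hφ''
  set N := ‖(φ''.toLp 2 : L2)‖ with hN
  set L := M * (‖((schwartzMult (fun ξ : ℝ => (ξ : ℂ) ^ 2) φ'').toLp 2 : L2)‖ +
          2 * ‖((schwartzMult (fun ξ : ℝ => (ξ : ℂ) ^ 4) φ).toLp 2 : L2)‖) with hL
  have hL0 : 0 ≤ L := by positivity
  have hN0 : 0 ≤ N := norm_nonneg _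
  have hmain : ∀ x z δ, t ≤ x → x ≤ z → (∀ s ∈ Icc x z, ‖u s - u x‖ ≤ δ) →
      ‖G z - G x‖ ≤ (K * A * (z ^ 2)⁻¹ + (δ * N + (z - x) * L)) * (z - x) := by
    intro x z δ hx hxz hδ
    have hz0 : 0 < z := by linarith
    have := norm_pair_freeProp_sub_le hu hVm hσ hC hVb hVV hM0 hM φ (A := A * (z ^ 2)⁻¹)
      (ht.le.trans hx) hxz (by positivity) (hφ z (hx.trans hxz)) hδ
    refine this.trans (le_of_eq ?_)
    rw [hK]
    ring
  have hcont : ContinuousOn G (Icc t t') := by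
    have h1 : ContinuousOn u (Icc t t') := hu.1.mono fun s hs => ht.le.trans hs.1
    have e : G = fun z => inner ℂ (star ((freeTest φ z).toLp 2 : L2)) (u z) := by
      funext z
      rw [hG]
      simp only
      rw [pair_freeProp, pair_eq_inner]
    rw [e]
    refine ContinuousOn.inner (Continuous.continuousOn ?_) h1
    refine continuous_star_L2.comp ?_
    set P := ‖((schwartzMult (fun ξ : ℝ => (ξ : ℂ) ^ 2) φ).toLp 2 : L2)‖
    refine (LipschitzWith.of_dist_le_mul (K := ⟨P, norm_nonneg _⟩) fun r s => ?_).continuous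
    have := norm_freeTest_sub_le φ s (r - s)
    rw [add_sub_cancel] at this
    rw [dist_eq_norm, dist_eq_norm, Real.norm_eq_abs]
    refine le_trans (le_of_eq ?_) (this.trans (le_of_eq (mul_comm _ _)))
    congr 1
  -- `G` is not known to be differentiable, so its right difference quotients are compared with the
  -- derivative of (KA + ε)(1/t - 1/x). The extra ε makes the comparison strict and is removed at
  -- the end.
  have hbound : ∀ ε : ℝ, 0 < ε → ‖G t' - G t‖ ≤ (K * A + ε) * (1 / t - 1 / t') := by
    intro ε hε
    have := image_norm_le_of_liminf_right_slope_norm_lt_deriv_boundary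
      (f := fun z => G z - G t) (f' := fun x => K * A * (x ^ 2)⁻¹) (a := t) (b := t')
      (hcont.sub continuousOn_const) ?_ (B := fun x => (K * A + ε) * (1 / t - 1 / x))
      (B' := fun x => (K * A + ε) * (x ^ 2)⁻¹) (by simp) ?_ ?_ ?_
    · exact this ⟨ht', le_rfl⟩
    · intro x hx r hr
      have hx0 : 0 < x := ht.trans_le hx.1
      apply Eventually.frequently
      -- The gap η is shared out: the continuity error and the Taylor error are each kept below η/4.
      set η := r - K * A * (x ^ 2)⁻¹ with hη
      have hη0 : 0 < η := sub_pos.2 hr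
      set δ := η / (4 * (N + 1)) with hδ
      have hδ0 : 0 < δ := by positivity
      have hδN : δ * N ≤ η / 4 := by
        rw [hδ, div_mul_eq_mul_div, div_le_div_iff₀ (by positivity) (by norm_num)]
        nlinarith
      have hc : ContinuousWithinAt u (Ici 0) x := hu.1 x hx0.le
      rw [Metric.continuousWithinAt_iff] at hc
      obtain ⟨d, hd, hdu⟩ := hc δ hδ0
      set d' := min d (η / (4 * (L + 1))) with hd'
      have hd'0 : 0 < d' := lt_min hd (by positivity)
      filter_upwards [Ioo_mem_nhdsGT (show x < x + d' by linarith)] with z hz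
      have hzx : 0 < z - x := sub_pos.2 hz.1
      have hzL : (z - x) * L ≤ η / 4 := by
        have h1 : z - x ≤ η / (4 * (L + 1)) := by
          have := min_le_right d (η / (4 * (L + 1)))
          linarith [hz.2]
        calc (z - x) * L ≤ η / (4 * (L + 1)) * L := by gcongr
          _ ≤ η / 4 := by
            rw [div_mul_eq_mul_div, div_le_div_iff₀ (by positivity) (by norm_num)]
            nlinarith
      have h2 := hmain x z δ hx.1 hz.1.le (fun s hs => by
        have hs0 : s ∈ Ici (0 : ℝ) := hx0.le.trans hs.1
        have : dist s x < d := by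
          rw [Real.dist_eq, abs_of_nonneg (sub_nonneg.2 hs.1)]
          have := min_le_left d (η / (4 * (L + 1)))
          linarith [hz.2, hs.2]
        rw [← dist_eq_norm]
        exact (hdu hs0 this).le)
      have h3 : (z ^ 2)⁻¹ ≤ (x ^ 2)⁻¹ :=
        inv_anti₀ (by positivity) (pow_le_pow_left₀ hx0.le hz.1.le 2)
      rw [slope_def_field, Function.comp_apply, Function.comp_apply, div_lt_iff₀ hzx]
      have h4 : ‖G z - G t‖ - ‖G x - G t‖ ≤ ‖G z - G x‖ := by
        refine (norm_sub_norm_le _ _).trans (le_of_eq ?_)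
        congr 1
        ring
      have h5 : K * A * (z ^ 2)⁻¹ ≤ K * A * (x ^ 2)⁻¹ := by gcongr
      calc ‖G z - G t‖ - ‖G x - G t‖ ≤ _ := h4.trans h2
        _ ≤ (K * A * (x ^ 2)⁻¹ + (η / 4 + η / 4)) * (z - x) := by gcongr
        _ < r * (z - x) := by
          gcongr
          linarith
    · refine continuousOn_const.mul (continuousOn_const.sub (continuousOn_const.div continuousOn_id
        fun x hx => (ht.trans_le hx.1).ne'))
    · intro x hx
      have hx0 : x ≠ 0 := (ht.trans_le hx.1).ne'
      have h1 : HasDerivAt (fun x : ℝ => (K * A + ε) * (1 / t - 1 / x))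
          ((K * A + ε) * (0 - -(x ^ 2)⁻¹)) x := by
        have h0 := (hasDerivAt_inv hx0).const_sub (1 / t)
        rw [zero_sub]
        simpa only [one_div] using h0.const_mul (K * A + ε)
      rw [zero_sub, neg_neg] at h1
      exact h1.hasDerivWithinAt
    · intro x hx _
      have hx0 : 0 < x := ht.trans_le hx.1
      have : 0 < (x ^ 2)⁻¹ := by positivity
      nlinarith
  have hlim : Tendsto (fun ε : ℝ => (K * A + ε) * (1 / t - 1 / t')) (𝓝[>] 0)
      (𝓝 ((K * A + 0) * (1 / t - 1 / t'))) := by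
    have : Continuous fun ε : ℝ => (K * A + ε) * (1 / t - 1 / t') := by fun_prop
    exact (this.tendsto 0).mono_left nhdsWithin_le_nhds
  have h6 := ge_of_tendsto hlim (by
    filter_upwards [self_mem_nhdsWithin] with ε hε using hbound ε hε)
  refine h6.trans ?_
  rw [add_zero, div_eq_mul_one_div (K * A) t]
  have : 0 ≤ 1 / t' := by
    have : 0 < t' := ht.trans_le ht'
    positivity
  exact mul_le_mul_of_nonneg_left (by linarith) (by positivity)

end Duhamel

/-! ### The scattering state as a weak limit. -/

/-- Banach–Alaoglu in the dual of L². With an ultrafilter in place of subsequences, the limits of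
several bounded families are taken along the same filter at once. The Riesz map is conjugate linear,
hence the conjugations. -/
theorem exists_weak_limit (U : Ultrafilter ℝ) {f : ℝ → L2} {M : ℝ} (hf : ∀ᶠ t in U, ‖f t‖ ≤ M) :
    ∃ g : L2, ∀ φ : 𝓢(ℝ, ℂ), Tendsto (fun t => pair (f t) φ) U (𝓝 (pair g φ)) := by
  obtain ⟨T, hT⟩ : ∃ T : ℝ → WeakDual ℂ L2,
      T = fun t => StrongDual.toWeakDual (InnerProductSpace.toDual ℂ L2 (f t)) := ⟨_, rfl⟩
  have hTf : ∀ t, WeakDual.toStrongDual (T t) = InnerProductSpace.toDual ℂ L2 (f t) := fun t => by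
    rw [hT]
    rfl
  have hmem : T ⁻¹' (WeakDual.toStrongDual ⁻¹' Metric.closedBall 0 M) ∈ U := by
    filter_upwards [hf] with t ht
    rw [mem_preimage, mem_preimage, mem_closedBall_zero_iff, hTf, LinearIsometryEquiv.norm_map]
    exact ht
  obtain ⟨S, -, hS⟩ :=
    (WeakDual.isCompact_closedBall (𝕜 := ℂ) (E := L2) 0 M).ultrafilter_le_nhds' (U.map T) hmem
  refine ⟨(InnerProductSpace.toDual ℂ L2).symm (WeakDual.toStrongDual S), fun φ => ?_⟩
  have h1 : ∀ y : L2, Tendsto (fun t => T t y) U (𝓝 (S y)) := fun y =>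
    ((WeakDual.eval_continuous y).tendsto S).comp hS
  have h2 := (Complex.continuous_conj.tendsto _).comp (h1 (star (φ.toLp 2 : L2)))
  simp_rw [pair_eq_inner]
  rw [← inner_conj_symm, InnerProductSpace.toDual_symm_apply]
  refine h2.congr fun t => ?_
  have h3 : T t (star (φ.toLp 2 : L2)) = inner ℂ (f t) (star (φ.toLp 2 : L2)) := by
    rw [← InnerProductSpace.toDual_apply_apply (𝕜 := ℂ), ← hTf]
    rfl
  rw [Function.comp_apply, h3, inner_conj_symm]

theorem freeTest_diff_gauss {a : ℝ} (ha : 0 ≤ a) (k : ℕ) (τ : ℝ) (ψ : 𝓢(ℝ, ℂ)) :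
    freeTest (schwartzMult (diffSymbol a k) ψ) τ =
      schwartzMult (fun ξ => gaussSymbol (Complex.I * τ) ξ * diffSymbol a k ξ) ψ := by
  rw [freeTest, schwartzMult_schwartzMult (temperate_free τ) (temperate_diffSymbol ha k)]

theorem freeTest_deriv_diff_gauss {a : ℝ} (ha : 0 ≤ a) (k : ℕ) (τ : ℝ) (ψ : 𝓢(ℝ, ℂ)) :
    freeTest (SchwartzMap.derivCLM ℂ ℂ (schwartzMult (diffSymbol a k) ψ)) τ =
      schwartzMult (fun ξ => gaussSymbol (Complex.I * τ) ξ *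
        (-Complex.I * ξ * diffSymbol a k ξ)) ψ := by
  have h : (fun ξ : ℝ => -Complex.I * ξ * diffSymbol a k ξ).HasTemperateGrowth :=
    temperate_neg_I_mul.mul (temperate_diffSymbol ha k)
  rw [freeTest, derivCLM_eq_schwartzMult,
    schwartzMult_schwartzMult temperate_neg_I_mul (temperate_diffSymbol ha k),
    schwartzMult_schwartzMult (temperate_free τ) h]

theorem pair_gauss_diff {a : ℝ} (ha : 0 ≤ a) (k : ℕ) (b : ℝ) (v : L2) (ψ : 𝓢(ℝ, ℂ)) :
    pair (mulL2 (gaussSymbol (((b ^ 2)⁻¹ : ℝ) : ℂ)) (fourierMult (diffSymbol a k) v)) ψ =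
      pair v (schwartzMult (diffSymbol a k) (gaussMul b ψ)) := by
  rw [pair_mulL2 (isSymbol_gaussSymbol (inv_sq_re_nonneg b))
    (temperate_gaussSymbol (inv_sq_re_nonneg b)),
    pair_fourierMult (isSymbol_diffSymbol ha k) (temperate_diffSymbol ha k), gaussMul]

/-- The scattering state and the decay of the localized high frequency part of the remainder. -/
theorem exists_scattering_state {σ M β δ : ℝ} {V : ℝ → ℝ → ℂ} {u g : ℝ → L2}
    (hσ : 2 < σ) (hV : IsDecayingPotential σ V) (hu : IsSolution V u)
    (hg : ∀ t, 0 ≤ t → IsWeakDeriv (u t) (g t))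
    (hM : ∀ t, 0 ≤ t → ‖u t‖ ≤ M) (hM' : ∀ t, 0 ≤ t → ‖g t‖ ≤ M)
    (hδ0 : 0 ≤ δ) (hδ' : δ < 1 / 2) (hβδ : β + δ < 1) :
    ∃ uP gP : L2, IsWeakDeriv uP gP ∧ ∃ (k : ℕ) (C γ : ℝ), 0 ≤ C ∧ 0 < γ ∧ ∀ t : ℝ, 1 ≤ t →
      ‖mulL2 (gaussSymbol ((((t ^ β) ^ 2)⁻¹ : ℝ) : ℂ))
        (fourierMult (diffSymbol (t ^ (2 * δ)) k) (freeProp t (u t) - uP))‖ ≤ C * t ^ (-γ) ∧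
      ‖mulL2 (gaussSymbol ((((t ^ β) ^ 2)⁻¹ : ℝ) : ℂ))
        (fourierMult (diffSymbol (t ^ (2 * δ)) k) (freeProp t (g t) - gP))‖ ≤ C * t ^ (-γ) := by
  have hM0 : 0 ≤ M := (norm_nonneg _).trans (hM 0 le_rfl)
  obtain ⟨K, hK0, hK⟩ := exists_cook_bound hσ hV hu hM0 hM
  obtain ⟨k, C, γ, hC0, hγ, hC⟩ := exists_decay_bound hδ0 hδ' hβδ
  set U : Ultrafilter ℝ := Ultrafilter.of atTop
  have hU : (U : Filter ℝ) ≤ atTop := Ultrafilter.of_le _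
  have hwd : ∀ t, 0 ≤ t → IsWeakDeriv (freeProp t (u t)) (freeProp t (g t)) :=
    fun t ht => (hg t ht).freeProp t
  obtain ⟨uP, huP⟩ := exists_weak_limit U (f := fun t => freeProp t (u t)) (M := M)
    (hU (by filter_upwards [eventually_ge_atTop 0] with t ht
      using (norm_freeProp_le _ _).trans (hM t ht)))
  obtain ⟨gP, hgP⟩ := exists_weak_limit U (f := fun t => freeProp t (g t)) (M := M)
    (hU (by filter_upwards [eventually_ge_atTop 0] with t ht
      using (norm_freeProp_le _ _).trans (hM' t ht)))
  -- The defining identity of the weak derivative is preserved under weak limits along the common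
  -- ultrafilter.
  have hP : IsWeakDeriv uP gP := fun φ => by
    refine tendsto_nhds_unique (huP _) ((hgP φ).neg.congr' ?_)
    refine hU ?_
    filter_upwards [eventually_ge_atTop 0] with t ht using (hwd t ht φ).symm
  have hcook : ∀ (φ : 𝓢(ℝ, ℂ)) (t A : ℝ), 0 < t → 0 ≤ A →
      (∀ τ, t ≤ τ → ∀ y, ‖freeTest φ τ y‖ ≤ A * (τ ^ 2)⁻¹ * (1 + y ^ 2) ^ (3 / 4 : ℝ)) →
        ‖pair (freeProp t (u t) - uP) φ‖ ≤ K * A / t := by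
    intro φ t A ht hA hφ
    rw [pair_sub_left, norm_sub_rev]
    refine le_of_tendsto ((huP φ).sub_const _).norm (hU ?_)
    filter_upwards [eventually_ge_atTop t] with t' ht' using hK φ t A ht hA hφ t' ht'
  refine ⟨uP, gP, hP, k, K * C, γ, by positivity, hγ, fun t ht => ?_⟩
  have ht0 : 0 < t := zero_lt_one.trans_le ht
  have ha : 0 ≤ t ^ (2 * δ) := by positivity
  have hA : ∀ N : ℝ, K * (C * t ^ (1 - γ) * N) / t = K * C * t ^ (-γ) * N := fun N => by
    rw [show -γ = (1 - γ) - 1 by ring, Real.rpow_sub_one ht0.ne']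
    ring
  constructor
  · refine norm_le_of_pair (by positivity) fun ψ => ?_
    rw [pair_gauss_diff ha, ← hA]
    refine hcook _ t _ ht0 (by positivity) fun τ hτ y => ?_
    rw [freeTest_diff_gauss ha]
    exact (hC ht hτ ψ y).1
  · refine norm_le_of_pair (by positivity) fun ψ => ?_
    -- Up to sign the derivative moves to the test function, so the estimate for `u` itself applies,
    -- with the second bound of `exists_decay_bound`.
    rw [pair_gauss_diff ha, ← hA, ← norm_neg, ← ((hwd t ht0.le).sub hP) _]
    refine hcook _ t _ ht0 (by positivity) fun τ hτ y => ?_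
    rw [freeTest_deriv_diff_gauss ha]
    exact (hC ht hτ ψ y).2

/-! ### Commutators of spatial cutoffs with Lipschitz Fourier multipliers. -/

/-- The character `x ↦ e^{-2πixη}`. -/
def planeWave (η x : ℝ) : ℂ := Real.fourierChar (-(x * η))

theorem norm_planeWave (η x : ℝ) : ‖planeWave η x‖ = 1 := Circle.norm_coe _

theorem isSymbol_planeWave (η : ℝ) : IsSymbol (planeWave η) :=
  ⟨Continuous.measurable (by unfold planeWave; fun_prop), 1, fun x => (norm_planeWave η x).le⟩

theorem fourier_compSubConst (ψ : 𝓢(ℝ, ℂ)) (η x : ℝ) :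
    𝓕 (ψ.compSubConstCLM ℂ η) x = planeWave η x * 𝓕 ψ x := by
  rw [SchwartzMap.fourier_coe, SchwartzMap.fourier_coe, Real.fourier_real_eq, Real.fourier_real_eq,
    ← integral_add_right_eq_self _ η, ← integral_const_mul]
  congr 1
  ext v
  rw [SchwartzMap.compSubConstCLM_apply, add_sub_cancel_right, add_mul, neg_add,
    AddChar.map_add_eq_mul, Circle.smul_def, Circle.smul_def, planeWave, mul_comm x η]
  simp only [Circle.coe_mul, smul_eq_mul]
  ring

/-- Translation in `L²`. -/
def translate (η : ℝ) (f : L2) : L2 :=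
  Lp.compMeasurePreserving (· + η) (measurePreserving_add_right volume η) f

theorem translate_coe (η : ℝ) (f : L2) : translate η f =ᵐ[volume] fun x => f (x + η) :=
  Lp.coeFn_compMeasurePreserving f (measurePreserving_add_right volume η)

theorem norm_translate (η : ℝ) (f : L2) : ‖translate η f‖ = ‖f‖ :=
  Lp.norm_compMeasurePreserving f (measurePreserving_add_right volume η)

theorem fourier_mulL2_planeWave (η : ℝ) (f : L2) :
    (𝓕 (mulL2 (planeWave η) f) : L2) = translate η (𝓕 f : L2) := by
  refine eq_of_pair fun ψ => ?_
  have h1 : pair (translate η (𝓕 f : L2)) ψ = pair (𝓕 f : L2) (ψ.compSubConstCLM ℂ η) := by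
    rw [pair, pair,
      ← integral_add_right_eq_self (fun x => (𝓕 f : L2) x * ψ.compSubConstCLM ℂ η x) η]
    apply integral_congr_ae
    filter_upwards [translate_coe η (𝓕 f : L2)] with x hx
    rw [hx, SchwartzMap.compSubConstCLM_apply, add_sub_cancel_right]
  rw [h1, pair_fourier, pair_fourier]
  apply integral_congr_ae
  filter_upwards [mulL2_coe (isSymbol_planeWave η) f] with x hx
  rw [hx, fourier_compSubConst]
  ring

/-- Modulation is translation on the Fourier side, so the commutator multiplies the translated
transform by a difference of values of q at two points 2π|η| apart. -/
theorem norm_planeWave_commutator_le {q : ℝ → ℂ} (hq : IsSymbol q) {Λ : ℝ}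
    (hΛ : ∀ ξ η, ‖q ξ - q η‖ ≤ Λ * |ξ - η|) (η : ℝ) (f : L2) :
    ‖mulL2 (planeWave η) (fourierMult q f) - fourierMult q (mulL2 (planeWave η) f)‖ ≤
      Λ * (2 * Real.pi * |η|) * ‖f‖ := by
  rw [← Lp.norm_fourier_eq, sub_eq_add_neg, FourierTransform.fourier_add,
    FourierTransform.fourier_neg, ← sub_eq_add_neg, fourier_fourierMult, fourier_mulL2_planeWave,
    fourier_mulL2_planeWave, fourier_fourierMult, ← Lp.norm_fourier_eq f,
    ← norm_translate η (𝓕 f : L2)]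
  apply Lp.norm_le_mul_norm_of_ae_le_mul
  have hqm := (measurePreserving_add_right (volume : Measure ℝ) η).quasiMeasurePreserving.ae
    (mulL2_coe hq.scale (𝓕 f : L2))
  filter_upwards [Lp.coeFn_sub (translate η (mulL2 (fun ξ => q (2 * Real.pi * ξ)) (𝓕 f : L2)))
    (mulL2 (fun ξ => q (2 * Real.pi * ξ)) (translate η (𝓕 f : L2))),
    translate_coe η (mulL2 (fun ξ => q (2 * Real.pi * ξ)) (𝓕 f : L2)),
    mulL2_coe hq.scale (translate η (𝓕 f : L2)), translate_coe η (𝓕 f : L2), hqm]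
    with x h1 h2 h3 h4 h5
  rw [h1, Pi.sub_apply, h2, h3, h4, h5, ← sub_mul, norm_mul]
  refine mul_le_mul_of_nonneg_right ((hΛ _ _).trans (le_of_eq ?_)) (norm_nonneg _)
  rw [show 2 * Real.pi * (x + η) - 2 * Real.pi * x = 2 * Real.pi * η by ring, abs_mul,
    abs_of_pos (by positivity : 0 < 2 * Real.pi)]

/-- The weak form of the decomposition of multiplication by 𝓕G into plane waves with amplitude G;
the matrix elements of plane waves are the Fourier transform of an integrable function. -/
theorem inner_mulL2_fourier {G : ℝ → ℂ} (hG : Integrable G) (hχ : IsSymbol (𝓕 G)) (f h : L2) :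
    Integrable (fun η => G η * inner ℂ f (mulL2 (planeWave η) h)) ∧
    inner ℂ f (mulL2 (𝓕 G) h) = ∫ η, G η * inner ℂ f (mulL2 (planeWave η) h) := by
  have hk : Integrable fun x => inner ℂ (f x) (h x) := L2.integrable_inner f h
  have e : ∀ η, inner ℂ f (mulL2 (planeWave η) h) = 𝓕 (fun x => inner ℂ (f x) (h x)) η := by
    intro η
    rw [L2.inner_def, Real.fourier_real_eq]
    apply integral_congr_ae
    filter_upwards [mulL2_coe (isSymbol_planeWave η) h] with x hx
    rw [hx, Circle.smul_def, smul_eq_mul, planeWave]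
    simp only [RCLike.inner_apply]
    ring
  simp_rw [e]
  constructor
  · refine hG.mul_bdd (c := ∫ x, ‖(inner ℂ (f x) (h x) : ℂ)‖) ?_ (ae_of_all _ fun η => ?_)
    · refine Continuous.aestronglyMeasurable ?_
      exact VectorFourier.fourierIntegral_continuous Real.continuous_fourierChar
        (by exact continuous_inner) hk
    · exact VectorFourier.norm_fourierIntegral_le_integral_norm _ _ _ _ _
  · rw [← integral_fourier_mul hG hk, L2.inner_def]
    apply integral_congr_ae
    filter_upwards [mulL2_coe hχ h] with x hx
    rw [hx]
    simp only [RCLike.inner_apply]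
    ring

/-- Commutators of multiplication operators with Lipschitz Fourier multipliers. -/
theorem norm_commutator_le {G : ℝ → ℂ} (hG : Integrable G) (hG' : Integrable fun η => |η| * ‖G η‖)
    (hχ : IsSymbol (𝓕 G)) {q : ℝ → ℂ} (hq : IsSymbol q) {Λ : ℝ}
    (hΛ : ∀ ξ η, ‖q ξ - q η‖ ≤ Λ * |ξ - η|) (f : L2) :
    ‖mulL2 (𝓕 G) (fourierMult q f) - fourierMult q (mulL2 (𝓕 G) f)‖ ≤
      Λ * (2 * Real.pi) * (∫ η, |η| * ‖G η‖) * ‖f‖ := by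
  set d := mulL2 (𝓕 G) (fourierMult q f) - fourierMult q (mulL2 (𝓕 G) f) with hd
  obtain ⟨i1, e1⟩ := inner_mulL2_fourier hG hχ d (fourierMult q f)
  obtain ⟨i2, e2⟩ := inner_mulL2_fourier hG hχ (fourierMult (fun x => starRingEnd ℂ (q x)) d) f
  -- The commutator is paired with itself, which bounds ‖d‖² by a multiple of ‖d‖‖f‖.
  have h1 : (inner ℂ d d : ℂ) = ∫ η, G η * inner ℂ d
      (mulL2 (planeWave η) (fourierMult q f) - fourierMult q (mulL2 (planeWave η) f)) := by
    conv_lhs => rw [hd, inner_sub_right, ← hd, inner_fourierMult hq, e1, e2, ← integral_sub i1 i2]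
    congr 1
    ext η
    rw [inner_sub_right, inner_fourierMult hq, mul_sub]
  have h2 : ‖(inner ℂ d d : ℂ)‖ ≤
      ∫ η, (Λ * (2 * Real.pi) * (‖d‖ * ‖f‖)) * (|η| * ‖G η‖) := by
    rw [h1]
    refine norm_integral_le_of_norm_le (hG'.const_mul _) (ae_of_all _ fun η => ?_)
    rw [norm_mul]
    calc _ ≤ ‖G η‖ * (‖d‖ * (Λ * (2 * Real.pi * |η|) * ‖f‖)) := by
          gcongr
          refine (norm_inner_le_norm _ _).trans ?_
          gcongr
          exact norm_planeWave_commutator_le hq hΛ η f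
      _ = _ := by ring
  rw [integral_const_mul, inner_self_eq_norm_sq_to_K, norm_pow] at h2
  simp only [Complex.coe_algebraMap, Complex.norm_real, norm_norm] at h2
  rcases (norm_nonneg d).eq_or_lt with h0 | h0
  · rw [← h0]
    have hΛ0 : 0 ≤ Λ := by
      have := (norm_nonneg _).trans (hΛ 1 0)
      simpa using this
    have : 0 ≤ ∫ η, |η| * ‖G η‖ := integral_nonneg fun η => by positivity
    positivity
  · nlinarith

/-- For width b the plane wave amplitude is b G(bη), and the rescaling of ∫ |η||G(η)| dη yields the
gain 1/b. -/
theorem exists_gauss_commutator : ∃ C : ℝ, 0 ≤ C ∧ ∀ {b : ℝ}, 0 < b → ∀ {q : ℝ → ℂ} {Λ : ℝ},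
    IsSymbol q → (∀ ξ η, ‖q ξ - q η‖ ≤ Λ * |ξ - η|) → ∀ f : L2,
    ‖mulL2 (gaussSymbol (((b ^ 2)⁻¹ : ℝ) : ℂ)) (fourierMult q f) -
      fourierMult q (mulL2 (gaussSymbol (((b ^ 2)⁻¹ : ℝ) : ℂ)) f)‖ ≤ C * (Λ / b) * ‖f‖ := by
  obtain ⟨G, hG, hGi, hGi'⟩ : ∃ G : ℝ → ℂ, 𝓕 G = gaussSymbol 1 ∧ Integrable G ∧
      Integrable fun η => |η| * ‖G η‖ := by
    have hpi : (0 : ℝ) < Real.pi * Real.pi := by positivity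
    have hπ : (Real.pi : ℂ) ≠ 0 := by exact_mod_cast Real.pi_ne_zero
    refine ⟨fun x => (Real.pi : ℂ) ^ (1 / 2 : ℂ) * Complex.exp (-Real.pi * Real.pi * x ^ 2),
      ?_, ?_, ?_⟩
    · have h1 := fourier_gaussian_pi (b := Real.pi) (by simpa using Real.pi_pos)
      have h2 : (Real.pi : ℂ) ^ (1 / 2 : ℂ) ≠ 0 := by
        rw [Complex.cpow_ne_zero_iff]
        exact Or.inl hπ
      ext t
      have h3 := congrFun h1 t
      rw [Real.fourier_real_eq] at h3 ⊢
      simp_rw [← mul_smul_comm]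
      rw [integral_const_mul, h3, ← mul_assoc, mul_one_div_cancel h2, one_mul, gaussSymbol,
        neg_div, div_self hπ]
    · have := (integrable_cexp_neg_mul_sq (b := Real.pi * Real.pi)
        (by simp [Real.pi_pos])).const_mul ((Real.pi : ℂ) ^ (1 / 2 : ℂ))
      simpa only [neg_mul] using this
    · have := ((integrable_mul_exp_neg_mul_sq hpi).norm).const_mul ‖(Real.pi : ℂ) ^ (1 / 2 : ℂ)‖
      refine this.congr (ae_of_all _ fun x => ?_)
      have h1 : ‖Complex.exp (-Real.pi * Real.pi * x ^ 2)‖ =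
          Real.exp (-(Real.pi * Real.pi) * x ^ 2) := by
        have := norm_cexp_neg_mul_sq (Real.pi * Real.pi) x
        simpa using this
      simp only [norm_mul, Real.norm_eq_abs, Real.abs_exp, h1]
      ring
  refine ⟨2 * Real.pi * ∫ η, |η| * ‖G η‖, ?_, ?_⟩
  · have : 0 ≤ ∫ η, |η| * ‖G η‖ := integral_nonneg fun η => by positivity
    positivity
  intro b hb q Λ hq hΛ f
  set Gb : ℝ → ℂ := fun η => b * G (b * η) with hGb
  have hF : 𝓕 Gb = gaussSymbol (((b ^ 2)⁻¹ : ℝ) : ℂ) := by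
    ext x
    have e1 : gaussSymbol (((b ^ 2)⁻¹ : ℝ) : ℂ) x = 𝓕 G (x / b) := by
      rw [hG, gaussSymbol, gaussSymbol]
      congr 1
      push_cast
      ring
    rw [e1, Real.fourier_real_eq, Real.fourier_real_eq]
    have := Measure.integral_comp_mul_left
      (fun v : ℝ => Real.fourierChar (-(v * (x / b))) • G v) b
    rw [abs_of_pos (inv_pos.2 hb)] at this
    rw [← one_smul ℝ (∫ v, _ • G v), ← mul_inv_cancel₀ hb.ne', mul_smul, ← this, ← integral_smul]
    congr 1
    ext v
    rw [hGb, Circle.smul_def, Circle.smul_def, Complex.real_smul, smul_eq_mul, smul_eq_mul,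
      show b * v * (x / b) = v * x by field_simp]
    ring
  have hi : Integrable Gb := (hGi.comp_mul_left' hb.ne').const_mul _
  have habs : ∀ η, |η| * ‖Gb η‖ = |b * η| * ‖G (b * η)‖ := fun η => by
    rw [hGb, norm_mul, Complex.norm_real, Real.norm_eq_abs, abs_mul]
    ring
  have hi' : Integrable fun η => |η| * ‖Gb η‖ := by
    simp_rw [habs]
    exact hGi'.comp_mul_left' hb.ne'
  have := norm_commutator_le hi hi' (hF ▸ isSymbol_gaussSymbol (inv_sq_re_nonneg b)) hq hΛ f
  rw [hF] at this
  refine this.trans (le_of_eq ?_)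
  simp_rw [habs]
  rw [Measure.integral_comp_mul_left (fun η => |η| * ‖G η‖) b, abs_of_pos (inv_pos.2 hb), smul_eq_mul]
  ring

/-! ### Closed forms of the dyadic cutoffs. -/

namespace IsDyadicCutoff

variable {F : ℝ → ℝ}

theorem eq_zero_of_le (hF : IsDyadicCutoff F) {x : ℝ} (hx : x ≤ 1 / 2) : F x = 0 := by
  have h : ∀ y < 1 / 2, F y = 0 := fun y hy => by
    by_contra hne
    exact absurd (hF.supp hne).1 (not_le.2 hy)
  rcases hx.lt_or_eq with hx | rfl
  · exact h x hx
  · refine tendsto_nhds_unique ((hF.smooth.continuous.tendsto (1 / 2)).mono_left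
      (nhdsWithin_le_nhds (s := Iio (1 / 2)))) (tendsto_const_nhds.congr' ?_)
    filter_upwards [self_mem_nhdsWithin] with y hy using (h y hy).symm

theorem eq_zero_of_ge (hF : IsDyadicCutoff F) {x : ℝ} (hx : 2 ≤ x) : F x = 0 := by
  have h : ∀ y > 2, F y = 0 := fun y hy => by
    by_contra hne
    exact absurd (hF.supp hne).2 (not_le.2 hy)
  rcases hx.lt_or_eq with hx | rfl
  · exact h x hx
  · refine tendsto_nhds_unique ((hF.smooth.continuous.tendsto 2).mono_left
      (nhdsWithin_le_nhds (s := Ioi 2))) (tendsto_const_nhds.congr' ?_)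
    filter_upwards [self_mem_nhdsWithin] with y hy using (h y hy).symm

theorem tsum_eq_one (hF : IsDyadicCutoff F) {x : ℝ} (hx : 0 < x) : ∑' j : ℤ, F (x / 2 ^ j) = 1 := by
  rw [(hF.hasSum x).tsum_eq, indicator_of_mem (mem_Ioi.2 hx)]

theorem two_le_div_zpow {x : ℝ} (hx : 1 ≤ x) {j : ℤ} (hj : j < 0) : 2 ≤ x / 2 ^ j := by
  have h1 : (2 : ℝ) ^ (1 : ℤ) ≤ 2 ^ (-j) := zpow_le_zpow_right₀ (by norm_num) (by omega)
  rw [zpow_one, zpow_neg] at h1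
  rw [div_eq_mul_inv]
  nlinarith

theorem div_zpow_le_half {x : ℝ} (hx : x ≤ 1) {j : ℤ} (hj : 0 < j) : x / 2 ^ j ≤ 1 / 2 := by
  have h1 : (2 : ℝ) ^ (1 : ℤ) ≤ 2 ^ j := zpow_le_zpow_right₀ (by norm_num) (by omega)
  rw [zpow_one] at h1
  rw [div_le_iff₀ (by positivity)]
  linarith

theorem apply_one (hF : IsDyadicCutoff F) : F 1 = 1 := by
  have h := hF.tsum_eq_one one_pos
  rw [tsum_eq_single 0] at h
  · simpa using h
  · intro j hj
    rcases lt_or_gt_of_ne hj with h0 | h0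
    · exact hF.eq_zero_of_ge (two_le_div_zpow le_rfl h0)
    · exact hF.eq_zero_of_le (div_zpow_le_half le_rfl h0)

/-- Below 1 only the term j = 0 can be nonzero. Above 1 the terms with j < 0 vanish, so the sum is
the full partition of unity, equal to 1 = F(1). -/
theorem cutGE_eq (hF : IsDyadicCutoff F) (y : ℝ) : cutGE F y = F (min y 1) := by
  rcases le_total y 1 with hy | hy
  · rw [min_eq_left hy, cutGE, tsum_eq_single 0]
    · simp
    · intro j hj
      exact hF.eq_zero_of_le (div_zpow_le_half hy (by omega))
  · rw [min_eq_right hy, hF.apply_one, ← hF.tsum_eq_one (zero_lt_one.trans_le hy), cutGE]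
    refine (Function.Injective.tsum_eq (g := fun n : ℕ => (n : ℤ))
      (f := fun j : ℤ => F (y / 2 ^ j)) Nat.cast_injective fun j hj => ?_)
    rcases lt_or_ge j 0 with h0 | h0
    · exact absurd (hF.eq_zero_of_ge (two_le_div_zpow hy h0)) hj
    · exact ⟨j.toNat, Int.toNat_of_nonneg h0⟩

/-- Mirror image of the previous closed form. Positivity matters: at y = 0 every term is F(0) = 0,
whereas F(1) = 1. -/
theorem cutLE_eq (hF : IsDyadicCutoff F) {y : ℝ} (hy0 : 0 < y) : cutLE F y = F (max y 1) := by
  rcases le_total y 1 with hy | hy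
  · rw [max_eq_right hy, hF.apply_one, ← hF.tsum_eq_one hy0, cutLE]
    refine (Function.Injective.tsum_eq (g := fun n : ℕ => -(n : ℤ))
      (f := fun j : ℤ => F (y / 2 ^ j)) (fun a b h => by simpa using h) fun j hj => ?_)
    rcases lt_or_ge 0 j with h0 | h0
    · exact absurd (hF.eq_zero_of_le (div_zpow_le_half hy h0)) hj
    · exact ⟨(-j).toNat, by simp only; omega⟩
  · rw [max_eq_left hy, cutLE, tsum_eq_single 0]
    · simp
    · intro j hj
      exact hF.eq_zero_of_ge (two_le_div_zpow hy (by omega))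

theorem add_half (hF : IsDyadicCutoff F) {y : ℝ} (h1 : 1 ≤ y) (h2 : y ≤ 2) :
    F y + F (y / 2) = 1 := by
  rw [← hF.tsum_eq_one (zero_lt_one.trans_le h1), tsum_eq_sum (s := {0, 1})]
  · simp
  · intro j hj
    simp only [Finset.mem_insert, Finset.mem_singleton, not_or] at hj
    rcases lt_or_ge j 0 with h0 | h0
    · exact hF.eq_zero_of_ge (two_le_div_zpow h1 h0)
    · have := hF.eq_zero_of_le (div_zpow_le_half (x := y / 2) (by linarith) (j := j - 1) (by omega))
      rw [zpow_sub_one₀ two_ne_zero] at this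
      convert this using 2
      field_simp

theorem abs_apply (hF : IsDyadicCutoff F) (x : ℝ) : F |x| = F x + F (-x) := by
  rcases le_total 0 x with h | h
  · rw [abs_of_nonneg h, hF.eq_zero_of_le (x := -x) (by linarith), add_zero]
  · rw [abs_of_nonpos h, hF.eq_zero_of_le (x := x) (by linarith), zero_add]

theorem contDiff_abs (hF : IsDyadicCutoff F) : ContDiff ℝ ∞ fun x => F |x| := by
  simp_rw [hF.abs_apply]
  exact hF.smooth.add (hF.smooth.comp contDiff_neg)

end IsDyadicCutoff

/-- The spatial cutoff profile. -/
def bump (F : ℝ → ℝ) (x : ℝ) : ℝ := F (max |x| 1)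

namespace IsDyadicCutoff

variable {F : ℝ → ℝ}

/-- Neither the maximum nor the absolute value is smooth. For |x| < 2 the profile equals 1 -
F(|x|/2), since F(y) + F(y/2) = 1 on [1, 2]; for |x| > 1 it equals F(|x|). Both are smooth because F
vanishes up to 1/2. -/
theorem contDiff_bump (hF : IsDyadicCutoff F) : ContDiff ℝ ∞ (bump F) := by
  rw [contDiff_iff_contDiffAt]
  intro x
  rcases lt_or_ge |x| 2 with h | h
  · have h1 : ContDiff ℝ ∞ fun x => 1 - F |x / 2| :=
      contDiff_const.sub (hF.contDiff_abs.comp (contDiff_id.div_const 2))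
    refine h1.contDiffAt.congr_of_eventuallyEq ?_
    filter_upwards [(isOpen_lt continuous_abs continuous_const).mem_nhds h] with y hy
    replace hy : |y| < 2 := hy
    rw [bump, abs_div, abs_two]
    rcases le_total |y| 1 with h2 | h2
    · rw [max_eq_right h2, hF.apply_one, hF.eq_zero_of_le (by linarith), sub_zero]
    · rw [max_eq_left h2, ← hF.add_half h2 hy.le, add_sub_cancel_right]
  · refine hF.contDiff_abs.contDiffAt.congr_of_eventuallyEq ?_
    filter_upwards [(isOpen_lt continuous_const continuous_abs).mem_nhds
      (show 1 < |x| by linarith)] with y hy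
    rw [bump, max_eq_left (le_of_lt hy)]

theorem bump_eq_zero (hF : IsDyadicCutoff F) {x : ℝ} (hx : 2 ≤ |x|) : bump F x = 0 :=
  hF.eq_zero_of_ge (hx.trans (le_max_left _ _))

theorem hasCompactSupport_bump (hF : IsDyadicCutoff F) : HasCompactSupport (bump F) := by
  refine HasCompactSupport.intro (isCompact_Icc (a := -2) (b := 2)) fun x hx => hF.bump_eq_zero ?_
  by_contra h
  exact hx (abs_le.1 (not_le.1 h).le)

theorem norm_apply_le (hF : IsDyadicCutoff F) (x : ℝ) : ‖(F x : ℂ)‖ ≤ 1 := by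
  rw [Complex.norm_real, Real.norm_eq_abs, abs_of_nonneg (hF.nonneg x)]
  exact hF.le_one x

theorem exists_lipschitz (hF : IsDyadicCutoff F) : ∃ Λ : ℝ≥0, LipschitzWith Λ F := by
  have hc : HasCompactSupport F := HasCompactSupport.intro (isCompact_Icc (a := 1 / 2) (b := 2))
    fun x hx => by
      by_contra h
      exact hx (hF.supp h)
  exact hF.smooth.lipschitzWith_of_hasCompactSupport hc (by simp)

end IsDyadicCutoff

/-! ### The Lipschitz quotient of the frequency cutoff by the difference symbol. -/

/-- Bounded Lipschitz functions. -/
def IsBddLip (f : ℝ → ℂ) : Prop :=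
  ∃ C : ℝ, 0 ≤ C ∧ (∀ x, ‖f x‖ ≤ C) ∧ ∀ x y, ‖f x - f y‖ ≤ C * |x - y|

theorem IsBddLip.mul {f g : ℝ → ℂ} (hf : IsBddLip f) (hg : IsBddLip g) :
    IsBddLip fun x => f x * g x := by
  obtain ⟨A, hA0, hA, hA'⟩ := hf
  obtain ⟨B, hB0, hB, hB'⟩ := hg
  refine ⟨max (A * B) (2 * (A * B)), by positivity, fun x => ?_, fun x y => ?_⟩
  · rw [norm_mul]
    exact (mul_le_mul (hA x) (hB x) (norm_nonneg _) hA0).trans (le_max_left _ _)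
  · have e : f x * g x - f y * g y = f x * (g x - g y) + (f x - f y) * g y := by ring
    rw [e]
    refine (norm_add_le _ _).trans ?_
    rw [norm_mul, norm_mul]
    calc _ ≤ A * (B * |x - y|) + (A * |x - y|) * B := by
          gcongr
          · exact hA x
          · exact hB' x y
          · exact hA' x y
          · exact hB y
      _ = 2 * (A * B) * |x - y| := by ring
      _ ≤ _ := by
        gcongr
        exact le_max_right _ _

theorem IsBddLip.pow {f : ℝ → ℂ} (hf : IsBddLip f) (k : ℕ) : IsBddLip fun x => f x ^ k := by
  induction k with
  | zero => exact ⟨1, zero_le_one, fun x => by simp, fun x y => by simp⟩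
  | succ k ih =>
    simp_rw [pow_succ]
    exact ih.mul hf

theorem IsBddLip.continuous {f : ℝ → ℂ} (hf : IsBddLip f) : Continuous f := by
  obtain ⟨C, hC0, -, hC⟩ := hf
  exact (LipschitzWith.of_dist_le_mul (K := ⟨C, hC0⟩) fun x y => by
    rw [dist_eq_norm, Real.dist_eq]
    exact hC x y).continuous

theorem abs_exp_neg_sq_sub_le (x y : ℝ) :
    |Real.exp (-x ^ 2) - Real.exp (-y ^ 2)| ≤ |x - y| := by
  have hd : ∀ z : ℝ, HasDerivAt (fun z : ℝ => Real.exp (-z ^ 2))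
      (Real.exp (-z ^ 2) * -(2 * z)) z := fun z => by
    have := ((hasDerivAt_pow 2 z).neg).exp
    simpa using this
  have hb : ∀ z : ℝ, ‖deriv (fun z : ℝ => Real.exp (-z ^ 2)) z‖ ≤ 1 := by
    intro z
    rw [(hd z).deriv, norm_mul, Real.norm_eq_abs, Real.norm_eq_abs, Real.abs_exp, abs_neg, abs_mul,
      abs_two]
    have h1 : 2 * |z| ≤ Real.exp (z ^ 2) := by
      have := Real.add_one_le_exp (z ^ 2)
      nlinarith [sq_nonneg (|z| - 1), sq_abs z]
    calc _ ≤ Real.exp (-z ^ 2) * Real.exp (z ^ 2) := by gcongr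
      _ = 1 := by rw [← Real.exp_add, neg_add_cancel, Real.exp_zero]
  have := Convex.norm_image_sub_le_of_norm_deriv_le (𝕜 := ℝ) (s := univ) (x := y) (y := x)
    (fun z _ => (hd z).differentiableAt) (fun z _ => hb z) convex_univ (mem_univ _) (mem_univ _)
  rwa [one_mul] at this

/-- The inverse of `e^{-s²} - 1`, regularized near the origin. -/
def invDiff (s : ℝ) : ℂ := ((Real.exp (-(max |s| (1 / 2)) ^ 2) - 1)⁻¹ : ℝ)

theorem isBddLip_invDiff : IsBddLip invDiff := by
  set c : ℝ := 1 - Real.exp (-(1 / 2) ^ 2) with hc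
  have hc0 : 0 < c := by
    have : Real.exp (-(1 / 2) ^ 2) < 1 := Real.exp_lt_one_iff.2 (by norm_num)
    linarith
  set E : ℝ → ℝ := fun s => Real.exp (-(max |s| (1 / 2)) ^ 2) - 1 with hE
  have hEc : ∀ s, c ≤ |E s| := by
    intro s
    have h1 : Real.exp (-(max |s| (1 / 2)) ^ 2) ≤ Real.exp (-(1 / 2) ^ 2) := by
      apply Real.exp_le_exp.2
      have : (1 / 2 : ℝ) ≤ max |s| (1 / 2) := le_max_right _ _
      nlinarith
    refine le_trans ?_ (neg_le_abs (E s))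
    simp only [hE, hc]
    linarith
  have hE0 : ∀ s, E s ≠ 0 := fun s h => by
    have := hEc s
    rw [h, abs_zero] at this
    linarith
  refine ⟨max c⁻¹ (c⁻¹ * c⁻¹), by positivity, fun s => ?_, fun s r => ?_⟩
  · rw [invDiff, Complex.norm_real, norm_inv, Real.norm_eq_abs]
    exact (inv_anti₀ hc0 (hEc s)).trans (le_max_left _ _)
  · rw [invDiff, invDiff, ← Complex.ofReal_sub, Complex.norm_real, inv_sub_inv (hE0 s) (hE0 r),
      norm_div, norm_mul, Real.norm_eq_abs, Real.norm_eq_abs, Real.norm_eq_abs, div_eq_mul_inv,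
      mul_inv]
    have h1 : |E r - E s| ≤ |s - r| := by
      simp only [hE]
      rw [sub_sub_sub_cancel_right]
      refine (abs_exp_neg_sq_sub_le _ _).trans ?_
      refine (abs_max_sub_max_le_abs _ _ _).trans ?_
      rw [abs_sub_comm]
      exact abs_abs_sub_abs_le_abs_sub _ _
    calc _ ≤ |s - r| * (c⁻¹ * c⁻¹) := by
          gcongr
          · exact hEc s
          · exact hEc r
      _ ≤ _ := by
        rw [mul_comm]
        gcongr
        exact le_max_right _ _

/-- The quotient of the frequency cutoff by the high order difference symbol. -/
def quotSymbol (F : ℝ → ℝ) (k : ℕ) (s : ℝ) : ℂ := (F (min |s| 1) : ℂ) * invDiff s ^ k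

theorem IsDyadicCutoff.isBddLip_quotSymbol {F : ℝ → ℝ} (hF : IsDyadicCutoff F) (k : ℕ) :
    IsBddLip (quotSymbol F k) := by
  refine IsBddLip.mul ?_ (isBddLip_invDiff.pow k)
  obtain ⟨Λ, hΛ⟩ := hF.exists_lipschitz
  refine ⟨max 1 Λ, by positivity, fun x => (hF.norm_apply_le _).trans (le_max_left _ _),
    fun x y => ?_⟩
  rw [← Complex.ofReal_sub, Complex.norm_real, ← dist_eq_norm]
  refine (hΛ.dist_le_mul _ _).trans ?_
  rw [Real.dist_eq]
  refine mul_le_mul (le_max_right _ _) ?_ (abs_nonneg _) (by positivity)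
  refine (abs_min_sub_min_le_max _ _ _ _).trans ?_
  rw [sub_self, abs_zero, max_eq_left (abs_nonneg _)]
  exact abs_abs_sub_abs_le_abs_sub _ _

/-- The regularization of the inverse takes effect only for |s| < 1/2, where the factor F already
vanishes. -/
theorem IsDyadicCutoff.quotSymbol_mul {F : ℝ → ℝ} (hF : IsDyadicCutoff F) (k : ℕ) (s : ℝ) :
    quotSymbol F k s * (Complex.exp (-(s : ℂ) ^ 2) - 1) ^ k = F (min |s| 1) := by
  rcases le_total |s| (1 / 2) with h | h
  · rw [quotSymbol, min_eq_left (by linarith), hF.eq_zero_of_le h]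
    simp
  · have e : Complex.exp (-(s : ℂ) ^ 2) - 1 = ((Real.exp (-s ^ 2) - 1 : ℝ) : ℂ) := by
      push_cast
      ring_nf
    have h0 : Real.exp (-s ^ 2) - 1 ≠ 0 := by
      have : Real.exp (-s ^ 2) < 1 := by
        rw [Real.exp_lt_one_iff]
        nlinarith [sq_abs s]
      linarith
    rw [quotSymbol, invDiff, max_eq_left h, sq_abs, e, mul_assoc, ← mul_pow, ← Complex.ofReal_mul,
      inv_mul_cancel₀ h0]
    simp

/-! ### Localization in position and frequency. -/

theorem isSymbol_schwartz (χ : 𝓢(ℝ, ℂ)) : IsSymbol χ :=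
  ⟨χ.continuous.measurable, SchwartzMap.seminorm ℂ 0 0 χ, fun x => χ.norm_le_seminorm ℂ x⟩

/-- The product rule. -/
theorem IsWeakDeriv.mulL2 {f g : L2} (h : IsWeakDeriv f g) (χ : 𝓢(ℝ, ℂ)) :
    IsWeakDeriv (mulL2 χ f) (mulL2 (SchwartzMap.derivCLM ℂ ℂ χ) f + mulL2 χ g) := fun φ => by
  have e : SchwartzMap.derivCLM ℂ ℂ (SchwartzMap.smulLeftCLM ℂ χ φ) =
      SchwartzMap.smulLeftCLM ℂ χ (SchwartzMap.derivCLM ℂ ℂ φ) +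
        SchwartzMap.smulLeftCLM ℂ (SchwartzMap.derivCLM ℂ ℂ χ) φ := by
    ext x
    have e1 : (SchwartzMap.smulLeftCLM ℂ χ φ : ℝ → ℂ) = fun x => χ x * φ x := by
      ext y
      rw [SchwartzMap.smulLeftCLM_apply_apply χ.hasTemperateGrowth, smul_eq_mul]
    rw [SchwartzMap.derivCLM_apply, e1, add_apply,
      SchwartzMap.smulLeftCLM_apply_apply χ.hasTemperateGrowth,
      SchwartzMap.smulLeftCLM_apply_apply (SchwartzMap.derivCLM ℂ ℂ χ).hasTemperateGrowth,
      SchwartzMap.derivCLM_apply, SchwartzMap.derivCLM_apply]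
    have := (χ.differentiable.differentiableAt (x := x)).hasDerivAt.mul
      (φ.differentiable.differentiableAt (x := x)).hasDerivAt
    rw [smul_eq_mul, smul_eq_mul, add_comm]
    exact this.deriv
  rw [pair_mulL2 (isSymbol_schwartz χ) χ.hasTemperateGrowth, pair_add_left,
    pair_mulL2 (isSymbol_schwartz χ) χ.hasTemperateGrowth,
    pair_mulL2 (isSymbol_schwartz _) (SchwartzMap.hasTemperateGrowth _)]
  have h1 := h (SchwartzMap.smulLeftCLM ℂ χ φ)
  rw [e, pair_add_right] at h1
  linear_combination h1

/-- The spatial cutoff at scale `R`. -/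
def spaceCut (F : ℝ → ℝ) (R x : ℝ) : ℂ := (bump F (x / R) : ℂ)

/-- The cutoff to frequencies above `ρ⁻¹`. -/
def freqCut (F : ℝ → ℝ) (ρ ξ : ℝ) : ℂ := (F (min |ρ * ξ| 1) : ℂ)

/-- The localization to `|x| ≲ R`, `|D| ≳ ρ⁻¹`. -/
def localize (F : ℝ → ℝ) (R ρ : ℝ) (f : L2) : L2 :=
  mulL2 (spaceCut F R) (fourierMult (freqCut F ρ) f)

section Localize

variable {F : ℝ → ℝ}

theorem norm_spaceCut_le (hF : IsDyadicCutoff F) (R x : ℝ) : ‖spaceCut F R x‖ ≤ 1 :=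
  hF.norm_apply_le _

theorem norm_freqCut_le (hF : IsDyadicCutoff F) (ρ ξ : ℝ) : ‖freqCut F ρ ξ‖ ≤ 1 :=
  hF.norm_apply_le _

theorem isSymbol_spaceCut (hF : IsDyadicCutoff F) (R : ℝ) : IsSymbol (spaceCut F R) := by
  refine IsSymbol.of_bound (Continuous.measurable ?_) (norm_spaceCut_le hF R)
  have := hF.smooth.continuous
  unfold spaceCut bump
  fun_prop

theorem isSymbol_freqCut (hF : IsDyadicCutoff F) (ρ : ℝ) : IsSymbol (freqCut F ρ) := by
  refine IsSymbol.of_bound (Continuous.measurable ?_) (norm_freqCut_le hF ρ)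
  have := hF.smooth.continuous
  unfold freqCut
  fun_prop

theorem localize_sub (hF : IsDyadicCutoff F) (R ρ : ℝ) (f g : L2) :
    localize F R ρ (f - g) = localize F R ρ f - localize F R ρ g := by
  rw [localize, fourierMult_sub (isSymbol_freqCut hF ρ), mulL2_sub (isSymbol_spaceCut hF R)]
  rfl

theorem tendsto_spaceCut (hF : IsDyadicCutoff F) {R : ℝ → ℝ} (hR : Tendsto R atTop atTop) (f : L2) :
    Tendsto (fun t => mulL2 (spaceCut F (R t)) f) atTop (𝓝 f) := by
  have := tendsto_mulL2 (m := fun _ => 1) (fun t => isSymbol_spaceCut hF (R t))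
    (fun t => norm_spaceCut_le hF (R t)) (l := atTop) (ae_of_all _ fun x => ?_) IsSymbol.one f
  · rwa [mulL2_one] at this
  · refine tendsto_const_nhds.congr' ?_
    filter_upwards [hR.eventually_ge_atTop |x|, hR.eventually_gt_atTop 0] with t h1 h2
    rw [spaceCut, bump, abs_div, abs_of_pos h2, max_eq_right ((div_le_one h2).2 h1), hF.apply_one,
      Complex.ofReal_one]

theorem tendsto_freqCut (hF : IsDyadicCutoff F) {ρ : ℝ → ℝ} (hρ : Tendsto ρ atTop atTop) (f : L2) :
    Tendsto (fun t => fourierMult (freqCut F (ρ t)) f) atTop (𝓝 f) := by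
  have := tendsto_fourierMult (m := fun _ => 1) (fun t => isSymbol_freqCut hF (ρ t))
    (fun t => norm_freqCut_le hF (ρ t)) (l := atTop) ?_ IsSymbol.one f
  · rwa [fourierMult_one] at this
  · filter_upwards [compl_mem_ae_iff.2 (measure_singleton (0 : ℝ))] with ξ hξ
    have h0 : 0 < |2 * Real.pi * ξ| := abs_pos.2 (mul_ne_zero (by positivity) hξ)
    refine tendsto_const_nhds.congr' ?_
    filter_upwards [(hρ.atTop_mul_const h0).eventually_ge_atTop 1, hρ.eventually_ge_atTop 0]
      with t h1 h2
    rw [freqCut, abs_mul, abs_of_nonneg h2, min_eq_right h1, hF.apply_one, Complex.ofReal_one]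

theorem tendsto_localize (hF : IsDyadicCutoff F) {R ρ : ℝ → ℝ} (hR : Tendsto R atTop atTop)
    (hρ : Tendsto ρ atTop atTop) (f : L2) :
    Tendsto (fun t => localize F (R t) (ρ t) f) atTop (𝓝 f) := by
  rw [tendsto_iff_norm_sub_tendsto_zero]
  have h1 := tendsto_iff_norm_sub_tendsto_zero.1 (tendsto_spaceCut hF hR f)
  have h2 := tendsto_iff_norm_sub_tendsto_zero.1 (tendsto_freqCut hF hρ f)
  refine squeeze_zero (fun t => norm_nonneg _) (fun t => ?_) (by simpa using h2.add h1)
  have e : localize F (R t) (ρ t) f - f =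
      mulL2 (spaceCut F (R t)) (fourierMult (freqCut F (ρ t)) f - f) +
        (mulL2 (spaceCut F (R t)) f - f) := by
    rw [mulL2_sub (isSymbol_spaceCut hF _), localize]
    abel
  rw [e]
  refine (norm_add_le _ _).trans (add_le_add ?_ le_rfl)
  simpa using norm_mulL2_le (isSymbol_spaceCut hF (R t)) (norm_spaceCut_le hF (R t))
    (fourierMult (freqCut F (ρ t)) f - f)

theorem exists_spaceCut_schwartz (hF : IsDyadicCutoff F) : ∃ Λ : ℝ, 0 ≤ Λ ∧ ∀ R : ℝ, 0 < R →
    ∃ χ : 𝓢(ℝ, ℂ), (χ : ℝ → ℂ) = spaceCut F R ∧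
      ∀ x, ‖SchwartzMap.derivCLM ℂ ℂ χ x‖ ≤ Λ / R := by
  obtain ⟨Λ, hΛ⟩ := hF.contDiff_bump.lipschitzWith_of_hasCompactSupport
    hF.hasCompactSupport_bump (by simp)
  refine ⟨Λ, Λ.2, fun R hR => ?_⟩
  have hs : ContDiff ℝ ∞ (spaceCut F R) :=
    Complex.ofRealCLM.contDiff.comp (hF.contDiff_bump.comp (contDiff_id.div_const R))
  have hc : HasCompactSupport (spaceCut F R) := by
    refine HasCompactSupport.intro (isCompact_Icc (a := -(2 * R)) (b := 2 * R)) fun x hx => ?_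
    rw [spaceCut, hF.bump_eq_zero, Complex.ofReal_zero]
    by_contra h
    rw [not_le, abs_div, abs_of_pos hR, div_lt_iff₀ hR] at h
    exact hx (abs_le.1 h.le)
  refine ⟨hc.toSchwartzMap hs, rfl, fun x => ?_⟩
  have hL : LipschitzWith ⟨Λ / R, by positivity⟩ (spaceCut F R) := by
    refine LipschitzWith.of_dist_le_mul fun x y => ?_
    rw [spaceCut, spaceCut, dist_eq_norm, ← Complex.ofReal_sub, Complex.norm_real, ← dist_eq_norm]
    refine (hΛ.dist_le_mul _ _).trans (le_of_eq ?_)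
    rw [Real.dist_eq, Real.dist_eq, ← sub_div, abs_div, abs_of_pos hR]
    change _ = (Λ / R : ℝ) * _
    ring
  exact norm_deriv_le_of_lipschitz hL

/-- Localized functions have weak derivatives, and the derivative commutes with the localization
up to a small error. -/
theorem exists_isWeakDeriv_localize (hF : IsDyadicCutoff F) : ∃ Λ : ℝ, 0 ≤ Λ ∧
    ∀ {R : ℝ} (ρ : ℝ), 0 < R → ∀ {f g : L2}, IsWeakDeriv f g → ∃ e : L2,
      IsWeakDeriv (localize F R ρ f) (e + localize F R ρ g) ∧ ‖e‖ ≤ Λ / R * ‖f‖ := by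
  obtain ⟨Λ, hΛ0, hΛ⟩ := exists_spaceCut_schwartz hF
  refine ⟨Λ, hΛ0, fun {R} ρ hR {f g} hfg => ?_⟩
  obtain ⟨χ, hχ, hχ'⟩ := hΛ R hR
  have h1 := (hfg.fourierMult (isSymbol_freqCut hF ρ)).mulL2 χ
  rw [hχ] at h1
  refine ⟨_, h1, (norm_mulL2_le (isSymbol_schwartz _) hχ' _).trans ?_⟩
  have h2 := norm_fourierMult_le (isSymbol_freqCut hF ρ) (norm_freqCut_le hF ρ) f
  rw [one_mul] at h2
  gcongr

theorem freqCut_eq (hF : IsDyadicCutoff F) (k : ℕ) (ρ : ℝ) {a : ℝ} (ha : a = ρ ^ 2) (ξ : ℝ) :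
    freqCut F ρ ξ = quotSymbol F k (ρ * ξ) * diffSymbol a k ξ := by
  rw [freqCut, ← hF.quotSymbol_mul k, diffSymbol, gaussSymbol, ha]
  congr 4
  push_cast
  ring

/-- The localization is controlled by the Gaussian localization of a high order difference. -/
theorem exists_norm_localize_le (hF : IsDyadicCutoff F) (k : ℕ) : ∃ C : ℝ, 0 ≤ C ∧
    ∀ {R b ρ a : ℝ}, 0 < R → R ≤ b → 0 ≤ ρ → a = ρ ^ 2 → ∀ v : L2,
      ‖localize F R ρ v‖ ≤ C * (‖mulL2 (gaussSymbol (((b ^ 2)⁻¹ : ℝ) : ℂ))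
        (fourierMult (diffSymbol a k) v)‖ + ρ / b * ‖v‖) := by
  obtain ⟨C, hC0, hC⟩ := exists_gauss_commutator
  have hq := hF.isBddLip_quotSymbol k
  have hqc := hq.continuous
  obtain ⟨B, hB0, hB, hB'⟩ := hq
  refine ⟨Real.exp 4 * max B (C * B * 2 ^ k), by positivity, ?_⟩
  intro R b ρ a hR hRb hρ ha v
  have ha0 : 0 ≤ a := ha ▸ sq_nonneg ρ
  have hb : 0 < b := hR.trans_le hRb
  have hqs : IsSymbol fun ξ => quotSymbol F k (ρ * ξ) :=
    ⟨(hqc.comp (continuous_const.mul continuous_id)).measurable, B, fun ξ => hB _⟩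
  have hns : IsSymbol (diffSymbol a k) := isSymbol_diffSymbol ha0 k
  have hgs : IsSymbol (gaussSymbol (((b ^ 2)⁻¹ : ℝ) : ℂ)) :=
    isSymbol_gaussSymbol (inv_sq_re_nonneg b)
  set n := fourierMult (diffSymbol a k) v with hn
  have h1 : fourierMult (freqCut F ρ) v = fourierMult (fun ξ => quotSymbol F k (ρ * ξ)) n := by
    rw [hn, fourierMult_fourierMult hqs hns]
    congr 1
    ext ξ
    exact freqCut_eq hF k ρ ha ξ
  -- The spatial cutoff lives on |x| ≤ 2R ≤ 2b, where the Gaussian is at least e⁻⁴.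
  have h2 : ‖localize F R ρ v‖ ≤ Real.exp 4 * ‖mulL2 (gaussSymbol (((b ^ 2)⁻¹ : ℝ) : ℂ))
      (fourierMult (fun ξ => quotSymbol F k (ρ * ξ)) n)‖ := by
    rw [localize, h1]
    refine norm_mulL2_le_norm_mulL2 (isSymbol_spaceCut hF R) hgs (ae_of_all _ fun x => ?_) _
    rcases le_total (2 * R) |x| with h | h
    · rw [spaceCut, hF.bump_eq_zero, Complex.ofReal_zero, norm_zero]
      · positivity
      · rwa [abs_div, abs_of_pos hR, le_div_iff₀ hR]
    · refine (norm_spaceCut_le hF R x).trans ?_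
      rw [norm_gaussSymbol, Complex.ofReal_re, ← Real.exp_add]
      refine Real.one_le_exp ?_
      have h3 : x ^ 2 ≤ 4 * b ^ 2 := by
        rw [← sq_abs]
        nlinarith [abs_nonneg x]
      have h4 : (b ^ 2)⁻¹ * x ^ 2 ≤ 4 := by
        rw [inv_mul_le_iff₀ (by positivity)]
        linarith
      linarith
  -- Rescaling the quotient symbol by ρ gives it the Lipschitz constant Bρ, so moving it past the
  -- Gaussian costs a multiple of ρ/b.
  have h3 := hC hb hqs (Λ := B * ρ) (fun ξ η => by
    refine (hB' _ _).trans (le_of_eq ?_)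
    rw [← mul_sub, abs_mul, abs_of_nonneg hρ, mul_assoc]) n
  have h4 := norm_fourierMult_le hqs (fun ξ => hB _) (mulL2 (gaussSymbol (((b ^ 2)⁻¹ : ℝ) : ℂ)) n)
  have h5 : ‖n‖ ≤ 2 ^ k * ‖v‖ := norm_fourierMult_le hns (norm_diffSymbol_le ha0 k) v
  have h6 := norm_sub_norm_le (mulL2 (gaussSymbol (((b ^ 2)⁻¹ : ℝ) : ℂ))
      (fourierMult (fun ξ => quotSymbol F k (ρ * ξ)) n))
      (fourierMult (fun ξ => quotSymbol F k (ρ * ξ)) (mulL2 (gaussSymbol (((b ^ 2)⁻¹ : ℝ) : ℂ)) n))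
  refine h2.trans ?_
  rw [mul_assoc]
  refine mul_le_mul_of_nonneg_left ?_ (Real.exp_pos _).le
  have h7 : C * (B * ρ / b) * ‖n‖ ≤ C * (B * ρ / b) * (2 ^ k * ‖v‖) := by gcongr
  calc _ ≤ B * ‖mulL2 (gaussSymbol (((b ^ 2)⁻¹ : ℝ) : ℂ)) n‖ +
        (C * B * 2 ^ k) * (ρ / b * ‖v‖) := by
        have : C * (B * ρ / b) * (2 ^ k * ‖v‖) = (C * B * 2 ^ k) * (ρ / b * ‖v‖) := by ring
        linarith
    _ ≤ max B (C * B * 2 ^ k) * ‖mulL2 (gaussSymbol (((b ^ 2)⁻¹ : ℝ) : ℂ)) n‖ +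
        max B (C * B * 2 ^ k) * (ρ / b * ‖v‖) := by
        gcongr
        · exact le_max_left _ _
        · exact le_max_right _ _
    _ = _ := by ring

end Localize

/-! ### The free channel in the interaction picture. -/

theorem freeProp_fourierMult {m : ℝ → ℂ} (hm : IsSymbol m) (t : ℝ) (f : L2) :
    freeProp t (fourierMult m f) = fourierMult m (freeProp t f) := by
  rw [freeProp_eq, freeProp_eq, fourierMult_fourierMult (isSymbol_free t) hm,
    fourierMult_fourierMult hm (isSymbol_free t)]
  simp_rw [mul_comm]

theorem freeProp_freeProp (s t : ℝ) (f : L2) : freeProp s (freeProp t f) = freeProp (s + t) f := by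
  rw [freeProp_eq, freeProp_eq, freeProp_eq,
    fourierMult_fourierMult (isSymbol_free s) (isSymbol_free t)]
  congr 1
  ext ξ
  rw [free_add]

theorem freeProp_zero (f : L2) : freeProp 0 f = f := by
  rw [freeProp_eq, Complex.ofReal_zero, mul_zero]
  have : gaussSymbol 0 = fun _ => 1 := funext gaussSymbol_zero
  rw [this, fourierMult_one]

theorem freeProp_sub (t : ℝ) (f g : L2) : freeProp t (f - g) = freeProp t f - freeProp t g := by
  rw [freeProp_eq, freeProp_eq, freeProp_eq, fourierMult_sub (isSymbol_free t)]

theorem inner_freeProp_neg (t : ℝ) (f g : L2) :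
    inner ℂ (freeProp (-t) f) g = inner ℂ f (freeProp t g) := by
  rw [freeProp_eq t, inner_fourierMult (isSymbol_free t), freeProp_eq]
  congr 2
  ext ξ
  rw [gaussSymbol, gaussSymbol, ← Complex.exp_conj]
  simp

/-- The propagators e^{itΔ} and e^{-itΔ} cancel on the left, and the inner one commutes with the
frequency cutoff. The two forms of the spatial cutoff differ at x = 0, a null set. -/
theorem freeProp_Jfree {F : ℝ → ℝ} (hF : IsDyadicCutoff F) {α δ t : ℝ} (ht : 0 < t) (f : L2) :
    freeProp t (Jfree F α δ t f) = localize F (t ^ α) (t ^ δ) (freeProp t f) := by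
  have e1 : (fun ξ : ℝ => (cutGE F (|ξ| / t ^ (-δ)) : ℂ)) = freqCut F (t ^ δ) := by
    ext ξ
    rw [hF.cutGE_eq, freqCut, abs_mul, abs_of_pos (by positivity : 0 < t ^ δ), Real.rpow_neg ht.le,
      div_inv_eq_mul, mul_comm]
  have hR : 0 < t ^ α := by positivity
  have hc : ∀ x : ℝ, x ≠ 0 → (cutLE F (|x| / t ^ α) : ℂ) = spaceCut F (t ^ α) x := fun x hx => by
    have : 0 < |x| := abs_pos.2 hx
    rw [hF.cutLE_eq (by positivity), spaceCut, bump, abs_div, abs_of_pos hR]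
  have e2 : ∀ᵐ x : ℝ, (cutLE F (|x| / t ^ α) : ℂ) = spaceCut F (t ^ α) x := by
    filter_upwards [compl_mem_ae_iff.2 (measure_singleton (0 : ℝ))] with x hx using hc x hx
  have e3 : ∀ h : L2, mulL2 (fun x => (cutLE F (|x| / t ^ α) : ℂ)) h =
      mulL2 (spaceCut F (t ^ α)) h := by
    intro h
    -- Measurability and boundedness of the series are read off from its closed form away from 0.
    have e4 : (fun x => (cutLE F (|x| / t ^ α) : ℂ)) =
        fun x => if x = 0 then (cutLE F 0 : ℂ) else spaceCut F (t ^ α) x := by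
      ext x
      split_ifs with hx
      · rw [hx, abs_zero, zero_div]
      · exact hc x hx
    refine mulL2_congr ?_ (isSymbol_spaceCut hF _) e2 h
    rw [e4]
    refine ⟨Measurable.ite (measurableSet_singleton 0) measurable_const
      (isSymbol_spaceCut hF _).meas, max ‖(cutLE F 0 : ℂ)‖ 1, fun x => ?_⟩
    split_ifs
    · exact le_max_left _ _
    · exact (norm_spaceCut_le hF _ x).trans (le_max_right _ _)
  rw [Jfree, freeProp_freeProp, add_neg_cancel, freeProp_zero, e1, e3,
    freeProp_fourierMult (isSymbol_freqCut hF _), localize]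

/-- The Gaussian part decays like t^{-γ} and the commutator error like t^δ/t^β, which tends to 0
because δ < β. -/
theorem tendsto_norm_localize {F : ℝ → ℝ} (hF : IsDyadicCutoff F) {α β δ γ C M : ℝ} {k : ℕ}
    (hαβ : α ≤ β) (hδβ : δ < β) (hγ : 0 < γ) {v : ℝ → L2} (hM : ∀ t, 1 ≤ t → ‖v t‖ ≤ M)
    (hv : ∀ t : ℝ, 1 ≤ t → ‖mulL2 (gaussSymbol ((((t ^ β) ^ 2)⁻¹ : ℝ) : ℂ))
      (fourierMult (diffSymbol (t ^ (2 * δ)) k) (v t))‖ ≤ C * t ^ (-γ)) :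
    Tendsto (fun t => ‖localize F (t ^ α) (t ^ δ) (v t)‖) atTop (𝓝 0) := by
  obtain ⟨B, hB0, hB⟩ := exists_norm_localize_le hF k
  have h1 : Tendsto (fun t : ℝ => B * (C * t ^ (-γ) + t ^ (-(β - δ)) * M)) atTop (𝓝 0) := by
    have := (((tendsto_rpow_neg_atTop hγ).const_mul C).add
      ((tendsto_rpow_neg_atTop (sub_pos.2 hδβ)).mul_const M)).const_mul B
    simpa using this
  refine squeeze_zero' (Eventually.of_forall fun t => norm_nonneg _) ?_ h1
  filter_upwards [eventually_ge_atTop 1] with t ht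
  have ht0 : 0 < t := zero_lt_one.trans_le ht
  refine (hB (b := t ^ β) (a := t ^ (2 * δ)) (by positivity)
    (Real.rpow_le_rpow_of_exponent_le ht hαβ) (by positivity) ?_ (v t)).trans ?_
  · rw [← Real.rpow_natCast, ← Real.rpow_mul ht0.le]
    congr 1
    push_cast
    ring
  · have e : t ^ δ / t ^ β = t ^ (-(β - δ)) := by
      rw [← Real.rpow_sub ht0]
      congr 1
      ring
    rw [e]
    gcongr
    · exact hv t ht
    · exact hM t ht

theorem tendsto_h1Norm {f g : ℝ → L2} (hfg : ∀ᶠ t in atTop, IsWeakDeriv (f t) (g t))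
    (hf : Tendsto (fun t => ‖f t‖) atTop (𝓝 0)) (hg : Tendsto (fun t => ‖g t‖) atTop (𝓝 0)) :
    Tendsto (fun t => h1Norm (f t)) atTop (𝓝 0) := by
  have h1 : Tendsto (fun t => ENNReal.ofReal (‖f t‖ + ‖g t‖)) atTop (𝓝 0) := by
    have := ENNReal.tendsto_ofReal (hf.add hg)
    simpa using this
  refine tendsto_of_tendsto_of_tendsto_of_le_of_le' tendsto_const_nhds h1
    (Eventually.of_forall fun t => zero_le) ?_
  filter_upwards [hfg] with t ht using h1Norm_le ht

theorem tendsto_norm_add_zero {f g : ℝ → L2} (hf : Tendsto (fun t => ‖f t‖) atTop (𝓝 0))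
    (hg : Tendsto (fun t => ‖g t‖) atTop (𝓝 0)) : Tendsto (fun t => ‖f t + g t‖) atTop (𝓝 0) :=
  squeeze_zero (fun _ => norm_nonneg _) (fun _ => norm_add_le _ _) (by simpa using hf.add hg)

theorem inner_localize {F : ℝ → ℝ} (hF : IsDyadicCutoff F) (R ρ : ℝ) (f g : L2) :
    inner ℂ f (localize F R ρ g) =
      inner ℂ (fourierMult (freqCut F ρ) (mulL2 (spaceCut F R) f)) g := by
  have e1 : (fun x => starRingEnd ℂ (spaceCut F R x)) = spaceCut F R :=
    funext fun x => Complex.conj_ofReal _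
  have e2 : (fun x => starRingEnd ℂ (freqCut F ρ x)) = freqCut F ρ :=
    funext fun x => Complex.conj_ofReal _
  rw [localize, inner_mulL2 (isSymbol_spaceCut hF R), e1, inner_fourierMult (isSymbol_freqCut hF ρ),
    e2]

/-- Bounded families whose localizations vanish converge weakly to zero. -/
theorem tendsto_inner_of_localize {F : ℝ → ℝ} (hF : IsDyadicCutoff F) {R ρ : ℝ → ℝ}
    (hR : Tendsto R atTop atTop) (hρ : Tendsto ρ atTop atTop) {v : ℝ → L2} {M : ℝ}
    (hM : ∀ᶠ t in atTop, ‖v t‖ ≤ M)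
    (hv : Tendsto (fun t => ‖localize F (R t) (ρ t) (v t)‖) atTop (𝓝 0)) (φ : L2) :
    Tendsto (fun t => inner ℂ φ (v t)) atTop (𝓝 0) := by
  have h1 : Tendsto (fun t => ‖φ - fourierMult (freqCut F (ρ t)) (mulL2 (spaceCut F (R t)) φ)‖)
      atTop (𝓝 0) := by
    have a1 := tendsto_iff_norm_sub_tendsto_zero.1 (tendsto_spaceCut hF hR φ)
    have a2 := tendsto_iff_norm_sub_tendsto_zero.1 (tendsto_freqCut hF hρ φ)
    refine squeeze_zero (fun t => norm_nonneg _) (fun t => ?_) (by simpa using a2.add a1)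
    rw [norm_sub_rev]
    have e : fourierMult (freqCut F (ρ t)) (mulL2 (spaceCut F (R t)) φ) - φ =
        (fourierMult (freqCut F (ρ t)) φ - φ) +
          fourierMult (freqCut F (ρ t)) (mulL2 (spaceCut F (R t)) φ - φ) := by
      rw [fourierMult_sub (isSymbol_freqCut hF _)]
      abel
    rw [e]
    refine (norm_add_le _ _).trans (add_le_add le_rfl ?_)
    simpa using norm_fourierMult_le (isSymbol_freqCut hF (ρ t)) (norm_freqCut_le hF (ρ t))
      (mulL2 (spaceCut F (R t)) φ - φ)
  have h2 : Tendsto (fun t => ‖φ - fourierMult (freqCut F (ρ t)) (mulL2 (spaceCut F (R t)) φ)‖ * M +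
      ‖φ‖ * ‖localize F (R t) (ρ t) (v t)‖) atTop (𝓝 0) := by
    simpa using (h1.mul_const M).add (hv.const_mul ‖φ‖)
  refine squeeze_zero_norm' ?_ h2
  filter_upwards [hM] with t ht
  have e : (inner ℂ φ (v t) : ℂ) =
      inner ℂ (φ - fourierMult (freqCut F (ρ t)) (mulL2 (spaceCut F (R t)) φ)) (v t) +
        inner ℂ φ (localize F (R t) (ρ t) (v t)) := by
    rw [inner_localize hF, inner_sub_left, sub_add_cancel]
  rw [e]
  refine (norm_add_le _ _).trans (add_le_add ?_ (norm_inner_le_norm _ _))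
  refine (norm_inner_le_norm _ _).trans ?_
  gcongr

end FreeChannel

end

/-! ### Convergence in H¹ and asymptotic orthogonality. -/

open FreeChannel in
theorem mainTheorem2
    (F : ℝ → ℝ) (hF : IsDyadicCutoff F)
    (σ : ℝ) (hσ : 2 < σ) (V : ℝ → ℝ → ℂ) (hV : IsDecayingPotential σ V)
    (u : ℝ → L2) (hu : IsSolution V u)
    (hbdd : ∃ M : ℝ≥0, ∀ t : ℝ, 0 ≤ t → h1Norm (u t) ≤ M)
    (α δ : ℝ) (hα : 0 < α) (hα1 : α < 1) (hδ : 0 < δ) (hδ1 : δ < min (1 / 2) (1 - α)) :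
    ∃ uPlus : L2, h1Norm uPlus < ⊤ ∧
      (∀ t : ℝ, 0 < t → h1Norm (freeProp t (Jfree F α δ t (u t))) < ⊤) ∧
      Tendsto (fun t : ℝ => h1Norm (freeProp t (Jfree F α δ t (u t)) - uPlus)) atTop (𝓝 0) ∧
      Tendsto (fun t : ℝ => h1Norm (u t - (uWb F α δ u t + freeProp (-t) uPlus))) atTop (𝓝 0) ∧
      ∀ φ : L2, h1Norm φ < ⊤ →
        Tendsto (fun t : ℝ => inner ℂ (freeProp (-t) φ) (uWb F α δ u t)) atTop (𝓝 0) := by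
  obtain ⟨M, hM⟩ := hbdd
  have hex : ∀ t, ∃ g, 0 ≤ t → IsWeakDeriv (u t) g := fun t => by
    by_cases ht : 0 ≤ t
    · obtain ⟨g, hg⟩ := exists_isWeakDeriv ((hM t ht).trans_lt ENNReal.coe_lt_top)
      exact ⟨g, fun _ => hg⟩
    · exact ⟨0, fun h => absurd h ht⟩
  choose g hg using hex
  have hδ2 : δ < 1 / 2 := hδ1.trans_le (min_le_left _ _)
  have hδα : δ < 1 - α := hδ1.trans_le (min_le_right _ _)
  -- The Gaussian scale must contain the cutoff scale (α ≤ β), beat the commutator (δ < β) and leave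
  -- room for decay (β + δ < 1). For β = max(α, 1/2) these are the hypotheses δ < 1/2 and δ < 1 - α.
  obtain ⟨β, hαβ, hδβ, hβδ⟩ : ∃ β : ℝ, α ≤ β ∧ δ < β ∧ β + δ < 1 :=
    ⟨max α (1 / 2), le_max_left _ _, hδ2.trans_le (le_max_right _ _), by
      rcases max_choice α (1 / 2) with h | h <;> rw [h] <;> linarith⟩
  have hMu : ∀ t, 0 ≤ t → ‖u t‖ ≤ M := fun t ht => (norm_le_of_h1Norm_le (hg t ht) (hM t ht)).1
  have hMg : ∀ t, 0 ≤ t → ‖g t‖ ≤ M := fun t ht => (norm_le_of_h1Norm_le (hg t ht) (hM t ht)).2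
  obtain ⟨uP, gP, hP, k, C, γ, hC0, hγ, hdecay⟩ :=
    exists_scattering_state hσ hV hu hg hMu hMg hδ.le hδ2 hβδ
  obtain ⟨Λ, hΛ0, hΛ⟩ := exists_isWeakDeriv_localize hF
  have hR : Tendsto (fun t : ℝ => t ^ α) atTop atTop := tendsto_rpow_atTop hα
  have hρ : Tendsto (fun t : ℝ => t ^ δ) atTop atTop := tendsto_rpow_atTop hδ
  have hnw : ∀ t, 0 ≤ t → ‖freeProp t (u t)‖ ≤ M := fun t ht =>
    (norm_freeProp_le _ _).trans (hMu t ht)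
  have hvu : ∀ t, 1 ≤ t → ‖freeProp t (u t) - uP‖ ≤ M + ‖uP‖ := fun t ht =>
    (norm_sub_le _ _).trans (add_le_add (hnw t (zero_le_one.trans ht)) le_rfl)
  have hvg : ∀ t, 1 ≤ t → ‖freeProp t (g t) - gP‖ ≤ M + ‖gP‖ := fun t ht =>
    (norm_sub_le _ _).trans (add_le_add ((norm_freeProp_le _ _).trans
      (hMg t (zero_le_one.trans ht))) le_rfl)
  have hlu := tendsto_norm_localize hF hαβ hδβ hγ hvu fun t ht => (hdecay t ht).1
  have hlg := tendsto_norm_localize hF hαβ hδβ hγ hvg fun t ht => (hdecay t ht).2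
  -- Vanishing of the localized difference suffices, since the localization of the fixed function
  -- `f` tends to `f`.
  have hlim : ∀ (w : ℝ → L2) (f : L2),
      Tendsto (fun t => ‖localize F (t ^ α) (t ^ δ) (w t - f)‖) atTop (𝓝 0) →
      Tendsto (fun t => ‖localize F (t ^ α) (t ^ δ) (w t) - f‖) atTop (𝓝 0) := by
    intro w f h
    have := tendsto_norm_add_zero h
      (tendsto_iff_norm_sub_tendsto_zero.1 (tendsto_localize hF hR hρ f))
    refine this.congr fun t => ?_
    rw [localize_sub hF, sub_add_sub_cancel]
  have hex' : ∀ t, ∃ e, 0 < t → IsWeakDeriv (localize F (t ^ α) (t ^ δ) (freeProp t (u t)))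
      (e + localize F (t ^ α) (t ^ δ) (freeProp t (g t))) ∧
        ‖e‖ ≤ Λ / t ^ α * ‖freeProp t (u t)‖ := fun t => by
    by_cases ht : 0 < t
    · obtain ⟨e, he⟩ := hΛ (t ^ δ) (by positivity : 0 < t ^ α) ((hg t ht.le).freeProp t)
      exact ⟨e, fun _ => he⟩
    · exact ⟨0, fun h => absurd h ht⟩
  choose e he using hex'
  have he0 : Tendsto (fun t => ‖e t‖) atTop (𝓝 0) := by
    have h1 : Tendsto (fun t : ℝ => Λ / t ^ α * M) atTop (𝓝 0) := by
      simpa using (hR.const_div_atTop Λ).mul_const (M : ℝ)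
    refine squeeze_zero' (Eventually.of_forall fun t => norm_nonneg _) ?_ h1
    filter_upwards [eventually_gt_atTop 0] with t ht
    refine (he t ht).2.trans ?_
    gcongr
    exact hnw t ht.le
  have hr := hlim _ _ hlu
  have hd : Tendsto (fun t => ‖e t + localize F (t ^ α) (t ^ δ) (freeProp t (g t)) - gP‖) atTop
      (𝓝 0) := by
    refine (tendsto_norm_add_zero he0 (hlim _ _ hlg)).congr fun t => ?_
    rw [add_sub_assoc]
  have hJ : ∀ t, 0 < t → freeProp t (Jfree F α δ t (u t)) =
      localize F (t ^ α) (t ^ δ) (freeProp t (u t)) := fun t ht => freeProp_Jfree hF ht _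
  have hrJ : Tendsto (fun t => ‖freeProp t (Jfree F α δ t (u t)) - uP‖) atTop (𝓝 0) := by
    refine hr.congr' ?_
    filter_upwards [eventually_gt_atTop 0] with t ht
    rw [hJ t ht]
  have hwd : ∀ t, 0 < t → IsWeakDeriv (freeProp t (Jfree F α δ t (u t)) - uP)
      (e t + localize F (t ^ α) (t ^ δ) (freeProp t (g t)) - gP) := fun t ht => by
    rw [hJ t ht]
    exact (he t ht).1.sub hP
  refine ⟨uP, (h1Norm_le hP).trans_lt ENNReal.ofReal_lt_top, fun t ht => ?_, ?_, ?_, ?_⟩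
  · rw [hJ t ht]
    exact (h1Norm_le (he t ht).1).trans_lt ENNReal.ofReal_lt_top
  · refine tendsto_h1Norm ?_ hrJ hd
    filter_upwards [eventually_gt_atTop 0] with t ht using hwd t ht
  -- The remainder is the backward free evolution of the error in the limit defining u₊, and the
  -- free flow preserves weak derivatives without increasing L² norms.
  · have hid : ∀ t, u t - (uWb F α δ u t + freeProp (-t) uP) =
        freeProp (-t) (freeProp t (Jfree F α δ t (u t)) - uP) := fun t => by
      rw [freeProp_sub, freeProp_freeProp, neg_add_cancel, freeProp_zero, uWb]
      abel
    simp_rw [hid]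
    refine tendsto_h1Norm (g := fun t => freeProp (-t)
      (e t + localize F (t ^ α) (t ^ δ) (freeProp t (g t)) - gP)) ?_ ?_ ?_
    · filter_upwards [eventually_gt_atTop 0] with t ht using (hwd t ht).freeProp (-t)
    · exact squeeze_zero (fun _ => norm_nonneg _) (fun t => norm_freeProp_le _ _) hrJ
    · exact squeeze_zero (fun _ => norm_nonneg _) (fun t => norm_freeProp_le _ _) hd
  · intro φ _
    have h1 := tendsto_inner_of_localize hF hR hρ (by
      filter_upwards [eventually_ge_atTop 1] with t ht using hvu t ht) hlu φ
    have h2 : Tendsto (fun t => (inner ℂ φ (freeProp t (Jfree F α δ t (u t)) - uP) : ℂ)) atTop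
        (𝓝 0) := by
      refine squeeze_zero_norm (fun t => norm_inner_le_norm _ _) ?_
      simpa using hrJ.const_mul ‖φ‖
    -- In the interaction picture u_wb is (w - u₊) minus (e^{itΔ}J_free u - u₊): the first tends
    -- weakly to 0 and the second strongly.
    refine (by simpa using h1.sub h2 : Tendsto (fun t => (inner ℂ φ (freeProp t (u t) - uP) : ℂ) -
      inner ℂ φ (freeProp t (Jfree F α δ t (u t)) - uP)) atTop (𝓝 0)).congr fun t => ?_
    rw [inner_freeProp_neg, uWb, freeProp_sub, ← inner_sub_right]
    congr 1
    abel
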